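/- **Definitions.** Alphabets are finite and non-empty, and $\square$ is a padding symbol outside the alphabet under consideration. Let $w\ge 1$. A *$(\Lambda,w)$-layer* over an alphabet $\Lambda$ is a tuple $B=(\ell,r,T,I,F,\iota,\phi)$ with left and right frontiers $\ell,r\subseteq\{0,\dots,w-1\}$, transitions $T\subseteq \ell\times(\Lambda\cup\{\square\})\times r$, initial states $I\subseteq\ell$, final states $F\subseteq r$, and Boolean flags $\iota,\phi$ such that $I=\emptyset$ if $\iota$ is false and $F=\emptyset$ if $\phi$ is false. Let $\mathcal B(\Lambda,w)$ be the finite set of these layers. A *$(\Lambda,w)$-ODD* of length $k\ge 1$ is a string $D=B_1\cdots B_k$ of layers such that the left frontier of $B_{i+1}$ is the right frontier of $B_i$, exactly $B_1$ has a true initial flag, and exactly $B_k$ has a true final flag. Its language $L(D)$ consists of the strings over $\Lambda$ of length between $1$ and $k$ which, padded with $\square$ to length $k$, label a path of transitions (the $i$-th in $B_i$) from an initial state of $B_1$ to a final state of $B_k$. The tensor product $u_1\otimes\cdots\otimes u_r$ of strings over $\Sigma$ is the string of $r$-tuples obtained by padding the $u_j$ with $\square$ to their maximal length; it is a string over $\Sigma_r:=(\Sigma\cup\{\square\})^r$.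 For a language $L$ over $\Sigma$ put $L^{\otimes r}:=\{u_1\otimes\cdots\otimes u_r : u_1,\dots,u_r\in L\}$. Let $\tau=(R_1,\dots,R_l)$ be a relational vocabulary, $R_i$ of arity $a_i\ge 1$. A tuple $(D_0,\dots,D_l)$ is *$(\Sigma,w,\tau)$-structural* if, for some $k\ge1$, $D_0$ is a $(\Sigma,w)$-ODD of length $k$, each $D_i$ is a $(\Sigma_{a_i},w)$-ODD of length $k$, and $L(D_i)\subseteq L(D_0)^{\otimes a_i}$ for $1\le i\le l$. The *derived structure* has domain $L(D_0)$, and its $i$-th relation is $\{(u_1,\dots,u_{a_i}) : u_1\otimes\cdots\otimes u_{a_i}\in L(D_i)\}$. Let $\Gamma=\mathcal B(\Sigma,w)\times\mathcal B(\Sigma_{a_1},w)\times\cdots\times\mathcal B(\Sigma_{a_l},w)$; a string over $\Gamma$ is the same as a tuple of $l+1$ strings of layers of equal length. A nondeterministic finite automaton $\mathcal A$ over $\Gamma$, with state set $Q$ and transition set $\Delta$, has size $|\mathcal A|=|Q|+|\Delta|\log_2|\Gamma|$. It *represents* a class $\mathcal C$ of finite $\tau$-structures (with non-empty domain) if every non-empty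 string that it accepts is a structural tuple, and $\mathcal C$ is the class of all finite $\tau$-structures with non-empty domain that are isomorphic to the structure derived from one of these tuples. A class is *$(\Sigma,w)$-regular-decisional* if some finite automaton over $\Gamma$ represents it. **Theorem.** There are a single algorithm (a program of a random access machine with unit-cost addition, subtraction, indirect addressing and conditional jumps) and a computable function $f$ such that the following holds. Let $\Sigma$ be an alphabet, $w\ge 1$, $\tau$ a relational vocabulary, $\varphi$ a first-order sentence (with equality) over $\tau$, and $\mathcal A$ a finite automaton over $\Gamma$ that represents a class $\mathcal C$ of finite $\tau$-structures. Given $\Sigma,w,\tau,\varphi$ and $\mathcal A$, the algorithm decides in at most $f(\Sigma,w,\tau,\varphi)\cdot\max(1,|\mathcal A|)$ steps whether some structure in $\mathcal C$ satisfies $\varphi$. (So the time is linear in $|\mathcal A|$ for fixed $\Sigma,w,\tau,\varphi$; the maximum matters only if $\mathcal A$ has no states.) Moreover, for every $(\Sigma,w)$-regular-decisional class $\mathcal C$ of finite $\tau$-structures, the first-order theory of $\mathcal C$, that is, the set of first-order sentences over $\tau$ that are satisfied by at least one structure in $\mathcal C$, is decidable. -/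

import Mathlib

namespace Decisional

open CategoryTheory FirstOrder

/-! ### Vocabularies, structures and codes of sentences -/

/-- A relational vocabulary: finitely many relation symbols, each of positive arity. -/
structure Vocabulary where
  num : ℕ
  arity : Fin num → ℕ
  arity_pos : ∀ i, 0 < arity i

/-- The first-order language with exactly the relation symbols of `τ` (and no function symbol). -/
def Vocabulary.language (τ : Vocabulary) : FirstOrder.Language.{0, 0} where
  Functions := fun _ => Empty
  Relations := fun r => {i : Fin τ.num // τ.arity i = r}

/-- The list of arities of a vocabulary. -/
def Vocabulary.code (τ : Vocabulary) : List ℕ :=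
  List.ofFn τ.arity

/-- A term of a relational language without free variables is a bound variable; its index. -/
def varIndex {τ : Vocabulary} {n : ℕ} : τ.language.Term (Empty ⊕ Fin n) → ℕ
  | .var (.inl e) => e.elim
  | .var (.inr i) => i
  | .func f _ => Empty.elim f

/-- Prefix code of a formula. -/
def formulaCode {τ : Vocabulary} : {n : ℕ} → τ.language.BoundedFormula Empty n → List ℕ
  | _, .falsum => [0]
  | _, .equal t₁ t₂ => [1, varIndex t₁, varIndex t₂]
  | _, .rel R ts => 2 :: (R.1 : ℕ) :: List.ofFn fun j => varIndex (ts j)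
  | _, .imp φ ψ => 3 :: (formulaCode φ ++ formulaCode ψ)
  | _, .all φ => 4 :: formulaCode φ

/-- The code of a sentence as a list of natural numbers. -/
def sentenceCode {τ : Vocabulary} (φ : τ.language.Sentence) : List ℕ :=
  formulaCode (n := 0) φ

/-! ### Ordered decision diagrams -/

/-- A layer of width at most `w` over the alphabet `α`. In the label of a transition, `none` is
the padding symbol of the alphabet. -/
structure Layer (α : Type) (w : ℕ) where
  left : Finset (Fin w)
  right : Finset (Fin w)
  trans : Finset (Fin w × Option α × Fin w)
  init : Finset (Fin w)
  final : Finset (Fin w)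
  initFlag : Bool
  finalFlag : Bool
  trans_left : ∀ t ∈ trans, t.1 ∈ left
  trans_right : ∀ t ∈ trans, t.2.2 ∈ right
  init_subset : init ⊆ left
  final_subset : final ⊆ right
  init_empty : initFlag = false → init = ∅
  final_empty : finalFlag = false → final = ∅

/-- A (nonempty) string of layers is an ordered decision diagram. -/
def IsODD {α : Type} {w : ℕ} (D : List (Layer α w)) : Prop :=
  D ≠ [] ∧
  (∀ (i : ℕ) (h : i + 1 < D.length), (D[i + 1]).left = (D[i]).right) ∧
  (∀ (i : ℕ) (h : i < D.length), (D[i]).initFlag = true ↔ i = 0) ∧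
  (∀ (i : ℕ) (h : i < D.length), (D[i]).finalFlag = true ↔ i + 1 = D.length)

/-- `t` is an accepting sequence of transitions for the string `u` in `D`; the string is padded
to the length of `D`. -/
def IsAcceptingSeq {α : Type} {w : ℕ} (D : List (Layer α w)) (u : List α)
    (t : Fin D.length → Fin w × Option α × Fin w) : Prop :=
  (∀ i, (t i).2.1 = u[(i : ℕ)]?) ∧
  (∀ i, t i ∈ (D[i]).trans) ∧
  (∀ i j : Fin D.length, (j : ℕ) = i + 1 → (t j).1 = (t i).2.2) ∧
  (∀ i : Fin D.length, (i : ℕ) = 0 → (t i).1 ∈ (D[i]).init) ∧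
  (∀ i : Fin D.length, (i : ℕ) + 1 = D.length → (t i).2.2 ∈ (D[i]).final)

/-- The language of an ordered decision diagram: the nonempty strings, of length at most the
length of the diagram, that have an accepting sequence. -/
def oddLang {α : Type} {w : ℕ} (D : List (Layer α w)) : Set (List α) :=
  {u | u ≠ [] ∧ u.length ≤ D.length ∧ ∃ t, IsAcceptingSeq D u t}

/-- The tensor product (convolution) `u₁ ⊗ ⋯ ⊗ uᵣ` of strings over `α`: a string over
`(α ⊔ {padding})ʳ`, whose length is the maximum of the lengths. -/
def tensor {α : Type} {r : ℕ} (u : Fin r → List α) : List (Fin r → Option α) :=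
  (List.range (Finset.univ.sup fun j => (u j).length)).map fun i j => (u j)[i]?

/-- The tensor power of a language. -/
def tensorPower {α : Type} (L : Set (List α)) (r : ℕ) : Set (List (Fin r → Option α)) :=
  {s | ∃ u : Fin r → List α, (∀ j, u j ∈ L) ∧ tensor u = s}

/-! ### Tuples of diagrams and the structures derived from them -/

/-- A tuple `(D₀, D₁, …, Dₗ)`: a string of layers over `α`, and for each relation symbol of arity
`r` a string of layers over the alphabet in which tensor products of `r` strings are written. -/
structure DiagramTuple (α : Type) (w : ℕ) (τ : Vocabulary) where
  dom : List (Layer α w)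
  rel : ∀ i : Fin τ.num, List (Layer (Fin (τ.arity i) → Option α) w)

/-- Structural tuples. -/
def DiagramTuple.IsStructural {α : Type} {w : ℕ} {τ : Vocabulary} (T : DiagramTuple α w τ) :
    Prop :=
  IsODD T.dom ∧
  (∀ i, IsODD (T.rel i) ∧ (T.rel i).length = T.dom.length) ∧
  ∀ i, oddLang (T.rel i) ⊆ tensorPower (oddLang T.dom) (τ.arity i)

/-- The domain of the structure derived from a tuple. -/
def DiagramTuple.Domain {α : Type} {w : ℕ} {τ : Vocabulary} (T : DiagramTuple α w τ) : Type :=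
  {u : List α // u ∈ oddLang T.dom}

/-- The structure derived from a tuple: a tuple of elements is in the `i`-th relation iff its
tensor product is in the language of the `i`-th diagram. -/
instance DiagramTuple.derivedStructure {α : Type} {w : ℕ} {τ : Vocabulary}
    (T : DiagramTuple α w τ) : τ.language.Structure T.Domain where
  funMap := fun f _ => Empty.elim f
  RelMap := fun {_} R x => tensor (fun j => (x (Fin.cast R.2 j)).1) ∈ oddLang (T.rel R.1)

/-- A set of tuples defines the class of all nonempty finite structures that are isomorphic to
the structure derived from a tuple of the set. -/
def classOf {α : Type} {w : ℕ} {τ : Vocabulary} (R : Set (DiagramTuple α w τ)) :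
    Set (Bundled.{0} τ.language.Structure) :=
  {S | Finite S ∧ Nonempty S ∧ ∃ T ∈ R, Nonempty (T.Domain ≃[τ.language] S)}

/-! ### Finite automata over the layer alphabet -/

/-- The layer alphabet: tuples of one layer for the domain and one for each relation symbol. -/
abbrev LayerAlphabet (α : Type) (w : ℕ) (τ : Vocabulary) : Type :=
  Layer α w × (∀ i : Fin τ.num, Layer (Fin (τ.arity i) → Option α) w)

/-- The tuple `(D₀, D₁, …, Dₗ)` of strings of layers with `D₀ ⊗ D₁ ⊗ ⋯ ⊗ Dₗ = z`. -/
def tupleOfString {α : Type} {w : ℕ} {τ : Vocabulary} (z : List (LayerAlphabet α w τ)) :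
    DiagramTuple α w τ where
  dom := z.map fun a => a.1
  rel := fun i => z.map fun a => a.2 i

/-- A finite automaton over `Γ` with states `0, …, n - 1`. -/
structure FinAut (Γ : Type) (n : ℕ) where
  trans : Finset (Fin n × Γ × Fin n)
  init : Finset (Fin n)
  final : Finset (Fin n)

/-- The automaton as a nondeterministic automaton of Mathlib. -/
def FinAut.toNFA {Γ : Type} {n : ℕ} (A : FinAut Γ n) : NFA Γ (Fin n) where
  step := fun p a => {q | (p, a, q) ∈ A.trans}
  start := {p | p ∈ A.init}
  accept := {p | p ∈ A.final}

/-- The set of nonempty strings accepted by the automaton. -/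
def FinAut.lang {Γ : Type} {n : ℕ} (A : FinAut Γ n) : Set (List Γ) :=
  {z | z ≠ [] ∧ z ∈ A.toNFA.accepts}

/-- The size `|Q| + |Δ| log |Γ|` of an automaton. -/
noncomputable def FinAut.size {Γ : Type} {n : ℕ} (A : FinAut Γ n) : ℝ :=
  n + A.trans.card * Real.logb 2 (Nat.card Γ)

/-- The automaton represents the class `C`: all tuples in the relation associated with its
language are structural, and the class they define is `C`. -/
def Represents {α : Type} {w : ℕ} {τ : Vocabulary} {n : ℕ} (A : FinAut (LayerAlphabet α w τ) n)
    (C : Set (Bundled.{0} τ.language.Structure)) : Prop :=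
  (∀ T ∈ tupleOfString '' A.lang, T.IsStructural) ∧ C = classOf (tupleOfString '' A.lang)

/-- The `(α, w)`-regular-decisional classes of finite structures. -/
def IsRegularDecisional (α : Type) (w : ℕ) {τ : Vocabulary}
    (C : Set (Bundled.{0} τ.language.Structure)) : Prop :=
  ∃ (n : ℕ) (A : FinAut (LayerAlphabet α w τ) n), Represents A C

/-! ### Random access machines with unit costs -/

/-- Instructions. Registers and memory cells hold natural numbers; subtraction is truncated;
`load` and `store` address the memory by the content of a register. -/
inductive Instr where
  | const (r c : ℕ)
  | add (r a b : ℕ)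
  | sub (r a b : ℕ)
  | load (r a : ℕ)
  | store (a r : ℕ)
  | jumpZero (r target : ℕ)

abbrev Program : Type := List Instr

structure MachineState where
  pc : ℕ
  reg : ℕ → ℕ
  mem : ℕ → ℕ

/-- The effect of one instruction. -/
def Instr.exec (σ : MachineState) : Instr → MachineState
  | .const r c => ⟨σ.pc + 1, Function.update σ.reg r c, σ.mem⟩
  | .add r a b => ⟨σ.pc + 1, Function.update σ.reg r (σ.reg a + σ.reg b), σ.mem⟩
  | .sub r a b => ⟨σ.pc + 1, Function.update σ.reg r (σ.reg a - σ.reg b), σ.mem⟩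
  | .load r a => ⟨σ.pc + 1, Function.update σ.reg r (σ.mem (σ.reg a)), σ.mem⟩
  | .store a r => ⟨σ.pc + 1, σ.reg, Function.update σ.mem (σ.reg a) (σ.reg r)⟩
  | .jumpZero r target => ⟨if σ.reg r = 0 then target else σ.pc + 1, σ.reg, σ.mem⟩

/-- One step of computation; the machine rests when the program counter has left the program. -/
def Program.step (P : Program) (σ : MachineState) : MachineState :=
  match P[σ.pc]? with
  | some c => c.exec σ
  | none => σ

/-- At the start the registers are zero and the memory holds the input, followed by zeros. -/
def initialState (x : List ℕ) : MachineState where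
  pc := 0
  reg := fun _ => 0
  mem := fun i => x[i]?.getD 0

/-- On input `x` the program halts after at most `t` steps, with the answer to the question
whether `p` holds (1 for yes, 0 for no) in register 0. -/
def Program.DecidesInTime (P : Program) (x : List ℕ) (t : ℝ) (p : Prop) : Prop :=
  ∃ k : ℕ, (k : ℝ) ≤ t ∧
    P.length ≤ ((P.step)^[k] (initialState x)).pc ∧
    (p → ((P.step)^[k] (initialState x)).reg 0 = 1) ∧
    (¬ p → ((P.step)^[k] (initialState x)).reg 0 = 0)

/-! ### The input of the machine -/

/-- The elements of `(Fin s ⊔ {padding})ʳ`, in lexicographic order read from the last coordinate,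
with the padding symbol first. -/
def tensorLetters (s r : ℕ) : List (Fin r → Option (Fin s)) :=
  (List.finRange ((s + 1) ^ r)).map fun c j => finSuccEquiv s (finFunctionFinEquiv.symm c j)

/-- A layer as a list of zeros and ones, given a list of all letters of the alphabet. -/
def layerCode {α : Type} [DecidableEq α] {w : ℕ} (letters : List α) (B : Layer α w) : List ℕ :=
  ((List.finRange w).map fun p => if p ∈ B.left then 1 else 0) ++
  ((List.finRange w).map fun p => if p ∈ B.right then 1 else 0) ++
  ((List.finRange w).flatMap fun p => (none :: letters.map some).flatMap fun a =>
    (List.finRange w).map fun q => if (p, a, q) ∈ B.trans then 1 else 0) ++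
  ((List.finRange w).map fun p => if p ∈ B.init then 1 else 0) ++
  ((List.finRange w).map fun p => if p ∈ B.final then 1 else 0) ++
  [B.initFlag.toNat, B.finalFlag.toNat]

/-- A symbol of the layer alphabet as a list of zeros and ones. -/
def symbolCode {s w : ℕ} {τ : Vocabulary} (a : LayerAlphabet (Fin s) w τ) : List ℕ :=
  layerCode (List.finRange s) a.1 ++
  (List.finRange τ.num).flatMap fun i => layerCode (tensorLetters s (τ.arity i)) (a.2 i)

/-- The part of the input that describes the alphabet, the width, the vocabulary and the
sentence. -/
def parameterInput (s w : ℕ) (τ : Vocabulary) (φ : τ.language.Sentence) : List ℕ :=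
  s :: w :: τ.num :: (τ.code ++ (sentenceCode φ).length :: sentenceCode φ)

/-- The part of the input that describes the automaton, whose transitions are listed in `l`: the
number of states, the number of transitions, for each state whether it is initial and whether it
is final, and the transitions. -/
def automatonInput {s w : ℕ} {τ : Vocabulary} {n : ℕ} (A : FinAut (LayerAlphabet (Fin s) w τ) n)
    (l : List (Fin n × LayerAlphabet (Fin s) w τ × Fin n)) : List ℕ :=
  n :: l.length ::
    (((List.finRange n).map fun p => if p ∈ A.init then 1 else 0) ++
     ((List.finRange n).map fun p => if p ∈ A.final then 1 else 0) ++
     l.flatMap fun t => (t.1 : ℕ) :: (t.2.2 : ℕ) :: symbolCode t.2.1)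

end Decisional

open Decisional

/-!
Every string of layers accepted by the given automaton determines a finite structure whose elements
are strings, and whose domain and relations are recognized by ordered decision diagrams, that is, by
nondeterministic automata that change from position to position. So, for fixed parameters, a finite
automaton that reads a string of symbols of the layer alphabet together with an assignment of
strings to variables, on one track for each variable, can check an atomic formula: it simulates
the diagram whose layers it reads (`oddAut`, `accepts_oddAut`). Connectives and quantifiers are
operations on automata: complement by the subset construction, disjoint union, product, and
projection to the other tracks. This gives an automaton for each formula (`formulaAut`,
`accepts_formulaAut`), hence for each sentence an automaton that reads a string of symbols only, and
accepts iff the derived structure is nonempty and satisfies the sentence (`accepts_codeAut`). Some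
structure in the class satisfies the sentence iff the product of this automaton with the given one
has an accepting path (`reflTransGen_iff_exists_realize`, `exists_classOf_realize`). Isomorphism and
the finiteness of the structures play no role beyond the invariance of truth.

The machine first computes the automaton of the sentence, in a time that depends only on the
parameters. No program for this is written out: the automaton is a primitive recursive function of
the alphabet, the width, the arities and the code of the sentence (`primrec_compiledAut`), and every
primitive recursive function is computed by some program, in a time bounded by a primitive
recursive function (`exists_realizesIn`). Then the machine reads the given automaton once, and for
each of its transitions adds to a graph in adjacency lists the boundedly many edges of the product
to which it gives rise (`Ready.wp_transLoop`). Finally it searches the graph, depth first, with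
bounded effort for each edge (`wp_search`). The total is linear in the number of states and
transitions (`wp_decideRealized`), and this number is at most the size of the automaton, because the layer
alphabet has at least two elements (`add_length_le_size`).

Programs are written in a structured language with loops and arrays, are verified by weakest
preconditions in which a clock counts the steps, and are compiled to the machine (`Exec.sim`). In a
verification, `reg i` is a register of this language; once they are set, the registers `0` and `1`
hold the length of the input and the constant `1`.

For the decidability of the theory, the code of a sentence is recognized by a parser
(`exists_sentenceCode_iff`). The program is then run for as many steps as its computable time bound
allows; such runs are primitive recursive functions of the input and the number of steps
(`primrec_run`).
-/

namespace Decisional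

/-! ### A structured language for the machine -/

/-- The state of a structured computation: registers, arrays of unbounded length, and a clock that
counts machine steps. -/
structure Store where
  reg : ℕ → ℕ
  arr : ℕ → ℕ → ℕ
  time : ℕ

namespace Store

/-- Let `t` steps pass. -/
def tick (σ : Store) (t : ℕ) : Store := ⟨σ.reg, σ.arr, σ.time + t⟩

/-- Set register `r` to `v`, in `t` steps. -/
def set (σ : Store) (r v t : ℕ) : Store := ⟨Function.update σ.reg r v, σ.arr, σ.time + t⟩

/-- Set cell `i` of array `j` to `v`, in `t` steps. -/
def put (σ : Store) (j i v t : ℕ) : Store :=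
  ⟨σ.reg, Function.update σ.arr j (Function.update (σ.arr j) i v), σ.time + t⟩

variable (σ : Store) (r v t j i : ℕ)

@[simp] theorem tick_reg : (σ.tick t).reg = σ.reg := rfl
@[simp] theorem tick_arr : (σ.tick t).arr = σ.arr := rfl
@[simp] theorem tick_time : (σ.tick t).time = σ.time + t := rfl
@[simp] theorem set_reg (k : ℕ) : (σ.set r v t).reg k = if k = r then v else σ.reg k := by
  simp [set, Function.update_apply]
@[simp] theorem set_arr : (σ.set r v t).arr = σ.arr := rfl
@[simp] theorem set_time : (σ.set r v t).time = σ.time + t := rfl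
@[simp] theorem put_reg : (σ.put j i v t).reg = σ.reg := rfl
@[simp] theorem put_arr (k l : ℕ) :
    (σ.put j i v t).arr k l = if k = j ∧ l = i then v else σ.arr k l := by
  by_cases h : k = j
  · subst h; simp [put, Function.update_apply]
  · simp [put, h]
@[simp] theorem put_time : (σ.put j i v t).time = σ.time + t := rfl

end Store

/-- Structured commands. The input is read by `get`, cells of the arrays are accessed by `load` and
`store`, and a loop runs as long as its register is not zero. -/
inductive Cmd where
  | const (r c : ℕ)
  | add (r a b : ℕ)
  | sub (r a b : ℕ)
  | get (r a : ℕ)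
  | load (r j a : ℕ)
  | store (j a r : ℕ)
  | seq (c d : Cmd)
  | ite (r : ℕ) (c d : Cmd)
  | loop (r : ℕ) (c : Cmd)

infixr:60 " ;; " => Cmd.seq

/-- Big-step semantics, with the time that the compiled code takes. The input `inp` occupies the
memory below `base`, and is never written to. Accesses to arrays require that register `0` holds
`base`, since it takes part in the computation of addresses; at most eight arrays are available. -/
inductive Exec (inp : ℕ → ℕ) (base : ℕ) : Cmd → Store → Store → Prop where
  | const (r c σ) : Exec inp base (.const r c) σ (σ.set r c 1)
  | add (r a b σ) : Exec inp base (.add r a b) σ (σ.set r (σ.reg a + σ.reg b) 1)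
  | sub (r a b σ) : Exec inp base (.sub r a b) σ (σ.set r (σ.reg a - σ.reg b) 1)
  | get (r a σ) (h : σ.reg a < base) : Exec inp base (.get r a) σ (σ.set r (inp (σ.reg a)) 1)
  | load (r j a σ) (h : σ.reg 0 = base) (hj : j < 8) :
      Exec inp base (.load r j a) σ (σ.set r (σ.arr j (σ.reg a)) 7)
  | store (j a r σ) (h : σ.reg 0 = base) (hj : j < 8) :
      Exec inp base (.store j a r) σ (σ.put j (σ.reg a) (σ.reg r) 7)
  | seq {c d σ σ₁ σ₂} (h₁ : Exec inp base c σ σ₁) (h₂ : Exec inp base d σ₁ σ₂) :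
      Exec inp base (.seq c d) σ σ₂
  | ite_pos {r c d σ σ₁} (h : σ.reg r ≠ 0) (h₁ : Exec inp base c (σ.tick 1) σ₁) :
      Exec inp base (.ite r c d) σ (σ₁.tick 1)
  | ite_neg {r c d σ σ₁} (h : σ.reg r = 0) (h₁ : Exec inp base d (σ.tick 1) σ₁) :
      Exec inp base (.ite r c d) σ σ₁
  | loop_pos {r c σ σ₁ σ₂} (h : σ.reg r ≠ 0) (h₁ : Exec inp base c (σ.tick 1) σ₁)
      (h₂ : Exec inp base (.loop r c) (σ₁.tick 1) σ₂) : Exec inp base (.loop r c) σ σ₂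
  | loop_neg {r c σ} (h : σ.reg r = 0) : Exec inp base (.loop r c) σ (σ.tick 1)

namespace Cmd

/-- The number of instructions of the compiled code. -/
def len : Cmd → ℕ
  | const _ _ | add _ _ _ | sub _ _ _ | get _ _ => 1
  | load _ _ _ | store _ _ _ => 7
  | seq c d => c.len + d.len
  | ite _ c d => c.len + d.len + 2
  | loop _ c => c.len + 2

/-- Put the address `base + 8 * i + j` of cell `i` of array `j` into machine register `0`, where `i`
is the content of register `a`. -/
def addressCode (j a : ℕ) : List Instr :=
  [.add 0 (a + 3) (a + 3), .add 0 0 0, .add 0 0 0, .add 0 0 3, .const 2 j, .add 0 0 2]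

/-- The code of a command that is placed at position `o`. Register `i` is machine register `i + 3`;
the machine registers `0` and `2` are used for addresses, and machine register `1` is always `0`, so
that a conditional jump on it is unconditional. The arrays are interleaved in the memory from
`base` on. -/
def compile : Cmd → ℕ → Program
  | const r c, _ => [.const (r + 3) c]
  | add r a b, _ => [.add (r + 3) (a + 3) (b + 3)]
  | sub r a b, _ => [.sub (r + 3) (a + 3) (b + 3)]
  | get r a, _ => [.load (r + 3) (a + 3)]
  | load r j a, _ => addressCode j a ++ [.load (r + 3) 0]
  | store j a r, _ => addressCode j a ++ [.store 0 (r + 3)]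
  | seq c d, o => c.compile o ++ d.compile (o + c.len)
  | ite r c d, o =>
    .jumpZero (r + 3) (o + c.len + 2) :: (c.compile (o + 1) ++
      .jumpZero 1 (o + c.len + d.len + 2) :: d.compile (o + c.len + 2))
  | loop r c, o => .jumpZero (r + 3) (o + c.len + 2) :: (c.compile (o + 1) ++ [.jumpZero 1 o])

@[simp] theorem length_compile (c : Cmd) (o : ℕ) : (c.compile o).length = c.len := by
  induction c generalizing o with
  | seq c d hc hd => simp [compile, len, hc, hd]
  | ite r c d hc hd => simp [compile, len, hc, hd]; omega
  | loop r c hc => simp [compile, len, hc]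
  | _ => simp [compile, len, addressCode]

end Cmd

/-- The instructions `l` stand in the program `P` from position `o` on. -/
def CodeAt (P : Program) (o : ℕ) (l : List Instr) : Prop := ∀ i < l.length, P[o + i]? = l[i]?

theorem codeAt_append {P : Program} {o : ℕ} {l₁ l₂ : List Instr} :
    CodeAt P o (l₁ ++ l₂) ↔ CodeAt P o l₁ ∧ CodeAt P (o + l₁.length) l₂ := by
  constructor
  · intro h
    refine ⟨fun i hi => ?_, fun i hi => ?_⟩
    · rw [h i (by simp; omega), List.getElem?_append_left hi]
    · rw [add_assoc, h _ (by simp; omega), List.getElem?_append_right (by omega)]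
      simp
  · rintro ⟨h₁, h₂⟩ i hi
    by_cases h : i < l₁.length
    · rw [h₁ i h, List.getElem?_append_left h]
    · rw [List.getElem?_append_right (by omega), ← h₂ _ (by simp at hi; omega)]
      congr 1; omega

theorem codeAt_cons {P : Program} {o : ℕ} {c : Instr} {l : List Instr} :
    CodeAt P o (c :: l) ↔ P[o]? = some c ∧ CodeAt P (o + 1) l := by
  rw [← List.singleton_append, codeAt_append]
  simp [CodeAt]

/-- The machine state `m` represents the store `σ`, with the program counter at `o`. -/
structure Sim (inp : ℕ → ℕ) (base : ℕ) (σ : Store) (o : ℕ) (m : MachineState) : Prop where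
  pc : m.pc = o
  zero : m.reg 1 = 0
  reg : ∀ i, m.reg (i + 3) = σ.reg i
  inp : ∀ i < base, m.mem i = inp i
  arr : ∀ j < 8, ∀ i, m.mem (base + 8 * i + j) = σ.arr j i

theorem step_of_codeAt {P : Program} {m : MachineState} {c : Instr} (h : P[m.pc]? = some c) :
    P.step m = c.exec m := by
  simp [Program.step, h]

theorem addressCode_correct {inp base σ o m} {P : Program} {j a : ℕ} (h : Sim inp base σ o m)
    (hb : σ.reg 0 = base) (hP : CodeAt P o (Cmd.addressCode j a)) :
    ∃ m', P.step^[6] m = m' ∧ Sim inp base σ (o + 6) m' ∧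
      m'.reg 0 = base + 8 * σ.reg a + j := by
  simp only [Cmd.addressCode, codeAt_cons] at hP
  obtain ⟨h0, h1, h2, h3, h4, h5, -⟩ := hP
  obtain ⟨rfl, hz, hr, hi, ha⟩ := h
  simp only [Function.iterate_succ, Function.iterate_zero, Function.comp, id]
  simp only [Program.step, h0, h1, h2, h3, h4, h5, Instr.exec]
  refine ⟨_, rfl, ⟨rfl, by simp [hz], fun i => by simp [hr], hi, ha⟩, ?_⟩
  · have h3 : m.reg 3 = base := (hr 0).trans hb
    simp [hr]; omega

/-- The compiled code of a command does what the command does, in as many steps as the clock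
counts. -/
theorem Exec.sim {inp base} {P : Program} {c : Cmd} {σ σ' : Store} (h : Exec inp base c σ σ') :
    ∀ {o m}, Sim inp base σ o m → CodeAt P o (c.compile o) →
      ∃ k m', σ'.time = σ.time + k ∧ P.step^[k] m = m' ∧ Sim inp base σ' (o + c.len) m' := by
  induction h with
  | const r c σ =>
    rintro o m ⟨rfl, hz, hr, hi, ha⟩ hP
    simp only [Cmd.compile, codeAt_cons] at hP
    refine ⟨1, _, rfl, rfl, ?_⟩
    rw [Function.iterate_one, step_of_codeAt hP.1]
    exact ⟨rfl, by simpa [Instr.exec, Function.update_apply] using hz,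
      fun i => by simp [Instr.exec, Function.update_apply, hr], hi, ha⟩
  | add r a b σ =>
    rintro o m ⟨rfl, hz, hr, hi, ha⟩ hP
    simp only [Cmd.compile, codeAt_cons] at hP
    refine ⟨1, _, rfl, rfl, ?_⟩
    rw [Function.iterate_one, step_of_codeAt hP.1]
    exact ⟨rfl, by simpa [Instr.exec, Function.update_apply] using hz,
      fun i => by simp [Instr.exec, Function.update_apply, hr], hi, ha⟩
  | sub r a b σ =>
    rintro o m ⟨rfl, hz, hr, hi, ha⟩ hP
    simp only [Cmd.compile, codeAt_cons] at hP
    refine ⟨1, _, rfl, rfl, ?_⟩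
    rw [Function.iterate_one, step_of_codeAt hP.1]
    exact ⟨rfl, by simpa [Instr.exec, Function.update_apply] using hz,
      fun i => by simp [Instr.exec, Function.update_apply, hr], hi, ha⟩
  | get r a σ hlt =>
    rintro o m ⟨rfl, hz, hr, hi, ha⟩ hP
    simp only [Cmd.compile, codeAt_cons] at hP
    refine ⟨1, _, rfl, rfl, ?_⟩
    rw [Function.iterate_one, step_of_codeAt hP.1]
    exact ⟨rfl, by simpa [Instr.exec, Function.update_apply] using hz,
      fun i => by simp [Instr.exec, Function.update_apply, hr, hi _ hlt], hi, ha⟩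
  | load r j a σ hb hj =>
    intro o m hS hP
    simp only [Cmd.compile, codeAt_append, codeAt_cons] at hP
    obtain ⟨m', hm, ⟨rfl', hz, hr, hi, ha⟩, h0⟩ := addressCode_correct hS hb hP.1
    refine ⟨7, _, rfl, rfl, ?_⟩
    rw [Function.iterate_succ_apply', hm,
      step_of_codeAt (by rw [rfl']; simpa [Cmd.addressCode] using hP.2.1)]
    exact ⟨by simp [Instr.exec, rfl', Cmd.len],
      by simpa [Instr.exec, Function.update_apply] using hz,
      fun i => by simp [Instr.exec, Function.update_apply, hr, h0, ha j hj], hi, ha⟩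
  | store j a r σ hb hj =>
    intro o m hS hP
    simp only [Cmd.compile, codeAt_append, codeAt_cons] at hP
    obtain ⟨m', hm, ⟨rfl', hz, hr, hi, ha⟩, h0⟩ := addressCode_correct hS hb hP.1
    refine ⟨7, _, rfl, rfl, ?_⟩
    rw [Function.iterate_succ_apply', hm,
      step_of_codeAt (by rw [rfl']; simpa [Cmd.addressCode] using hP.2.1)]
    refine ⟨by simp [Instr.exec, rfl', Cmd.len], by simpa [Instr.exec] using hz,
      fun i => by simp [Instr.exec, hr], fun i hib => ?_, fun j' hj' i => ?_⟩
    · simp only [Instr.exec, h0, Function.update_apply]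
      rw [if_neg (by omega), hi _ hib]
    · simp only [Instr.exec, h0, Function.update_apply, hr, Store.put_arr, ha _ hj']
      congr 1
      apply propext
      omega
  | @seq c d σ σ₁ σ₂ h₁ h₂ ih₁ ih₂ =>
    intro o m hS hP
    simp only [Cmd.compile, codeAt_append, Cmd.length_compile] at hP
    obtain ⟨k₁, m₁, t₁, e₁, S₁⟩ := ih₁ hS hP.1
    obtain ⟨k₂, m₂, t₂, e₂, S₂⟩ := ih₂ S₁ hP.2
    refine ⟨k₂ + k₁, m₂, by omega, by rw [Function.iterate_add_apply, e₁, e₂], ?_⟩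
    simpa [Cmd.len, add_assoc] using S₂
  | @ite_pos r c d σ σ₁ h0 h₁ ih =>
    rintro o m ⟨rfl, hz, hr, hi, ha⟩ hP
    simp only [Cmd.compile, codeAt_append, codeAt_cons, Cmd.length_compile] at hP
    obtain ⟨hj, hc, hj', -⟩ := hP
    obtain ⟨k₁, m₁, t₁, e₁, S₁⟩ := ih (m := ⟨m.pc + 1, m.reg, m.mem⟩)
      ⟨rfl, hz, hr, hi, ha⟩ hc
    refine ⟨1 + (k₁ + 1), _, by simp [t₁] ; omega, rfl, ?_⟩
    rw [Function.iterate_add_apply, Function.iterate_succ_apply P.step k₁, step_of_codeAt hj]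
    simp only [Instr.exec, hr, h0, if_false, e₁, Function.iterate_one]
    rw [step_of_codeAt (by rw [S₁.pc]; exact hj')]
    exact ⟨by simp [Instr.exec, S₁.zero, Cmd.len]; omega, S₁.zero, S₁.reg, S₁.inp, S₁.arr⟩
  | @ite_neg r c d σ σ₁ h0 h₁ ih =>
    rintro o m ⟨rfl, hz, hr, hi, ha⟩ hP
    simp only [Cmd.compile, codeAt_append, codeAt_cons, Cmd.length_compile] at hP
    obtain ⟨hj, -, -, hd⟩ := hP
    obtain ⟨k₁, m₁, t₁, e₁, S₁⟩ := ih (m := ⟨m.pc + c.len + 2, m.reg, m.mem⟩)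
      ⟨rfl, hz, hr, hi, ha⟩ (by convert hd using 1; simp only; omega)
    refine ⟨k₁ + 1, _, by simp [t₁] ; omega, rfl, ?_⟩
    rw [Function.iterate_succ_apply, step_of_codeAt hj]
    simp only [Instr.exec, hr, h0, if_true, e₁]
    convert S₁ using 1
    simp [Cmd.len]; omega
  | @loop_pos r c σ σ₁ σ₂ h0 h₁ h₂ ih₁ ih₂ =>
    intro o m hS hP
    have hP' := hP
    obtain ⟨rfl, hz, hr, hi, ha⟩ := hS
    simp only [Cmd.compile, codeAt_append, codeAt_cons, Cmd.length_compile] at hP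
    obtain ⟨hj, hc, hj', -⟩ := hP
    obtain ⟨k₁, m₁, t₁, e₁, S₁⟩ := ih₁ (m := ⟨m.pc + 1, m.reg, m.mem⟩)
      ⟨rfl, hz, hr, hi, ha⟩ hc
    obtain ⟨k₂, m₂, t₂, e₂, S₂⟩ := ih₂ (m := ⟨m.pc, m₁.reg, m₁.mem⟩)
      ⟨rfl, S₁.zero, S₁.reg, S₁.inp, S₁.arr⟩ hP'
    refine ⟨k₂ + (1 + (k₁ + 1)), _, by simp at t₁ t₂; omega, rfl, ?_⟩
    rw [Function.iterate_add_apply, Function.iterate_add_apply,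
      Function.iterate_succ_apply P.step k₁, step_of_codeAt hj]
    simp only [Instr.exec, hr, h0, if_false, e₁, Function.iterate_one]
    rw [step_of_codeAt (by rw [S₁.pc]; exact hj')]
    simp only [Instr.exec, S₁.zero, if_true, e₂]
    exact S₂
  | @loop_neg r c σ h0 =>
    rintro o m ⟨rfl, hz, hr, hi, ha⟩ hP
    simp only [Cmd.compile, codeAt_cons] at hP
    refine ⟨1, _, rfl, rfl, ?_⟩
    rw [Function.iterate_one, step_of_codeAt hP.1]
    exact ⟨by simp [Instr.exec, hr, h0, Cmd.len, add_assoc], hz, hr, hi, ha⟩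

/-! ### Weakest preconditions -/

/-- The weakest precondition for total correctness: the command `c` terminates from `σ`, in a state
with `Q`. As the clock is part of the state, `Q` may also bound the time. -/
def wp (inp : ℕ → ℕ) (base : ℕ) (c : Cmd) (Q : Store → Prop) (σ : Store) : Prop :=
  ∃ σ', Exec inp base c σ σ' ∧ Q σ'

section wp
variable {inp : ℕ → ℕ} {base : ℕ} {Q Q' : Store → Prop} {σ : Store}

theorem wp_mono {c : Cmd} (h : wp inp base c Q σ) (hQ : ∀ σ', Q σ' → Q' σ') :
    wp inp base c Q' σ :=
  h.imp fun _ h => ⟨h.1, hQ _ h.2⟩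

@[simp] theorem wp_const {r c : ℕ} : wp inp base (.const r c) Q σ ↔ Q (σ.set r c 1) :=
  ⟨by rintro ⟨_, ⟨⟩, h⟩; exact h, fun h => ⟨_, .const .., h⟩⟩

@[simp] theorem wp_add {r a b : ℕ} :
    wp inp base (.add r a b) Q σ ↔ Q (σ.set r (σ.reg a + σ.reg b) 1) :=
  ⟨by rintro ⟨_, ⟨⟩, h⟩; exact h, fun h => ⟨_, .add .., h⟩⟩

@[simp] theorem wp_sub {r a b : ℕ} :
    wp inp base (.sub r a b) Q σ ↔ Q (σ.set r (σ.reg a - σ.reg b) 1) :=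
  ⟨by rintro ⟨_, ⟨⟩, h⟩; exact h, fun h => ⟨_, .sub .., h⟩⟩

@[simp] theorem wp_get {r a : ℕ} :
    wp inp base (.get r a) Q σ ↔ σ.reg a < base ∧ Q (σ.set r (inp (σ.reg a)) 1) :=
  ⟨by rintro ⟨_, ⟨⟩, h⟩; exact ⟨‹_›, h⟩, fun h => ⟨_, .get _ _ _ h.1, h.2⟩⟩

@[simp] theorem wp_load {r j a : ℕ} :
    wp inp base (.load r j a) Q σ ↔
      σ.reg 0 = base ∧ j < 8 ∧ Q (σ.set r (σ.arr j (σ.reg a)) 7) :=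
  ⟨by rintro ⟨_, ⟨⟩, h⟩; exact ⟨‹_›, ‹_›, h⟩, fun h => ⟨_, .load _ _ _ _ h.1 h.2.1, h.2.2⟩⟩

@[simp] theorem wp_store {r j a : ℕ} :
    wp inp base (.store j a r) Q σ ↔
      σ.reg 0 = base ∧ j < 8 ∧ Q (σ.put j (σ.reg a) (σ.reg r) 7) :=
  ⟨by rintro ⟨_, ⟨⟩, h⟩; exact ⟨‹_›, ‹_›, h⟩, fun h => ⟨_, .store _ _ _ _ h.1 h.2.1, h.2.2⟩⟩

@[simp] theorem wp_seq {c d : Cmd} :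
    wp inp base (c ;; d) Q σ ↔ wp inp base c (fun σ => wp inp base d Q σ) σ :=
  ⟨by rintro ⟨_, ⟨⟩, h⟩; exact ⟨_, ‹_›, _, ‹_›, h⟩,
    by rintro ⟨_, h₁, _, h₂, h⟩; exact ⟨_, .seq h₁ h₂, h⟩⟩

theorem wp_ite {r : ℕ} {c d : Cmd} :
    wp inp base (.ite r c d) Q σ ↔
      (σ.reg r ≠ 0 → wp inp base c (fun σ => Q (σ.tick 1)) (σ.tick 1)) ∧
      (σ.reg r = 0 → wp inp base d Q (σ.tick 1)) := by
  constructor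
  · rintro ⟨_, h, hQ⟩
    cases h with
    | ite_pos h h₁ => exact ⟨fun _ => ⟨_, h₁, hQ⟩, fun h' => absurd h' h⟩
    | ite_neg h h₁ => exact ⟨fun h' => absurd h h', fun _ => ⟨_, h₁, hQ⟩⟩
  · rintro ⟨h₁, h₂⟩
    by_cases h : σ.reg r = 0
    · obtain ⟨_, e, hQ⟩ := h₂ h
      exact ⟨_, .ite_neg h e, hQ⟩
    · obtain ⟨_, e, hQ⟩ := h₁ h
      exact ⟨_, .ite_pos h e, hQ⟩

/-- Total correctness of a loop, from an invariant indexed by a decreasing natural number. -/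
theorem wp_loop {r : ℕ} {c : Cmd} (I : ℕ → Store → Prop) {m : ℕ} (h : I m σ)
    (hstep : ∀ m σ, I m σ → σ.reg r ≠ 0 →
      wp inp base c (fun σ' => ∃ m' < m, I m' (σ'.tick 1)) (σ.tick 1))
    (hend : ∀ m σ, I m σ → σ.reg r = 0 → Q (σ.tick 1)) :
    wp inp base (.loop r c) Q σ := by
  induction m using Nat.strong_induction_on generalizing σ with
  | _ m ih =>
    by_cases h0 : σ.reg r = 0
    · exact ⟨_, .loop_neg h0, hend m σ h h0⟩
    · obtain ⟨σ₁, e₁, m', hm', h'⟩ := hstep m σ h h0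
      obtain ⟨σ₂, e₂, hQ⟩ := ih m' hm' h'
      exact ⟨_, .loop_pos h0 e₁ e₂, hQ⟩

end wp

/-! ### Primitive recursive functions on the machine -/

/-- The registers below `b` and all arrays are the same in `σ` and `σ'`. -/
structure Keeps (b : ℕ) (σ σ' : Store) : Prop where
  reg : ∀ i < b, σ'.reg i = σ.reg i
  arr : σ'.arr = σ.arr

theorem Keeps.trans {b b' : ℕ} {σ σ₁ σ₂ : Store} (h₁ : Keeps b σ σ₁) (h₂ : Keeps b' σ₁ σ₂)
    (h : b ≤ b') : Keeps b σ σ₂ :=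
  ⟨fun i hi => (h₂.reg i (by omega)).trans (h₁.reg i hi), h₂.arr.trans h₁.arr⟩

namespace Cmd

/-- Copy register `a` into register `r ≠ a`. -/
def move (r a : ℕ) : Cmd := .const r 0 ;; .add r r a

/-- Add `k * a` to register `r`; register `k` ends as `0`, and `o` is used for the constant `1`. -/
def addMul (r k a o : ℕ) : Cmd := .const o 1 ;; .loop k (.add r r a ;; .sub k k o)

/-- Put the pair of the registers `b` and `b + 1`, in the sense of `Nat.pair`, into register `b`. -/
def pairing (b : ℕ) : Cmd :=
  .sub (b + 2) (b + 1) b ;;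
  .ite (b + 2)
    (.move (b + 3) (b + 1) ;; .addMul b (b + 3) (b + 1) (b + 4))
    (.move (b + 3) b ;; .add (b + 2) b (b + 1) ;; .addMul (b + 2) (b + 3) b (b + 4) ;;
      .move b (b + 2))

/-- Replace the code of a pair in register `b` by its components in the registers `b` and `b + 1`.
Consecutive odd numbers are subtracted as long as possible, which computes the square root that
`Nat.unpair` refers to, and the remainder. -/
def unpairing (b : ℕ) : Cmd :=
  .const (b + 1) 0 ;; .const (b + 3) 1 ;; .move (b + 2) b ;;
  .loop (b + 2)
    (.sub b b (b + 1) ;; .sub b b (b + 1) ;; .sub b b (b + 3) ;; .add (b + 1) (b + 1) (b + 3) ;;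
      .sub (b + 2) b (b + 1) ;; .sub (b + 2) (b + 2) (b + 1)) ;;
  .sub (b + 2) (b + 1) b ;;
  .ite (b + 2) (.const (b + 2) 0)
    (.move (b + 2) (b + 1) ;; .sub (b + 1) b (b + 1) ;; .move b (b + 2))

end Cmd

section
variable {inp : ℕ → ℕ} {base : ℕ} {Q : Store → Prop} {σ : Store}

theorem wp_move {r a : ℕ} (h : a ≠ r) :
    wp inp base (.move r a) Q σ ↔ Q ((σ.set r 0 1).set r (σ.reg a) 1) := by
  simp [Cmd.move, h]

theorem wp_addMul {r k a o : ℕ} (hrk : r ≠ k) (hra : r ≠ a) (hro : r ≠ o) (hka : k ≠ a)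
    (hko : k ≠ o) (hao : a ≠ o)
    (h : ∀ σ' : Store, σ'.reg r = σ.reg r + σ.reg k * σ.reg a →
      (∀ i, i ≠ r → i ≠ k → i ≠ o → σ'.reg i = σ.reg i) → σ'.arr = σ.arr →
      σ'.time = σ.time + 4 * σ.reg k + 2 → Q σ') :
    wp inp base (.addMul r k a o) Q σ := by
  simp only [Cmd.addMul, wp_seq, wp_const]
  apply wp_loop (m := σ.reg k) (fun m σ' => σ'.reg k = m ∧ σ'.reg o = 1 ∧
    σ'.reg r + m * σ.reg a = σ.reg r + σ.reg k * σ.reg a ∧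
    (∀ i, i ≠ r → i ≠ k → i ≠ o → σ'.reg i = σ.reg i) ∧ σ'.arr = σ.arr ∧
    σ'.time + 4 * m = σ.time + 4 * σ.reg k + 1)
  · refine ⟨by simp [hko], by simp, by simp [hro], fun i _ _ h => by simp [h], rfl, ?_⟩
    simp; omega
  · rintro m σ' ⟨h1, h2, h3, h4, h5, h6⟩ h0
    have ha := h4 a hra.symm hka.symm hao
    obtain ⟨m, rfl⟩ : ∃ k, m = k + 1 := ⟨m - 1, by omega⟩
    simp only [wp_seq, wp_add, wp_sub]
    refine ⟨m, by omega, by simp [hrk.symm, hro.symm, h1, h2], by simp [hro.symm, hko.symm, h2],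
      ?_, fun i hr hk ho => by simp [hr, hk, h4 i hr hk ho], h5, ?_⟩
    · simp only [Store.tick_reg, Store.set_reg, if_neg hrk, if_true, ha]
      rw [← h3]; ring
    · simp; omega
  · rintro m σ' ⟨h1, h2, h3, h4, h5, h6⟩ h0
    obtain rfl : m = 0 := by omega
    exact h _ (by simpa using h3) (by simpa using h4) (by simpa using h5) (by simp; omega)

theorem wp_pairing {b : ℕ} (h : ∀ σ', Keeps b σ σ' →
      σ'.reg b = Nat.pair (σ.reg b) (σ.reg (b + 1)) →
      σ'.time ≤ σ.time + 4 * Nat.pair (σ.reg b) (σ.reg (b + 1)) + 12 → Q σ') :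
    wp inp base (.pairing b) Q σ := by
  have hl := Nat.left_le_pair (σ.reg b) (σ.reg (b + 1))
  have hr := Nat.right_le_pair (σ.reg b) (σ.reg (b + 1))
  simp only [Cmd.pairing, wp_seq, wp_sub, wp_ite]
  constructor
  · intro h0
    simp only [Store.set_reg, if_true] at h0
    rw [wp_move (by simp)]
    apply wp_addMul <;> try simp
    intro σ' h1 h2 h3 h4
    refine h _ ⟨fun i hi => ?_, ?_⟩ ?_ ?_
    · rw [Store.tick_reg, h2 i (by omega) (by omega) (by omega)]
      simp (disch := omega) only [if_neg]
    · exact h3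
    · rw [Store.tick_reg, h1, Nat.pair, if_pos (by omega)]; ring
    · simp only [Store.tick_time, h4]; omega
  · intro h0
    simp only [Store.set_reg, if_true] at h0
    rw [wp_move (by simp)]
    simp only [wp_add]
    apply wp_addMul <;> try simp
    intro σ' h1 h2 h3 h4
    rw [wp_move (by simp)]
    refine h _ ⟨fun i hi => ?_, ?_⟩ ?_ ?_
    · simp (disch := omega) only [Store.set_reg, if_neg]
      rw [h2 i (by omega) (by omega) (by omega)]
      simp (disch := omega) only [if_neg]
    · exact h3
    · simp only [Store.set_reg, if_true, h1]
      rw [Nat.pair, if_neg (by omega)]; ring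
    · simp only [Store.set_time, h4]; omega

theorem wp_unpairing {b : ℕ} (h : ∀ σ', Keeps b σ σ' →
      σ'.reg b = (Nat.unpair (σ.reg b)).1 → σ'.reg (b + 1) = (Nat.unpair (σ.reg b)).2 →
      σ'.time ≤ σ.time + 8 * σ.reg b + 20 → Q σ') :
    wp inp base (.unpairing b) Q σ := by
  simp only [Cmd.unpairing, wp_seq, wp_const]
  rw [wp_move (by simp)]
  apply wp_loop (m := σ.reg b) (fun m σ' => σ'.reg b = m ∧ σ'.reg (b + 3) = 1 ∧
    σ'.reg (b + 2) = m - 2 * σ'.reg (b + 1) ∧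
    m + σ'.reg (b + 1) * σ'.reg (b + 1) = σ.reg b ∧ Keeps b σ σ' ∧
    σ'.time + 8 * m ≤ σ.time + 8 * σ.reg b + 4)
  · refine ⟨by simp, by simp, by simp, by simp, ⟨fun i hi => ?_, rfl⟩, ?_⟩
    · simp (disch := omega) only [Store.set_reg, if_neg]
    · simp; omega
  · rintro m σ' ⟨h1, h2, h3, h4, h5, h6⟩ h0
    simp only [wp_seq, wp_add, wp_sub]
    refine ⟨m - 2 * σ'.reg (b + 1) - 1, by omega, ?_, ?_, ?_, ?_, ⟨fun i hi => ?_, h5.arr⟩, ?_⟩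
    · simp [h1, h2]; omega
    · simp [h2]
    · simp [h1, h2]; omega
    · simp [h2]; rw [← h4]
      zify [show 1 ≤ m - 2 * σ'.reg (b + 1) by omega, show 2 * σ'.reg (b + 1) ≤ m by omega]; ring
    · simp (disch := omega) only [Store.set_reg, if_neg, Store.tick_reg, h5.reg i hi]
    · simp; omega
  · rintro m σ' ⟨h1, h2, h3, h4, h5, h6⟩ h0
    have hs : Nat.sqrt (σ.reg b) = σ'.reg (b + 1) := by
      rw [← h4, add_comm]; exact Nat.sqrt_add_eq _ (by omega)
    have hu : Nat.unpair (σ.reg b) = if m < σ'.reg (b + 1) then (m, σ'.reg (b + 1)) else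
        (σ'.reg (b + 1), m - σ'.reg (b + 1)) := by
      rw [Nat.unpair, hs, ← h4]
      simp
    simp only [wp_sub, wp_ite]
    constructor
    · intro hlt
      simp [h1] at hlt
      rw [if_pos (by omega)] at hu
      simp only [wp_const]
      refine h _ ⟨fun i hi => ?_, h5.arr⟩ (by simp [hu, h1]) (by simp [hu]) (by simp; omega)
      simp (disch := omega) only [Store.set_reg, if_neg, Store.tick_reg, h5.reg i hi]
    · intro hge
      simp [h1] at hge
      rw [if_neg (by omega)] at hu
      rw [wp_seq, wp_move (by simp)]
      simp only [wp_seq, wp_sub]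
      rw [wp_move (by simp)]
      refine h _ ⟨fun i hi => ?_, h5.arr⟩ (by simp [hu]) (by simp [hu, h1]) (by simp; omega)
      simp (disch := omega) only [Store.set_reg, if_neg, Store.tick_reg, h5.reg i hi]

end

/-- For every `b` there is a command that replaces the content of register `b` by its value under
`f`, in time `t`, and changes no array and no register below `b`. -/
def RealizesIn (f t : ℕ → ℕ) : Prop :=
  ∀ b, ∃ c, ∀ inp base σ, wp inp base c (fun σ' => Keeps b σ σ' ∧ σ'.reg b = f (σ.reg b) ∧
    σ'.time ≤ σ.time + t (σ.reg b)) σ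

theorem realizesIn_pair {f g tf tg : ℕ → ℕ} (hf : RealizesIn f tf) (hg : RealizesIn g tg) :
    RealizesIn (fun n => Nat.pair (f n) (g n))
      (fun n => tf n + tg n + 4 * Nat.pair (f n) (g n) + 20) := by
  intro b
  obtain ⟨cf, hf⟩ := hf (b + 1)
  obtain ⟨cg, hg⟩ := hg (b + 2)
  refine ⟨.move (b + 1) b ;; cf ;; .move (b + 2) b ;; cg ;; .move b (b + 1) ;;
    .move (b + 1) (b + 2) ;; .pairing b, fun inp base σ => ?_⟩
  rw [wp_seq, wp_move (by simp), wp_seq]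
  refine wp_mono (hf _ _ _) fun σ₁ ⟨k₁, r₁, t₁⟩ => ?_
  have e₁ := k₁.reg b (by omega)
  simp at r₁ t₁ e₁
  rw [wp_seq, wp_move (by simp), wp_seq]
  refine wp_mono (hg _ _ _) fun σ₂ ⟨k₂, r₂, t₂⟩ => ?_
  have e₂ := k₂.reg (b + 1) (by omega)
  simp [e₁] at r₂ t₂ e₂
  rw [wp_seq, wp_move (by simp), wp_seq, wp_move (by simp)]
  refine wp_pairing fun σ₃ k₃ r₃ t₃ => ⟨⟨fun i hi => ?_, ?_⟩, ?_, ?_⟩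
  · rw [k₃.reg i hi]
    simp (disch := omega) only [Store.set_reg, if_neg]
    rw [k₂.reg i (by omega)]
    simp (disch := omega) only [Store.set_reg, if_neg]
    rw [k₁.reg i (by omega)]
    simp (disch := omega) only [Store.set_reg, if_neg]
  · rw [k₃.arr, Store.set_arr, Store.set_arr, Store.set_arr, Store.set_arr, k₂.arr, Store.set_arr,
      Store.set_arr, k₁.arr]; rfl
  · simpa [r₁, r₂, e₂] using r₃
  · simp [r₁, r₂, e₂] at t₃
    dsimp only
    omega

theorem realizesIn_comp {f g tf tg : ℕ → ℕ} (hf : RealizesIn f tf) (hg : RealizesIn g tg) :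
    RealizesIn (fun n => f (g n)) (fun n => tg n + tf (g n)) := by
  intro b
  obtain ⟨cf, hf⟩ := hf b
  obtain ⟨cg, hg⟩ := hg b
  refine ⟨cg ;; cf, fun inp base σ => ?_⟩
  rw [wp_seq]
  refine wp_mono (hg _ _ _) fun σ₁ ⟨k₁, r₁, t₁⟩ => wp_mono (hf _ _ _) fun σ₂ ⟨k₂, r₂, t₂⟩ =>
    ⟨k₁.trans k₂ le_rfl, by rw [r₂, r₁], ?_⟩
  rw [r₁] at t₂
  dsimp only
  omega

/-- The value of a primitive recursion with parameter `z` after `y` steps. -/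
def precVal (f g : ℕ → ℕ) (z y : ℕ) : ℕ :=
  Nat.rec (f z) (fun y IH => g (Nat.pair z (Nat.pair y IH))) y

/-- The time for `n` steps of a primitive recursion. -/
def precTime (f g tg : ℕ → ℕ) (z n : ℕ) : ℕ :=
  Nat.rec 0 (fun y T => T + (tg (Nat.pair z (Nat.pair y (precVal f g z y))) +
    4 * Nat.pair y (precVal f g z y) + 4 * Nat.pair z (Nat.pair y (precVal f g z y)) + 40)) n

theorem realizesIn_prec {f g tf tg : ℕ → ℕ} (hf : RealizesIn f tf) (hg : RealizesIn g tg) :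
    RealizesIn (fun n => precVal f g n.unpair.1 n.unpair.2)
      (fun n => 8 * n + tf n.unpair.1 + precTime f g tg n.unpair.1 n.unpair.2 + 40) := by
  intro b
  obtain ⟨cf, hf⟩ := hf (b + 3)
  obtain ⟨cg, hg⟩ := hg (b + 4)
  refine ⟨.unpairing b ;; .const (b + 2) 0 ;; .move (b + 3) b ;; cf ;;
    .loop (b + 1) (.move (b + 4) (b + 2) ;; .move (b + 5) (b + 3) ;; .pairing (b + 4) ;;
      .move (b + 5) (b + 4) ;; .move (b + 4) b ;; .pairing (b + 4) ;; cg ;;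
      .move (b + 3) (b + 4) ;; .const (b + 5) 1 ;; .add (b + 2) (b + 2) (b + 5) ;;
      .sub (b + 1) (b + 1) (b + 5)) ;; .move b (b + 3), fun inp base σ => ?_⟩
  obtain ⟨z, n, hzn⟩ : ∃ z n, (σ.reg b).unpair = (z, n) := ⟨_, _, rfl⟩
  simp only [hzn]
  rw [wp_seq]
  refine wp_unpairing fun σ₁ k₁ r₁ r₁' t₁ => ?_
  simp only [hzn] at r₁ r₁'
  rw [wp_seq, wp_const, wp_seq, wp_move (by simp), wp_seq]
  refine wp_mono (hf _ _ _) fun σ₂ ⟨k₂, r₂, t₂⟩ => ?_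
  have e₂ := k₂.reg b (by omega)
  have e₂' := k₂.reg (b + 1) (by omega)
  have e₂'' := k₂.reg (b + 2) (by omega)
  simp [r₁, r₁'] at e₂ e₂' e₂'' r₂ t₂
  rw [wp_seq]
  apply wp_loop (m := n) (fun m σ' => m ≤ n ∧ σ'.reg b = z ∧ σ'.reg (b + 1) = m ∧
    σ'.reg (b + 2) = n - m ∧ σ'.reg (b + 3) = precVal f g z (n - m) ∧ Keeps b σ σ' ∧
    σ'.time ≤ σ.time + 8 * σ.reg b + tf z + precTime f g tg z (n - m) + 30)
  · refine ⟨le_rfl, e₂, e₂', by simpa using e₂'', by simpa [precVal] using r₂, ⟨fun i hi => ?_, ?_⟩, ?_⟩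
    · rw [k₂.reg i (by omega)]
      simp (disch := omega) only [Store.set_reg, if_neg]
      rw [k₁.reg i hi]
    · rw [k₂.arr, Store.set_arr, Store.set_arr, Store.set_arr, k₁.arr]
    · simp [precTime]; omega
  · rintro m σ' ⟨hm, h1, h2, h3, h4, h5, h6⟩ h0
    obtain ⟨m, rfl⟩ : ∃ k, m = k + 1 := ⟨m - 1, by omega⟩
    obtain ⟨y, hy⟩ : ∃ y, n - (m + 1) = y := ⟨_, rfl⟩
    have hy' : n - m = y + 1 := by omega
    rw [hy] at h3 h4 h6
    rw [wp_seq, wp_move (by simp), wp_seq, wp_move (by simp), wp_seq]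
    refine wp_pairing fun σ₃ k₃ r₃ t₃ => ?_
    have q₃ := k₃.reg b (by omega)
    have q₃1 := k₃.reg (b + 1) (by omega)
    have q₃2 := k₃.reg (b + 2) (by omega)
    simp [h1, h2, h3, h4] at r₃ t₃ q₃ q₃1 q₃2
    rw [wp_seq, wp_move (by simp), wp_seq, wp_move (by simp), wp_seq]
    refine wp_pairing fun σ₄ k₄ r₄ t₄ => ?_
    have q₄ := k₄.reg b (by omega)
    have q₄1 := k₄.reg (b + 1) (by omega)
    have q₄2 := k₄.reg (b + 2) (by omega)
    simp [r₃, q₃, q₃1, q₃2] at r₄ t₄ q₄ q₄1 q₄2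
    rw [wp_seq]
    refine wp_mono (hg _ _ _) fun σ₅ ⟨k₅, r₅, t₅⟩ => ?_
    have q₅ := k₅.reg b (by omega)
    have q₅1 := k₅.reg (b + 1) (by omega)
    have q₅2 := k₅.reg (b + 2) (by omega)
    rw [r₄] at r₅ t₅
    rw [wp_seq, wp_move (by simp)]
    simp only [wp_seq, wp_const, wp_add, wp_sub]
    refine ⟨m, by omega, by omega, by simp [q₅, q₄], by simp [q₅1, q₄1],
      by simp [q₅2, q₄2, hy'], by simp [r₅, hy', precVal], ⟨fun i hi => ?_, ?_⟩, ?_⟩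
    · simp (disch := omega) only [Store.tick_reg, Store.set_reg, if_neg]
      rw [k₅.reg i (by omega), k₄.reg i (by omega)]
      simp (disch := omega) only [Store.set_reg, if_neg]
      rw [k₃.reg i (by omega)]
      simp (disch := omega) only [Store.tick_reg, Store.set_reg, if_neg]
      exact h5.reg i hi
    · simp only [Store.tick_arr, Store.set_arr]
      rw [k₅.arr, k₄.arr]
      simp only [Store.set_arr]
      rw [k₃.arr]
      exact h5.arr
    · have : precTime f g tg z (y + 1) = precTime f g tg z y +
        (tg (Nat.pair z (Nat.pair y (precVal f g z y))) +
        4 * Nat.pair y (precVal f g z y) + 4 * Nat.pair z (Nat.pair y (precVal f g z y)) + 40) := rfl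
      rw [hy', this]
      simp
      omega
  · rintro m σ' ⟨hm, h1, h2, h3, h4, h5, h6⟩ h0
    obtain rfl : m = 0 := by omega
    rw [wp_move (by simp)]
    refine ⟨⟨fun i hi => ?_, h5.arr⟩, by simpa using h4, ?_⟩
    · simp (disch := omega) only [Store.tick_reg, Store.set_reg, if_neg]
      exact h5.reg i hi
    · simp at h6 ⊢; omega

theorem primrec_precVal {f g : ℕ → ℕ} (hf : Primrec f) (hg : Primrec g) :
    Primrec₂ (precVal f g) :=
  Primrec.nat_rec hf ((hg.comp (Primrec₂.natPair.comp .fst (Primrec₂.natPair.comp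
    (Primrec.fst.comp .snd) (Primrec.snd.comp .snd)))).to₂)

theorem primrec_precTime {f g tg : ℕ → ℕ} (hf : Primrec f) (hg : Primrec g) (ht : Primrec tg) :
    Primrec₂ (precTime f g tg) := by
  have hv : Primrec fun p : ℕ × ℕ × ℕ => Nat.pair p.2.1 (precVal f g p.1 p.2.1) :=
    Primrec₂.natPair.comp (Primrec.fst.comp .snd)
      ((primrec_precVal hf hg).comp .fst (Primrec.fst.comp .snd))
  have hw : Primrec fun p : ℕ × ℕ × ℕ =>
      Nat.pair p.1 (Nat.pair p.2.1 (precVal f g p.1 p.2.1)) := Primrec₂.natPair.comp .fst hv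
  have hc : Primrec fun p : ℕ × ℕ × ℕ => tg (Nat.pair p.1 (Nat.pair p.2.1 (precVal f g p.1 p.2.1))) +
      4 * Nat.pair p.2.1 (precVal f g p.1 p.2.1) +
      4 * Nat.pair p.1 (Nat.pair p.2.1 (precVal f g p.1 p.2.1)) + 40 :=
    Primrec.nat_add.comp (Primrec.nat_add.comp (Primrec.nat_add.comp (ht.comp hw)
      (Primrec.nat_mul.comp (.const 4) hv)) (Primrec.nat_mul.comp (.const 4) hw)) (.const 40)
  exact Primrec.nat_rec (f := fun _ : ℕ => 0) (.const 0)
    (Primrec.nat_add.comp (Primrec.snd.comp .snd) hc).to₂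

/-- Every primitive recursive function can be computed by the machine, in a time that is bounded by
a primitive recursive function. -/
theorem exists_realizesIn {f : ℕ → ℕ} (hf : Nat.Primrec f) :
    ∃ t : ℕ → ℕ, Primrec t ∧ RealizesIn f t := by
  induction hf with
  | zero =>
    refine ⟨fun _ => 1, .const _, fun b => ⟨.const b 0, fun inp base σ => ?_⟩⟩
    rw [wp_const]
    exact ⟨⟨fun i hi => by simp (disch := omega) only [Store.set_reg, if_neg], rfl⟩, by simp,
      by simp⟩
  | succ =>
    refine ⟨fun _ => 2, .const _, fun b => ⟨.const (b + 1) 1 ;; .add b b (b + 1),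
      fun inp base σ => ?_⟩⟩
    rw [wp_seq, wp_const, wp_add]
    exact ⟨⟨fun i hi => by simp (disch := omega) only [Store.set_reg, if_neg], rfl⟩, by simp,
      by simp⟩
  | left =>
    refine ⟨fun n => 8 * n + 20, Primrec.nat_add.comp (Primrec.nat_mul.comp (.const 8) (Primrec.id (α := ℕ)))
      (.const _), fun b => ⟨.unpairing b, fun inp base σ => ?_⟩⟩
    exact wp_unpairing fun σ' h1 h2 h3 h4 => ⟨h1, h2, by omega⟩
  | right =>
    refine ⟨fun n => 8 * n + 22, Primrec.nat_add.comp (Primrec.nat_mul.comp (.const 8) (Primrec.id (α := ℕ)))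
      (.const _), fun b => ⟨.unpairing b ;; .move b (b + 1), fun inp base σ => ?_⟩⟩
    rw [wp_seq]
    refine wp_unpairing fun σ' h1 h2 h3 h4 => ?_
    rw [wp_move (by simp)]
    refine ⟨⟨fun i hi => ?_, h1.arr⟩, by simpa using h3, by simp; omega⟩
    simp (disch := omega) only [Store.set_reg, if_neg]
    exact h1.reg i hi
  | @pair f g pf pg hf hg =>
    obtain ⟨tf, htf, hf⟩ := hf
    obtain ⟨tg, htg, hg⟩ := hg
    refine ⟨_, ?_, realizesIn_pair hf hg⟩
    exact Primrec.nat_add.comp (Primrec.nat_add.comp (Primrec.nat_add.comp htf htg)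
      (Primrec.nat_mul.comp (.const _) (Primrec₂.natPair.comp (Primrec.nat_iff.2 pf)
        (Primrec.nat_iff.2 pg)))) (.const _)
  | @comp f g pf pg hf hg =>
    obtain ⟨tf, htf, hf⟩ := hf
    obtain ⟨tg, htg, hg⟩ := hg
    exact ⟨_, Primrec.nat_add.comp htg (htf.comp (Primrec.nat_iff.2 pg)), realizesIn_comp hf hg⟩
  | @prec f g pf pg hf hg =>
    obtain ⟨tf, htf, hf⟩ := hf
    obtain ⟨tg, htg, hg⟩ := hg
    refine ⟨_, ?_, realizesIn_prec hf hg⟩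
    have h1 := Primrec.fst.comp Primrec.unpair
    have h2 := Primrec.snd.comp Primrec.unpair
    exact Primrec.nat_add.comp (Primrec.nat_add.comp (Primrec.nat_add.comp
      (Primrec.nat_mul.comp (.const 8) (Primrec.id (α := ℕ))) (htf.comp h1))
      ((primrec_precTime (Primrec.nat_iff.2 pf) (Primrec.nat_iff.2 pg) htg).comp h1 h2)) (.const _)

/-! ### Machine computations are primitive recursive -/

/-- The content of cell `k` after the writes in `l` (latest first) on input `x`: register `i` is
cell `2 * i`, and memory cell `i` is cell `2 * i + 1`. -/
def readLog (x : List ℕ) (l : List (ℕ × ℕ)) (k : ℕ) : ℕ :=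
  (l.lookup k).getD (if k % 2 = 1 then x[k / 2]?.getD 0 else 0)

/-- The machine state with program counter `s.1` and the writes `s.2`. -/
def logState (x : List ℕ) (s : ℕ × List (ℕ × ℕ)) : MachineState where
  pc := s.1
  reg i := readLog x s.2 (2 * i)
  mem i := readLog x s.2 (2 * i + 1)

/-- An instruction as an operation on logs of writes. -/
def Instr.logExec (x : List ℕ) (s : ℕ × List (ℕ × ℕ)) : Instr → ℕ × List (ℕ × ℕ)
  | .const r c => (s.1 + 1, (2 * r, c) :: s.2)
  | .add r a b => (s.1 + 1, (2 * r, readLog x s.2 (2 * a) + readLog x s.2 (2 * b)) :: s.2)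
  | .sub r a b => (s.1 + 1, (2 * r, readLog x s.2 (2 * a) - readLog x s.2 (2 * b)) :: s.2)
  | .load r a => (s.1 + 1, (2 * r, readLog x s.2 (2 * readLog x s.2 (2 * a) + 1)) :: s.2)
  | .store a r =>
    (s.1 + 1, (2 * readLog x s.2 (2 * a) + 1, readLog x s.2 (2 * r)) :: s.2)
  | .jumpZero r target => (if readLog x s.2 (2 * r) = 0 then target else s.1 + 1, s.2)

theorem readLog_cons (x : List ℕ) (l : List (ℕ × ℕ)) (k v i : ℕ) :
    readLog x ((k, v) :: l) i = if i = k then v else readLog x l i := by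
  by_cases h : i = k
  · simp [readLog, h]
  · simp [readLog, List.lookup_cons, h, beq_eq_false_iff_ne.2 h]

theorem logState_logExec (x : List ℕ) (s : ℕ × List (ℕ × ℕ)) (c : Instr) :
    logState x (c.logExec x s) = c.exec (logState x s) := by
  cases c <;> simp [logState, Instr.logExec, Instr.exec, readLog_cons] <;> (try constructor) <;>
    (ext i; simp [Function.update_apply]) <;> (intro h; omega)

theorem primrec_readLog : Primrec fun p : (List ℕ × List (ℕ × ℕ)) × ℕ => readLog p.1.1 p.1.2 p.2 :=
  Primrec.option_getD.comp (Primrec.listLookup.comp .snd (Primrec.snd.comp .fst))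
    (Primrec.ite (Primrec.eq.comp (Primrec.nat_mod.comp .snd (.const 2)) (.const 1))
      (Primrec.option_getD.comp (Primrec.list_getElem?.comp (Primrec.fst.comp .fst)
        (Primrec.nat_div.comp .snd (.const 2))) (.const 0)) (.const 0))

theorem primrec_logExec (c : Instr) :
    Primrec fun p : List ℕ × ℕ × List (ℕ × ℕ) => c.logExec p.1 p.2 := by
  have hs : Primrec fun p : List ℕ × ℕ × List (ℕ × ℕ) => p.2.1 + 1 :=
    Primrec.succ.comp (Primrec.fst.comp .snd)
  have hl : Primrec fun p : List ℕ × ℕ × List (ℕ × ℕ) => p.2.2 := Primrec.snd.comp .snd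
  have hr {k : List ℕ × ℕ × List (ℕ × ℕ) → ℕ} (hk : Primrec k) :
      Primrec fun p : List ℕ × ℕ × List (ℕ × ℕ) => readLog p.1 p.2.2 (k p) :=
    primrec_readLog.comp (.pair (.pair .fst hl) hk)
  have hw {k v : List ℕ × ℕ × List (ℕ × ℕ) → ℕ} (hk : Primrec k) (hv : Primrec v) :
      Primrec fun p : List ℕ × ℕ × List (ℕ × ℕ) => (p.2.1 + 1, (k p, v p) :: p.2.2) :=
    .pair hs (Primrec.list_cons.comp (.pair hk hv) hl)
  have ha {k : List ℕ × ℕ × List (ℕ × ℕ) → ℕ} (hk : Primrec k) :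
      Primrec fun p : List ℕ × ℕ × List (ℕ × ℕ) => 2 * k p + 1 :=
    Primrec.succ.comp (Primrec.nat_mul.comp (.const 2) hk)
  cases c with
  | const r c => exact hw (.const _) (.const _)
  | add r a b => exact hw (.const _) (Primrec.nat_add.comp (hr (.const _)) (hr (.const _)))
  | sub r a b => exact hw (.const _) (Primrec.nat_sub.comp (hr (.const _)) (hr (.const _)))
  | load r a => exact hw (.const _) (hr (ha (hr (.const _))))
  | store a r => exact hw (ha (hr (.const _))) (hr (.const _))
  | jumpZero r t =>
    exact .pair (Primrec.ite (Primrec.eq.comp (hr (.const _)) (.const _)) (.const _) hs) hl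

/-- The instruction at position `n` of a program, as an operation on logs of writes. -/
def logStepAt : Program → List ℕ → ℕ → ℕ × List (ℕ × ℕ) → ℕ × List (ℕ × ℕ)
  | [], _, _, s => s
  | c :: _, x, 0, s => c.logExec x s
  | _ :: P, x, n + 1, s => logStepAt P x n s

theorem primrec_logStepAt (P : Program) :
    Primrec fun p : List ℕ × ℕ × ℕ × List (ℕ × ℕ) => logStepAt P p.1 p.2.1 p.2.2 := by
  induction P with
  | nil => exact Primrec.snd.comp .snd
  | cons c P ih =>
    refine (Primrec.nat_casesOn (f := fun p : List ℕ × ℕ × ℕ × List (ℕ × ℕ) => p.2.1)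
      (g := fun p => c.logExec p.1 p.2.2) (h := fun p n => logStepAt P p.1 n p.2.2)
      (Primrec.fst.comp .snd) ((primrec_logExec c).comp (.pair .fst (Primrec.snd.comp .snd)))
      (ih.comp (.pair (Primrec.fst.comp .fst) (.pair .snd
        (Primrec.snd.comp (Primrec.snd.comp .fst)))))).of_eq ?_
    rintro ⟨x, n, s⟩
    cases n <;> rfl

theorem logState_logStepAt (P : Program) (x : List ℕ) (n : ℕ) (s : ℕ × List (ℕ × ℕ)) :
    logState x (logStepAt P x n s) =
      match P[n]? with
      | some c => c.exec (logState x s)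
      | none => logState x s := by
  induction P generalizing n with
  | nil => simp [logStepAt]
  | cons c P ih =>
    cases n with
    | zero => simp [logStepAt, logState_logExec]
    | succ n => simp [logStepAt, ih]

/-- The content of register `0` after `t` steps of a program is a primitive recursive function of
the input and `t`. -/
theorem primrec_run (P : Program) :
    Primrec₂ fun (x : List ℕ) (t : ℕ) => ((P.step)^[t] (initialState x)).reg 0 := by
  have h : ∀ (x : List ℕ) (t : ℕ), (P.step)^[t] (initialState x) =
      logState x ((fun s => logStepAt P x s.1 s)^[t] (0, [])) := by
    intro x t
    induction t with
    | zero =>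
      simp [initialState, logState, readLog]
      ext i
      simp [show (2 * i + 1) / 2 = i by omega]
    | succ t ih =>
      rw [Function.iterate_succ_apply', Function.iterate_succ_apply', ih, logState_logStepAt]
      rfl
  have h' : Primrec fun p : List ℕ × ℕ =>
      (fun s => logStepAt P p.1 s.1 s)^[p.2] ((0, []) : ℕ × List (ℕ × ℕ)) :=
    Primrec.nat_iterate .snd (.const _) ((primrec_logStepAt P).comp
      (.pair (Primrec.fst.comp .fst) (.pair (Primrec.fst.comp .snd) .snd)))
  refine (primrec_readLog.comp (.pair (.pair .fst (Primrec.snd.comp h')) (.const 0))).of_eq ?_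
  rintro ⟨x, t⟩
  simp [h, logState]

/-! ### Finite automata as lists of transitions -/

/-- `Path T l p q`: the word `l` labels a path from `p` to `q` in the transition relation `T`. -/
def Path {S α : Type} (T : S → α → S → Prop) : List α → S → S → Prop
  | [], p, q => p = q
  | a :: l, p, q => ∃ r, T p a r ∧ Path T l r q

section Path
variable {S S' α β : Type}

theorem path_append {T : S → α → S → Prop} {l₁ l₂ : List α} {p q : S} :
    Path T (l₁ ++ l₂) p q ↔ ∃ r, Path T l₁ p r ∧ Path T l₂ r q := by
  induction l₁ generalizing p with
  | nil => simp [Path]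
  | cons a l ih =>
    simp only [List.cons_append, Path, ih]
    constructor
    · rintro ⟨r, h, s, h', h''⟩; exact ⟨s, ⟨r, h, h'⟩, h''⟩
    · rintro ⟨s, ⟨r, h, h'⟩, h''⟩; exact ⟨r, h, s, h', h''⟩

/-- If `f` embeds the transition system `T` into `T'` as a part that no path leaves, then the paths
from there correspond to the paths of `T`. -/
theorem path_embed {T : S → α → S → Prop} {T' : S' → α → S' → Prop} (f : S → S')
    (h : ∀ p a y, T' (f p) a y ↔ ∃ q, f q = y ∧ T p a q) {l : List α} {p : S} {y : S'} :
    Path T' l (f p) y ↔ ∃ q, f q = y ∧ Path T l p q := by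
  induction l generalizing p with
  | nil => simp [Path]
  | cons a l ih =>
    simp only [Path, h]
    constructor
    · rintro ⟨_, ⟨r, rfl, hr⟩, h'⟩
      obtain ⟨q, rfl, hq⟩ := ih.1 h'
      exact ⟨q, rfl, r, hr, hq⟩
    · rintro ⟨q, rfl, r, hr, hq⟩
      exact ⟨_, ⟨r, rfl, hr⟩, ih.2 ⟨q, rfl, hq⟩⟩

theorem path_prod {T : S → α → S → Prop} {T' : S' → α → S' → Prop} {l : List α} {p q : S × S'} :
    Path (fun p a q => T p.1 a q.1 ∧ T' p.2 a q.2) l p q ↔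
      Path T l p.1 q.1 ∧ Path T' l p.2 q.2 := by
  induction l generalizing p with
  | nil => simp [Path, Prod.ext_iff]
  | cons a l ih =>
    simp only [Path, ih]
    constructor
    · rintro ⟨r, ⟨h1, h2⟩, h3, h4⟩; exact ⟨⟨_, h1, h3⟩, _, h2, h4⟩
    · rintro ⟨⟨r, h1, h3⟩, r', h2, h4⟩; exact ⟨(r, r'), ⟨h1, h2⟩, h3, h4⟩

theorem path_relabel {T : S → α → S → Prop} {T' : S → β → S → Prop} (f : α → β)
    (h : ∀ p b q, T' p b q ↔ ∃ a, f a = b ∧ T p a q) {l : List β} {p q : S} :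
    Path T' l p q ↔ ∃ l', l'.map f = l ∧ Path T l' p q := by
  induction l generalizing p with
  | nil => simp [Path]
  | cons b l ih =>
    simp only [Path, h, ih]
    constructor
    · rintro ⟨r, ⟨a, rfl, ha⟩, l', rfl, hl⟩
      exact ⟨a :: l', rfl, r, ha, hl⟩
    · rintro ⟨_ | ⟨a, l'⟩, hl, hp⟩
      · simp at hl
      · simp only [List.map_cons, List.cons.injEq] at hl
        obtain ⟨r, ha, hp⟩ := hp
        exact ⟨r, ⟨a, hl.1, ha⟩, l', hl.2, hp⟩

theorem path_map_range {T : S → α → S → Prop} {k : ℕ} {f : ℕ → α} {p q : S} :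
    Path T ((List.range k).map f) p q ↔
      ∃ st : ℕ → S, st 0 = p ∧ st k = q ∧ ∀ i < k, T (st i) (f i) (st (i + 1)) := by
  induction k generalizing q with
  | zero => exact ⟨fun h => ⟨fun _ => p, rfl, h, by simp⟩, fun ⟨st, h, h', _⟩ => h ▸ h'⟩
  | succ k ih =>
    simp only [List.range_succ, List.map_append, path_append, ih, List.map_cons, List.map_nil, Path]
    constructor
    · rintro ⟨r, ⟨st, rfl, rfl, hst⟩, s, hr, rfl⟩
      refine ⟨fun i => if i ≤ k then st i else s, by simp, by simp, fun i hi => ?_⟩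
      by_cases h : i = k
      · subst h; simpa using hr
      · simpa [show i ≤ k by omega, show i + 1 ≤ k by omega] using hst i (by omega)
    · rintro ⟨st, rfl, rfl, hst⟩
      exact ⟨_, ⟨st, rfl, rfl, fun i hi => hst i (by omega)⟩, _, hst k (by omega), rfl⟩

end Path

/-- A nondeterministic automaton: initial states, transitions, final states. -/
abbrev ListAut (α : Type) : Type := List ℕ × List (ℕ × α × ℕ) × List ℕ

namespace ListAut

variable {α β : Type}

/-- The transition relation. -/
def Tr (A : ListAut α) (p : ℕ) (a : α) (q : ℕ) : Prop := (p, a, q) ∈ A.2.1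

/-- Some path from an initial to a final state is labelled by the word `l`. -/
def Accepts (A : ListAut α) (l : List α) : Prop := ∃ p ∈ A.1, ∃ q ∈ A.2.2, Path A.Tr l p q

/-- The disjoint union; the states of `A` become even and those of `B` odd. -/
def union (A B : ListAut α) : ListAut α :=
  (A.1.map (2 * ·) ++ B.1.map (2 * · + 1),
    A.2.1.map (fun t => (2 * t.1, t.2.1, 2 * t.2.2)) ++
      B.2.1.map (fun t => (2 * t.1 + 1, t.2.1, 2 * t.2.2 + 1)),
    A.2.2.map (2 * ·) ++ B.2.2.map (2 * · + 1))

theorem accepts_union {A B : ListAut α} {l : List α} :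
    (A.union B).Accepts l ↔ A.Accepts l ∨ B.Accepts l := by
  have hA : ∀ p y, Path (A.union B).Tr l (2 * p) y ↔ ∃ q, 2 * q = y ∧ Path A.Tr l p q := by
    intro p y
    refine path_embed (fun p => 2 * p) ?_
    intro p a y
    simp only [Tr, union, List.mem_append, List.mem_map, Prod.mk.injEq, Prod.exists]
    constructor
    · rintro (⟨p', a', q, h, h1, rfl, h2⟩ | ⟨p', a', q, h, h1, rfl, h2⟩)
      · obtain rfl : p' = p := by omega
        exact ⟨q, h2, h⟩
      · omega
    · rintro ⟨q, rfl, h⟩; exact .inl ⟨p, a, q, h, rfl, rfl, rfl⟩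
  have hB : ∀ p y, Path (A.union B).Tr l (2 * p + 1) y ↔ ∃ q, 2 * q + 1 = y ∧ Path B.Tr l p q := by
    intro p y
    refine path_embed (fun p => 2 * p + 1) ?_
    intro p a y
    simp only [Tr, union, List.mem_append, List.mem_map, Prod.mk.injEq, Prod.exists]
    constructor
    · rintro (⟨p', a', q, h, h1, rfl, h2⟩ | ⟨p', a', q, h, h1, rfl, h2⟩)
      · omega
      · obtain rfl : p' = p := by omega
        exact ⟨q, h2, h⟩
    · rintro ⟨q, rfl, h⟩; exact .inr ⟨p, a, q, h, rfl, rfl, rfl⟩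
  have hI : ∀ x, x ∈ (A.union B).1 ↔ (∃ p ∈ A.1, 2 * p = x) ∨ ∃ p ∈ B.1, 2 * p + 1 = x := by
    simp [union]
  have hF : ∀ x, x ∈ (A.union B).2.2 ↔ (∃ p ∈ A.2.2, 2 * p = x) ∨ ∃ p ∈ B.2.2, 2 * p + 1 = x := by
    simp [union]
  simp only [Accepts, hI, hF]
  constructor
  · rintro ⟨_, ⟨p, hp, rfl⟩ | ⟨p, hp, rfl⟩, q, hq, h⟩
    · obtain ⟨q', rfl, h'⟩ := (hA _ _).1 h
      rcases hq with ⟨q, hq, e⟩ | ⟨q, hq, e⟩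
      · obtain rfl : q = q' := by omega
        exact .inl ⟨p, hp, q, hq, h'⟩
      · omega
    · obtain ⟨q', rfl, h'⟩ := (hB _ _).1 h
      rcases hq with ⟨q, hq, e⟩ | ⟨q, hq, e⟩
      · omega
      · obtain rfl : q = q' := by omega
        exact .inr ⟨p, hp, q, hq, h'⟩
  · rintro (⟨p, hp, q, hq, h⟩ | ⟨p, hp, q, hq, h⟩)
    · exact ⟨_, .inl ⟨p, hp, rfl⟩, _, .inl ⟨q, hq, rfl⟩, (hA _ _).2 ⟨q, rfl, h⟩⟩
    · exact ⟨_, .inr ⟨p, hp, rfl⟩, _, .inr ⟨q, hq, rfl⟩, (hB _ _).2 ⟨q, rfl, h⟩⟩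

/-- The product automaton, on pairs of states. -/
def inter [DecidableEq α] (A B : ListAut α) : ListAut α :=
  (A.1.flatMap fun p => B.1.map fun q => Nat.pair p q,
    A.2.1.flatMap fun t => (B.2.1.filter fun t' => t'.2.1 = t.2.1).map fun t' =>
      (Nat.pair t.1 t'.1, t.2.1, Nat.pair t.2.2 t'.2.2),
    A.2.2.flatMap fun p => B.2.2.map fun q => Nat.pair p q)

theorem accepts_inter [DecidableEq α] {A B : ListAut α} {l : List α} :
    (A.inter B).Accepts l ↔ A.Accepts l ∧ B.Accepts l := by
  have h : ∀ (p : ℕ × ℕ) y, Path (A.inter B).Tr l (Nat.pair p.1 p.2) y ↔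
      ∃ q : ℕ × ℕ, Nat.pair q.1 q.2 = y ∧ Path A.Tr l p.1 q.1 ∧ Path B.Tr l p.2 q.2 := by
    intro p y
    simp only [← path_prod (T := A.Tr) (T' := B.Tr)]
    refine path_embed (fun p : ℕ × ℕ => Nat.pair p.1 p.2) ?_
    rintro ⟨p, p'⟩ a y
    simp only [Tr, inter, List.mem_flatMap, List.mem_map, List.mem_filter, decide_eq_true_eq,
      Prod.mk.injEq, Prod.exists, Nat.pair_eq_pair]
    constructor
    · rintro ⟨_, _, q, h, _, _, q', ⟨h', rfl⟩, ⟨rfl, rfl⟩, rfl, rfl⟩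
      exact ⟨q, q', rfl, h, h'⟩
    · rintro ⟨q, q', rfl, h, h'⟩
      exact ⟨_, _, q, h, _, _, q', ⟨h', rfl⟩, ⟨rfl, rfl⟩, rfl, rfl⟩
  constructor
  · rintro ⟨_, hp, _, hq, hl⟩
    simp only [inter, List.mem_flatMap, List.mem_map] at hp hq
    obtain ⟨p, hp, p', hp', rfl⟩ := hp
    obtain ⟨q, hq, q', hq', rfl⟩ := hq
    obtain ⟨⟨r, r'⟩, e, h1, h2⟩ := (h (p, p') _).1 hl
    rw [Nat.pair_eq_pair] at e
    obtain ⟨rfl, rfl⟩ := e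
    exact ⟨⟨_, hp, _, hq, h1⟩, _, hp', _, hq', h2⟩
  · rintro ⟨⟨p, hp, q, hq, h1⟩, p', hp', q', hq', h2⟩
    exact ⟨Nat.pair p p', by simp only [inter, List.mem_flatMap, List.mem_map]; exact
      ⟨p, hp, p', hp', rfl⟩, Nat.pair q q', by
      simp only [inter, List.mem_flatMap, List.mem_map]; exact ⟨q, hq, q', hq', rfl⟩,
      (h (p, p') _).2 ⟨(q, q'), rfl, h1, h2⟩⟩

/-- The image under a map of letters. -/
def relabel (f : α → β) (A : ListAut α) : ListAut β :=
  (A.1, A.2.1.map fun t => (t.1, f t.2.1, t.2.2), A.2.2)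

theorem accepts_relabel {f : α → β} {A : ListAut α} {l : List β} :
    (A.relabel f).Accepts l ↔ ∃ l', l'.map f = l ∧ A.Accepts l' := by
  have h : ∀ p q, Path (A.relabel f).Tr l p q ↔ ∃ l', l'.map f = l ∧ Path A.Tr l' p q := by
    intro p q
    refine path_relabel f ?_
    intro p b q
    simp only [Tr, relabel, List.mem_map, Prod.mk.injEq, Prod.exists]
    constructor
    · rintro ⟨_, a, _, h, rfl, rfl, rfl⟩; exact ⟨a, rfl, h⟩
    · rintro ⟨a, rfl, h⟩; exact ⟨_, a, _, h, rfl, rfl, rfl⟩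
  simp only [Accepts, h]
  constructor
  · rintro ⟨p, hp, q, hq, l', e, h⟩; exact ⟨l', e, p, hp, q, hq, h⟩
  · rintro ⟨l', e, p, hp, q, hq, h⟩; exact ⟨p, hp, q, hq, l', e, h⟩

/-- All subsequences of a list. -/
def subs {β : Type} (l : List β) : List (List β) :=
  l.foldr (fun a r => r ++ r.map (a :: ·)) [[]]

theorem filter_mem_subs {β : Type} (p : β → Bool) (l : List β) : l.filter p ∈ subs l := by
  induction l with
  | nil => simp [subs]
  | cons a l ih =>
    rw [subs, List.foldr_cons, ← subs]
    cases h : p a <;> simp [h, ih]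

/-- All states that are initial or the target of a transition. -/
def states (A : ListAut α) : List ℕ := A.1 ++ A.2.1.map fun t => t.2.2

/-- The states that can be reached from `S` by the letter `a`. -/
def succs [DecidableEq α] (A : ListAut α) (S : List ℕ) (a : α) : List ℕ :=
  A.states.filter fun q => ∃ p ∈ S, (p, a, q) ∈ A.2.1

/-- The subset construction, followed by complementation, for words over the list `L`. A set of
states is represented by the subsequence of `A.states` that consists of its elements. -/
def compl [DecidableEq α] (L : List α) (A : ListAut α) : ListAut α :=
  ([Encodable.encode (A.states.filter fun q => q ∈ A.1)],
    (subs A.states).flatMap fun S => L.map fun a =>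
      (Encodable.encode S, a, Encodable.encode (A.succs S a)),
    ((subs A.states).filter fun S => ¬ ∃ q ∈ S, q ∈ A.2.2).map Encodable.encode)

theorem mem_foldl_succs [DecidableEq α] {A : ListAut α} {l : List α} {S : List ℕ} {q : ℕ} :
    q ∈ l.foldl A.succs S ↔ ∃ p ∈ S, Path A.Tr l p q := by
  induction l generalizing S with
  | nil => simp [Path]
  | cons a l ih =>
    simp only [List.foldl_cons, ih, Path]
    constructor
    · rintro ⟨r, hr, h⟩
      simp only [succs, List.mem_filter, decide_eq_true_eq] at hr
      obtain ⟨-, p, hp, hr⟩ := hr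
      exact ⟨p, hp, r, hr, h⟩
    · rintro ⟨p, hp, r, hr, h⟩
      refine ⟨r, ?_, h⟩
      simp only [succs, List.mem_filter, decide_eq_true_eq, states, List.mem_append, List.mem_map]
      exact ⟨.inr ⟨_, hr, rfl⟩, p, hp, hr⟩

theorem accepts_compl [DecidableEq α] {L : List α} {A : ListAut α} {l : List α}
    (hl : ∀ a ∈ l, a ∈ L) : (A.compl L).Accepts l ↔ ¬ A.Accepts l := by
  have hp : ∀ S ∈ subs A.states, ∀ y, Path (A.compl L).Tr l (Encodable.encode S) y ↔
      y = Encodable.encode (l.foldl A.succs S) ∧ l.foldl A.succs S ∈ subs A.states := by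
    induction l with
    | nil => intro S hS y; simp [Path, hS, eq_comm]
    | cons a l ih =>
      intro S hS y
      have ha : a ∈ L := hl a (by simp)
      have hS' : A.succs S a ∈ subs A.states := filter_mem_subs _ _
      rw [List.foldl_cons, ← ih (fun b hb => hl b (by simp [hb])) _ hS']
      simp only [Path]
      constructor
      · rintro ⟨r, hr, h⟩
        simp only [Tr, compl, List.mem_flatMap, List.mem_map, Prod.mk.injEq] at hr
        obtain ⟨S₁, -, a', -, e, rfl, rfl⟩ := hr
        rw [Encodable.encode_inj] at e
        rwa [← e]
      · intro h
        refine ⟨_, ?_, h⟩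
        simp only [Tr, compl, List.mem_flatMap, List.mem_map, Prod.mk.injEq]
        exact ⟨S, hS, a, ha, rfl, rfl, rfl⟩
  have h0 : A.states.filter (fun q => q ∈ A.1) ∈ subs A.states := filter_mem_subs _ _
  have hm : ∀ q, q ∈ A.states.filter (fun q => q ∈ A.1) ↔ q ∈ A.1 := by
    simp +contextual [states]
  have hacc : (A.compl L).Accepts l ↔
      ¬ ∃ q ∈ l.foldl A.succs (A.states.filter fun q => q ∈ A.1), q ∈ A.2.2 := by
    constructor
    · rintro ⟨p, hp', q, hq, h⟩
      simp only [compl, List.mem_singleton] at hp'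
      subst hp'
      simp only [compl, List.mem_map, List.mem_filter, decide_eq_true_eq] at hq
      obtain ⟨S, ⟨-, hS⟩, rfl⟩ := hq
      have := ((hp _ h0 _).1 h).1
      rw [Encodable.encode_inj] at this
      rwa [this] at hS
    · intro h
      have h' : l.foldl A.succs (A.states.filter fun q => q ∈ A.1) ∈ subs A.states := by
        rcases List.eq_nil_or_concat l with rfl | ⟨l', a, rfl⟩
        · exact h0
        · simp only [List.concat_eq_append, List.foldl_append, List.foldl_cons, List.foldl_nil]
          exact filter_mem_subs _ _
      refine ⟨_, List.mem_singleton.2 rfl, _, ?_, (hp _ h0 _).2 ⟨rfl, h'⟩⟩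
      simp only [compl, List.mem_map, List.mem_filter, decide_eq_true_eq]
      exact ⟨_, ⟨h', h⟩, rfl⟩
  rw [hacc, not_iff_not]
  simp only [mem_foldl_succs, hm, Accepts]
  constructor
  · rintro ⟨q, ⟨p, hp, h⟩, hq⟩; exact ⟨p, hp, q, hq, h⟩
  · rintro ⟨p, hp, q, hq, h⟩; exact ⟨q, ⟨p, hp, h⟩, hq⟩

/-! ### Primitive recursiveness of the constructions -/

section Primrec
open Primrec
variable {γ : Type} [Primcodable α] [Primcodable β] [Primcodable γ]

theorem primrec_union {f g : γ → ListAut α} (hf : Primrec f) (hg : Primrec g) :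
    Primrec fun c => (f c).union (g c) := by
  have h2 : Primrec fun n : ℕ => 2 * n := Primrec.nat_double
  have h3 : Primrec fun n : ℕ => 2 * n + 1 := Primrec.nat_double_succ
  have k {m : ℕ → ℕ} (hm : Primrec m) :
      Primrec fun t : ℕ × α × ℕ => (m t.1, t.2.1, m t.2.2) :=
    .pair (hm.comp .fst) (.pair (Primrec.fst.comp .snd) (hm.comp (Primrec.snd.comp .snd)))
  exact .pair
    (list_append.comp (list_map (Primrec.fst.comp hf) (h2.comp snd).to₂)
      (list_map (Primrec.fst.comp hg) (h3.comp snd).to₂))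
    (.pair (list_append.comp
        (list_map (Primrec.fst.comp (Primrec.snd.comp hf)) ((k h2).comp snd).to₂)
        (list_map (Primrec.fst.comp (Primrec.snd.comp hg)) ((k h3).comp snd).to₂))
      (list_append.comp (list_map (Primrec.snd.comp (Primrec.snd.comp hf)) (h2.comp snd).to₂)
        (list_map (Primrec.snd.comp (Primrec.snd.comp hg)) (h3.comp snd).to₂)))

theorem primrec_filter {p : γ → β → Bool} {f : γ → List β} (hf : Primrec f) (hp : Primrec₂ p) :
    Primrec fun c => (f c).filter (p c) := by
  refine (listFilterMap (g := fun c b => if p c b = true then some b else none) hf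
    (Primrec.ite (Primrec.eq.comp hp (.const true)) (option_some.comp snd) (.const none)).to₂).of_eq ?_
  intro c
  rw [← List.filterMap_eq_filter]
  rfl

theorem primrec_inter [DecidableEq α] {f g : γ → ListAut α} (hf : Primrec f) (hg : Primrec g) :
    Primrec fun c => (f c).inter (g c) := by
  have hP {u v : γ → List ℕ} (hu : Primrec u) (hv : Primrec v) :
      Primrec fun c => (u c).flatMap fun p => (v c).map fun q => Nat.pair p q :=
    list_flatMap hu (list_map (hv.comp fst) (Primrec₂.natPair.comp (snd.comp fst) snd).to₂).to₂
  refine .pair (hP (fst.comp hf) (fst.comp hg)) (.pair ?_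
    (hP (snd.comp (snd.comp hf)) (snd.comp (snd.comp hg))))
  refine list_flatMap (fst.comp (snd.comp hf)) (.mk (list_map (primrec_filter
    (fst.comp (snd.comp (hg.comp fst))) (.mk ?_)) (.mk ?_)))
  · exact Primrec.eq.decide.comp (fst.comp (snd.comp snd)) (fst.comp (snd.comp (snd.comp fst)))
  · exact Primrec.pair (Primrec₂.natPair.comp (fst.comp (snd.comp fst)) (fst.comp snd))
      (.pair (fst.comp (snd.comp (snd.comp fst))) (Primrec₂.natPair.comp
        (snd.comp (snd.comp (snd.comp fst))) (snd.comp (snd.comp snd))))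

theorem primrec_relabel {h : α → β} {f : γ → ListAut α} (hh : Primrec h) (hf : Primrec f) :
    Primrec fun c => (f c).relabel h :=
  .pair (fst.comp hf) (.pair (list_map (fst.comp (snd.comp hf))
    (Primrec.pair (fst.comp snd) (.pair (hh.comp (fst.comp (snd.comp snd)))
      (snd.comp (snd.comp snd)))).to₂) (snd.comp (snd.comp hf)))

theorem primrec_subs : Primrec (subs : List β → List (List β)) := by
  refine list_foldr (f := fun l : List β => l) (g := fun _ => ([[]] : List (List β)))
    (h := fun _ p => p.2 ++ p.2.map (p.1 :: ·)) .id (.const [[]]) (.mk ?_)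
  exact list_append.comp (snd.comp snd) (list_map (snd.comp snd)
    (list_cons.comp (fst.comp (snd.comp fst)) snd).to₂)

theorem primrec_states : Primrec (states : ListAut α → List ℕ) :=
  list_append.comp fst (list_map (fst.comp snd) (snd.comp (snd.comp snd)).to₂)

theorem primrecPred_mem [DecidableEq β] {f : γ → β} {g : γ → List β} (hf : Primrec f)
    (hg : Primrec g) : PrimrecPred fun c => f c ∈ g c :=
  ((PrimrecRel.exists_mem_list (Primrec.eq (α := β))).comp hg hf).of_eq fun c => by simp

theorem primrec_succs [DecidableEq α] :
    Primrec fun p : ListAut α × List ℕ × α => p.1.succs p.2.1 p.2.2 := by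
  refine primrec_filter (primrec_states.comp fst) (.mk (PrimrecPred.decide ?_))
  have : PrimrecRel fun (S : List ℕ) (c : (ListAut α × List ℕ × α) × ℕ) =>
      ∃ p ∈ S, (p, c.1.2.2, c.2) ∈ c.1.1.2.1 :=
    PrimrecRel.exists_mem_list (R := fun p (c : (ListAut α × List ℕ × α) × ℕ) =>
      (p, c.1.2.2, c.2) ∈ c.1.1.2.1) (PrimrecPred.primrecRel
      (primrecPred_mem (.pair fst (.pair (snd.comp (snd.comp (fst.comp snd))) (snd.comp snd)))
        (fst.comp (snd.comp (fst.comp (fst.comp snd))))))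
  exact this.comp (fst.comp (snd.comp fst)) .id

theorem primrec_compl [DecidableEq α] {f : γ → ListAut α} {L : γ → List α} (hf : Primrec f)
    (hL : Primrec L) : Primrec fun c => (f c).compl (L c) := by
  have hs := primrec_states.comp hf
  have hss := primrec_subs.comp hs
  refine .pair (list_cons.comp (Primrec.encode.comp (primrec_filter hs
    (.mk (PrimrecPred.decide (primrecPred_mem snd (fst.comp (hf.comp fst))))))) (.const []))
    (.pair ?_ ?_)
  · refine list_flatMap hss (.mk (list_map (hL.comp fst) (.mk
      (Primrec.pair (Primrec.encode.comp (snd.comp fst))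
      (.pair snd (Primrec.encode.comp ?_))))))
    exact primrec_succs.comp (.pair (hf.comp (fst.comp fst)) (.pair (snd.comp fst) snd))
  · refine list_map (primrec_filter hss (.mk (PrimrecPred.decide (PrimrecPred.not ?_))))
      (.mk (Primrec.encode.comp snd))
    exact (PrimrecRel.exists_mem_list (R := fun q (l : List ℕ) => q ∈ l)
      (PrimrecPred.primrecRel (primrecPred_mem fst snd))).comp snd
        (snd.comp (snd.comp (hf.comp fst)))

end Primrec

end ListAut

/-! ### Runs of ordered decision diagrams -/

/-- The number of bits of the code of a layer of width `w` for `A` labels (including padding). -/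
def layerLen (w A : ℕ) : ℕ := 2 * w + w * (A * w) + 2 * w + 2

/-- The position of the bit for the transition from `p` to `q` with the `i`-th label. -/
def transPos (w A p i q : ℕ) : ℕ := 2 * w + (p * (A * w) + (i * w + q))

/-- The position of the bit for the initial state `p`. -/
def initPos (w A p : ℕ) : ℕ := 2 * w + w * (A * w) + p

/-- The position of the bit for the final state `q`. -/
def finalPos (w A q : ℕ) : ℕ := 2 * w + w * (A * w) + w + q

section Code
variable {α β : Type}

theorem length_flatMap_const {f : α → List β} {c : ℕ} (hf : ∀ x, (f x).length = c) (l : List α) :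
    (l.flatMap f).length = l.length * c := by
  simp [List.length_flatMap, hf]

theorem getElem?_flatMap_const {f : α → List β} {c : ℕ} (hf : ∀ x, (f x).length = c) {l : List α}
    {x : α} {i j : ℕ} (hi : l[i]? = some x) (hj : j < c) : (l.flatMap f)[i * c + j]? = (f x)[j]? := by
  induction l generalizing i with
  | nil => simp at hi
  | cons a l ih =>
    cases i with
    | zero =>
      simp only [List.getElem?_cons_zero, Option.some.injEq] at hi
      subst hi
      rw [List.flatMap_cons, List.getElem?_append_left (by simp [hf, hj])]
      simp
    | succ i =>
      rw [List.flatMap_cons, List.getElem?_append_right (by rw [hf]; nlinarith), hf,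
        show (i + 1) * c + j - c = i * c + j by rw [add_mul]; omega]
      exact ih (by simpa using hi)

variable [DecidableEq α] {w : ℕ} {letters : List α} {B : Layer α w}

theorem length_layerCode : (layerCode letters B).length = layerLen w (letters.length + 1) := by
  unfold layerCode layerLen
  simp only [List.length_append, List.length_map, List.length_finRange, List.length_cons,
    List.length_nil]
  rw [length_flatMap_const (c := (letters.length + 1) * w)]
  · simp; ring
  · intro p
    rw [length_flatMap_const (c := w)]
    · simp
    · simp

theorem layerCode_eq_one_iff_zero_or_one {b : ℕ} (h : b ∈ layerCode letters B) :
    b = 0 ∨ b = 1 := by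
  have hite : ∀ (p : Prop) [Decidable p], (if p then 1 else 0 : ℕ) = 0 ∨
    (if p then 1 else 0 : ℕ) = 1 := fun p _ => by split <;> simp
  have hb : ∀ x : Bool, x.toNat = 0 ∨ x.toNat = 1 := by decide
  simp only [layerCode, List.mem_append, List.mem_map, List.mem_flatMap, List.mem_cons,
    List.not_mem_nil, or_false] at h
  rcases h with ((((⟨_, _, rfl⟩ | ⟨_, _, rfl⟩) | ⟨_, _, _, _, _, _, rfl⟩) | ⟨_, _, rfl⟩) |
    ⟨_, _, rfl⟩) | rfl | rfl
  any_goals exact hite _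
  all_goals exact hb _

theorem getElem?_layerCode_trans {p q : Fin w} {o : Option α} {i : ℕ}
    (hi : (none :: letters.map some)[i]? = some o) :
    (layerCode letters B)[transPos w (letters.length + 1) p i q]? =
      some (if (p, o, q) ∈ B.trans then 1 else 0) := by
  have h1 : ∀ (p : Fin w) (a : Option α), (((List.finRange w).map fun q =>
    if (p, a, q) ∈ B.trans then 1 else 0) : List ℕ).length = w := by simp
  have h2 : ∀ p : Fin w, (((none :: letters.map some).flatMap fun a =>
      (List.finRange w).map fun q => if (p, a, q) ∈ B.trans then 1 else 0) : List ℕ).length =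
      (letters.length + 1) * w := by
    intro p
    rw [length_flatMap_const (h1 p)]
    simp
  have hlt : i < letters.length + 1 := by
    have := (List.getElem?_eq_some_iff.1 hi).1
    simpa using this
  have hlt2 : i * w + q < (letters.length + 1) * w := by
    have := q.2
    nlinarith
  have h3 := length_flatMap_const h2 (List.finRange w)
  have hlt3 : p * ((letters.length + 1) * w) + (i * w + q) < w * ((letters.length + 1) * w) := by
    have := Nat.mul_le_mul_right ((letters.length + 1) * w) (Nat.succ_le_of_lt p.2)
    rw [Nat.succ_mul] at this
    omega
  unfold layerCode transPos
  rw [List.append_assoc, List.append_assoc, List.getElem?_append_left]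
  swap
  · simp only [List.length_append, h3]
    simp; omega
  rw [List.getElem?_append_right (by simp; omega)]
  simp only [List.length_append, List.length_map, List.length_finRange]
  rw [show 2 * w + (p * ((letters.length + 1) * w) + (i * w + q)) - (w + w) =
    p * ((letters.length + 1) * w) + (i * w + q) by omega,
    getElem?_flatMap_const h2 (x := p) (by simp) hlt2, getElem?_flatMap_const (h1 p) hi q.2]
  simp

theorem getElem?_layerCode_init {p : Fin w} :
    (layerCode letters B)[initPos w (letters.length + 1) p]? =
      some (if p ∈ B.init then 1 else 0) := by
  have h1 : ∀ p : Fin w, (((none :: letters.map some).flatMap fun a =>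
      (List.finRange w).map fun q => if (p, a, q) ∈ B.trans then 1 else 0) : List ℕ).length =
      (letters.length + 1) * w := by
    intro p
    rw [length_flatMap_const (c := w) (by simp)]
    simp
  have h3 := length_flatMap_const h1 (List.finRange w)
  unfold layerCode initPos
  rw [List.append_assoc, List.append_assoc, List.getElem?_append_right, List.getElem?_append_left]
  · simp only [List.length_append, h3]
    simp [show 2 * w + w * ((letters.length + 1) * w) + p -
      (w + w + w * ((letters.length + 1) * w)) = p by omega]
  · simp only [List.length_append, h3]
    simp; omega
  · simp only [List.length_append, h3]
    simp; omega

theorem getElem?_layerCode_final {p : Fin w} :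
    (layerCode letters B)[finalPos w (letters.length + 1) p]? =
      some (if p ∈ B.final then 1 else 0) := by
  have h1 : ∀ p : Fin w, (((none :: letters.map some).flatMap fun a =>
      (List.finRange w).map fun q => if (p, a, q) ∈ B.trans then 1 else 0) : List ℕ).length =
      (letters.length + 1) * w := by
    intro p
    rw [length_flatMap_const (c := w) (by simp)]
    simp
  have h3 := length_flatMap_const h1 (List.finRange w)
  unfold layerCode finalPos
  rw [List.append_assoc, List.getElem?_append_right, List.getElem?_append_left]
  · simp only [List.length_append, h3]
    simp [show 2 * w + w * ((letters.length + 1) * w) + w + p -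
      (w + w + w * ((letters.length + 1) * w) + w) = p by omega]
  · simp only [List.length_append, h3]
    simp; omega
  · simp only [List.length_append, h3]
    simp; omega

end Code

/-- The letters of the automata: the bits of a symbol of the layer alphabet, and the values of the
variables (`0` for padding), the last quantified variable first. -/
abbrev Letter : Type := List ℕ × List ℕ

/-- The transitions with letter `a` that arise from a transition of the diagram from `p` to `q`
with the `i`-th label. State `0` is initial, state `1` is final, and `2 * p + 2` and `2 * p + 3`
stand for the state `p` of the diagram, before and after the first padding symbol, whose label has
number `0`. So letters cannot follow padding; and as padding does not lead out of the initial state,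
the accepted strings are not empty. -/
def oddTrans (w off A : ℕ) (a : Letter) (i p q : ℕ) : List (ℕ × Letter × ℕ) :=
  if a.1[off + transPos w A p i q]? = some 1 then
    ((2 * p + 2) :: (if i = 0 then [2 * p + 3] else
        if a.1[off + initPos w A p]? = some 1 then [0] else [])).flatMap fun x =>
      ((2 * q + 2 + if i = 0 then 1 else 0) ::
        (if a.1[off + finalPos w A q]? = some 1 then [1] else [])).map fun y => (x, a, y)
  else []

/-- The automaton that runs through the diagram whose layers stand from bit `off` on. The list
holds the letters together with the label of the transitions that they call for. -/
def oddAut (w off A : ℕ) (Λ : List (Letter × ℕ)) : ListAut Letter :=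
  ([0], Λ.flatMap fun a => (List.range w).flatMap fun p => (List.range w).flatMap fun q =>
    oddTrans w off A a.1 a.2 p q, [1])

theorem oddAut_tr {w off A : ℕ} {Λ : List (Letter × ℕ)} {x y : ℕ} {a : Letter} :
    (oddAut w off A Λ).Tr x a y ↔ ∃ i, (a, i) ∈ Λ ∧ ∃ p < w, ∃ q < w,
      a.1[off + transPos w A p i q]? = some 1 ∧
      (x = 2 * p + 2 ∨ i = 0 ∧ x = 2 * p + 3 ∨
        i ≠ 0 ∧ a.1[off + initPos w A p]? = some 1 ∧ x = 0) ∧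
      (y = 2 * q + 2 + (if i = 0 then 1 else 0) ∨ a.1[off + finalPos w A q]? = some 1 ∧ y = 1) := by
  have key : ∀ (b : Letter) (i p q : ℕ), (x, a, y) ∈ oddTrans w off A b i p q ↔ b = a ∧
      a.1[off + transPos w A p i q]? = some 1 ∧
      (x = 2 * p + 2 ∨ i = 0 ∧ x = 2 * p + 3 ∨
        i ≠ 0 ∧ a.1[off + initPos w A p]? = some 1 ∧ x = 0) ∧
      (y = 2 * q + 2 + (if i = 0 then 1 else 0) ∨
        a.1[off + finalPos w A q]? = some 1 ∧ y = 1) := by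
    intro b i p q
    unfold oddTrans
    split_ifs with h1 h2 h3 h4 <;> simp <;> grind
  simp only [ListAut.Tr, oddAut, List.mem_flatMap, key, List.mem_range]
  constructor
  · rintro ⟨⟨b, i⟩, hΛ, p, hp, q, hq, rfl, h⟩; exact ⟨i, hΛ, p, hp, q, hq, h⟩
  · rintro ⟨i, hΛ, p, hp, q, hq, h⟩; exact ⟨(a, i), hΛ, p, hp, q, hq, rfl, h⟩

/-- A sequence of optional letters in which padding persists is a padded string. -/
theorem exists_padded {β : Type} (o : ℕ → Option β) (k : ℕ)
    (h : ∀ i, i + 1 < k → o i = none → o (i + 1) = none) :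
    ∃ u : List β, u.length ≤ k ∧ ∀ i < k, u[i]? = o i := by
  induction k with
  | zero => exact ⟨[], by simp, by simp⟩
  | succ k ih =>
    obtain ⟨u, hu, hi⟩ := ih fun i h' => h i (by omega)
    cases hk : o k with
    | none =>
      refine ⟨u, by omega, fun i hik => ?_⟩
      by_cases e : i = k
      · subst e; rw [hk]; simpa using hu
      · exact hi i (by omega)
    | some b =>
      have hlen : u.length = k := by
        by_contra hne
        have h1 : o (k - 1) = none := by
          rw [← hi (k - 1) (by omega)]; simp; omega
        have := h (k - 1) (by omega) h1
        rw [show k - 1 + 1 = k by omega, hk] at this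
        simp at this
      refine ⟨u ++ [b], by simp; omega, fun i hik => ?_⟩
      by_cases e : i = k
      · subst e; rw [hk, ← hlen]; simp
      · rw [List.getElem?_append_left (by omega)]; exact hi i (by omega)

/-- The automaton accepts exactly the padded strings of the language of the diagram. -/
theorem accepts_oddAut {β : Type} {w off A : ℕ} {D : List (Layer β w)} {L : List Letter}
    {idx : Letter → ℕ} {enc : Option β → ℕ} {V : ℕ → Letter} (hinj : enc.Injective)
    (hnone : enc none = 0) (hsurj : ∀ a ∈ L, ∃ o, enc o = idx a)
    (htrans : ∀ (i : ℕ) (h : i < D.length) (p q : Fin w) (o : Option β),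
      (V i).1[off + transPos w A p (enc o) q]? = some 1 ↔ (p, o, q) ∈ (D[i]).trans)
    (hinit : ∀ (i : ℕ) (h : i < D.length) (p : Fin w),
      (V i).1[off + initPos w A p]? = some 1 ↔ p ∈ (D[i]).init)
    (hfinal : ∀ (i : ℕ) (h : i < D.length) (p : Fin w),
      (V i).1[off + finalPos w A p]? = some 1 ↔ p ∈ (D[i]).final) :
    (oddAut w off A (L.map fun a => (a, idx a))).Accepts ((List.range D.length).map V) ↔
      (∀ i < D.length, V i ∈ L) ∧
        ∃ u ∈ oddLang D, ∀ i < D.length, idx (V i) = enc u[i]? := by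
  have hz : ∀ o, enc o = 0 ↔ o = none := fun o => by rw [← hnone]; exact hinj.eq_iff
  simp only [ListAut.Accepts]
  have hmem : ∀ a i, (a, i) ∈ L.map (fun a => (a, idx a)) ↔ a ∈ L ∧ idx a = i := by
    intro a i
    simp only [List.mem_map, Prod.mk.injEq]
    exact ⟨by rintro ⟨b, hb, rfl, rfl⟩; exact ⟨hb, rfl⟩, fun h => ⟨a, h.1, rfl, h.2⟩⟩
  simp only [path_map_range, oddAut_tr, hmem]
  constructor
  · rintro ⟨p0, hp0, q0, hq0, st, h0, hk, hst⟩
    obtain rfl : p0 = 0 := by simpa [oddAut] using hp0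
    obtain rfl : q0 = 1 := by simpa [oddAut] using hq0
    have hk0 : D.length ≠ 0 := fun e => by rw [e, h0] at hk; omega
    have hL : ∀ i < D.length, V i ∈ L := fun i hi => by
      obtain ⟨_, ⟨h, -⟩, -⟩ := hst i hi
      exact h
    refine ⟨hL, ?_⟩
    have h1 : ∀ i, ∃ (p q : ℕ) (o : Option β), i < D.length → p < w ∧ q < w ∧ idx (V i) = enc o ∧
        (V i).1[off + transPos w A p (enc o) q]? = some 1 ∧
        (st i = 2 * p + 2 ∨ enc o = 0 ∧ st i = 2 * p + 3 ∨
          enc o ≠ 0 ∧ (V i).1[off + initPos w A p]? = some 1 ∧ st i = 0) ∧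
        (st (i + 1) = 2 * q + 2 + (if enc o = 0 then 1 else 0) ∨
          (V i).1[off + finalPos w A q]? = some 1 ∧ st (i + 1) = 1) := by
      intro i
      by_cases hi : i < D.length
      · obtain ⟨_, ⟨hV, rfl⟩, p, hp, q, hq, h⟩ := hst i hi
        obtain ⟨o, ho⟩ := hsurj _ hV
        rw [← ho] at h
        exact ⟨p, q, o, fun _ => ⟨hp, hq, ho.symm, h⟩⟩
      · exact ⟨0, 0, none, fun h => absurd h hi⟩
    choose p q o hpq using h1
    have hnext : ∀ i, i + 1 < D.length → p (i + 1) = q i ∧ (o i = none → o (i + 1) = none) := by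
      intro i hi
      obtain ⟨-, -, -, -, -, h⟩ := hpq i (by omega)
      obtain ⟨-, -, -, -, h', -⟩ := hpq (i + 1) hi
      rw [← hz, ← hz]
      split_ifs at h with e
      · refine ⟨?_, fun _ => ?_⟩ <;> omega
      · refine ⟨?_, fun e' => absurd e' e⟩; omega
    obtain ⟨u, hu, hui⟩ := exists_padded o D.length fun i hi => (hnext i hi).2
    have hinit0 : enc (o 0) ≠ 0 ∧ (V 0).1[off + initPos w A (p 0)]? = some 1 := by
      obtain ⟨-, -, -, -, h, -⟩ := hpq 0 (by omega)
      rw [h0] at h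
      rcases h with h | h | h
      · omega
      · omega
      · exact ⟨h.1, h.2.1⟩
    refine ⟨u, ⟨?_, hu, ?_⟩, fun i hi => by rw [hui i hi, (hpq i hi).2.2.1]⟩
    · rintro rfl
      have := hui 0 (by omega)
      exact hinit0.1 (by rw [hz, ← this]; simp)
    · refine ⟨fun i => (⟨p i, (hpq i i.2).1⟩, o i, ⟨q i, (hpq i i.2).2.1⟩),
        fun i => (hui i i.2).symm, fun i => ?_, fun i j hij => ?_, fun i hi => ?_, fun i hi => ?_⟩
      · exact (htrans i i.2 _ _ _).1 (hpq i i.2).2.2.2.1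
      · have := j.2
        simp only [Fin.mk.injEq]
        rw [hij]
        exact (hnext i (by omega)).1
      · have := (hinit 0 (by omega) ⟨p 0, (hpq 0 (by omega)).1⟩).1 hinit0.2
        obtain ⟨i, hi'⟩ := i
        simp only at hi
        subst hi
        exact this
      · obtain ⟨hp, hq, -, -, -, h⟩ := hpq i i.2
        rw [hi, hk] at h
        rcases h with h | h
        · omega
        · exact (hfinal i i.2 ⟨q i, hq⟩).1 h.1
  · rintro ⟨hL, u, ⟨hne, hlen, t, ht1, ht2, ht3, ht4, ht5⟩, hidx⟩
    have hk0 : 0 < D.length := lt_of_lt_of_le (List.length_pos_iff.2 hne) hlen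
    refine ⟨0, by simp [oddAut], 1, by simp [oddAut], fun i => if h : i = 0 then 0 else
      if h' : i < D.length then 2 * ((t ⟨i - 1, by omega⟩).2.2 : ℕ) + 2 +
        (if enc u[i - 1]? = 0 then 1 else 0) else 1, by simp,
      by beta_reduce; rw [dif_neg hk0.ne', dif_neg (lt_irrefl _)], fun i hi => ?_⟩
    refine ⟨_, ⟨hL i hi, rfl⟩, (t ⟨i, hi⟩).1, (t ⟨i, hi⟩).1.2, (t ⟨i, hi⟩).2.2,
      (t ⟨i, hi⟩).2.2.2, ?_, ?_, ?_⟩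
    · rw [hidx i hi, htrans i hi]
      have h1 := ht1 ⟨i, hi⟩
      have h2 := ht2 ⟨i, hi⟩
      simp only at h1
      rw [← h1]
      exact h2
    · rw [hidx i hi]
      by_cases h : i = 0
      · subst h
        refine .inr (.inr ⟨?_, (hinit 0 hi _).2 (ht4 ⟨0, hi⟩ rfl), by simp⟩)
        rw [Ne, hz]
        simpa using hne
      · simp only [h, hi, dif_neg, not_false_eq_true, dif_pos]
        have h3 := ht3 ⟨i - 1, by omega⟩ ⟨i, hi⟩ (by simp; omega)
        rw [← h3]
        split_ifs with e
        · refine .inr (.inl ⟨?_, rfl⟩)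
          rw [hz] at e ⊢
          simp at e ⊢
          omega
        · exact .inl rfl
    · rw [hidx i hi]
      by_cases h : i + 1 < D.length
      · exact .inl (by simp [h])
      · exact .inr ⟨(hfinal i hi _).2 (ht5 ⟨i, hi⟩ (by simp; omega)), by simp [h]⟩

open FirstOrder

/-! ### The automaton of a sentence -/

/-- All lists of length `k` over `X`. -/
def listsOver (X : List ℕ) (k : ℕ) : List (List ℕ) :=
  (fun W => W.flatMap fun v => X.map (· :: v))^[k] [ [] ]

theorem mem_listsOver {X v : List ℕ} {k : ℕ} :
    v ∈ listsOver X k ↔ v.length = k ∧ ∀ x ∈ v, x ∈ X := by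
  induction k generalizing v with
  | zero =>
    simp only [listsOver, Function.iterate_zero, id, List.mem_singleton]
    constructor <;> simp +contextual
  | succ k ih =>
    rw [listsOver, Function.iterate_succ_apply', ← listsOver]
    simp only [List.mem_flatMap, List.mem_map, ih]
    constructor
    · rintro ⟨v, ⟨h1, h2⟩, x, hx, rfl⟩
      simpa [h1, hx] using h2
    · rintro ⟨h1, h2⟩
      cases v with
      | nil => simp at h1
      | cons x v =>
        simp only [List.mem_cons, forall_eq_or_imp] at h2
        exact ⟨v, ⟨by simpa using h1, h2.2⟩, x, h2.1, rfl⟩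

/-- The letters for symbols with `L` bits and `n` variables over an alphabet with `s` letters. -/
def alph (s L n : ℕ) : List Letter :=
  (listsOver [0, 1] L).flatMap fun b => (listsOver (List.range (s + 1)) n).map fun v => (b, v)

theorem mem_alph {s L n : ℕ} {a : Letter} :
    a ∈ alph s L n ↔ (a.1.length = L ∧ ∀ b ∈ a.1, b = 0 ∨ b = 1) ∧
      a.2.length = n ∧ ∀ x ∈ a.2, x < s + 1 := by
  simp only [alph, List.mem_flatMap, List.mem_map, mem_listsOver, List.mem_range, List.mem_cons,
    List.not_mem_nil, or_false]
  constructor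
  · rintro ⟨b, hb, v, hv, rfl⟩; exact ⟨hb, hv⟩
  · rintro ⟨hb, hv⟩; exact ⟨_, hb, _, hv, rfl⟩

/-- The number of bits of the code of a symbol of the layer alphabet. -/
def symbolLen (s w : ℕ) (ar : List ℕ) : ℕ :=
  layerLen w (s + 1) + (ar.map fun r => layerLen w ((s + 1) ^ r + 1)).sum

/-- The position at which the code of the layer of the `R`-th relation symbol starts. -/
def relOffset (s w : ℕ) (ar : List ℕ) (R : ℕ) : ℕ := symbolLen s w (ar.take R)

/-- The index of the label by which the variables `args` of the letter `v` are read: their values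
are the digits of a number in base `s + 1`; if all are padding, then so is the label. -/
def labelIndex (s n : ℕ) (args : List ℕ) (v : List ℕ) : ℕ :=
  if args.foldr (fun x d => v.getD (n - 1 - x) 0 + (s + 1) * d) 0 = 0 then 0
  else args.foldr (fun x d => v.getD (n - 1 - x) 0 + (s + 1) * d) 0 + 1

/-- The automaton of the atomic formula with relation symbol `R` and arguments `args`. -/
def relAut (s w : ℕ) (ar : List ℕ) (n R : ℕ) (args : List ℕ) : ListAut Letter :=
  oddAut w (relOffset s w ar R) ((s + 1) ^ (ar.getD R 0) + 1)
    ((alph s (symbolLen s w ar) n).map fun a => (a, labelIndex s n args a.2))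

/-- The automaton that checks that the last variable is an element of the domain. -/
def domAut (s w : ℕ) (ar : List ℕ) (n : ℕ) : ListAut Letter :=
  oddAut w 0 (s + 1) ((alph s (symbolLen s w ar) n).map fun a => (a, a.2.headI))

/-- The automaton that checks that the `i`-th and the `j`-th variable of each letter agree. It has
one state. -/
def eqAut (L : List Letter) (i j : ℕ) : ListAut Letter :=
  ([0], (L.filter fun a => a.2[i]? = a.2[j]?).map fun a => (0, a, 0), [0])

/-- The operation on letters that forgets the last variable. -/
def forget (a : Letter) : Letter := (a.1, a.2.tail)

/-- The automaton of a universal quantifier over the variable `n`: no element of the domain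
violates the formula with automaton `A`. -/
def allAut (s w : ℕ) (ar : List ℕ) (n : ℕ) (A : ListAut Letter) : ListAut Letter :=
  (((domAut s w ar (n + 1)).inter (A.compl (alph s (symbolLen s w ar) (n + 1)))).relabel
    forget).compl (alph s (symbolLen s w ar) n)

/-- The automaton of an implication. -/
def impAut (s w : ℕ) (ar : List ℕ) (n : ℕ) (A B : ListAut Letter) : ListAut Letter :=
  (A.compl (alph s (symbolLen s w ar) n)).union B

/-- The automaton of a formula over the vocabulary `τ`. -/
def formulaAut (s w : ℕ) {τ : Vocabulary} :
    {n : ℕ} → τ.language.BoundedFormula Empty n → ListAut Letter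
  | _, .falsum => ([], [], [])
  | n, .equal t₁ t₂ =>
    eqAut (alph s (symbolLen s w τ.code) n) (n - 1 - varIndex t₁) (n - 1 - varIndex t₂)
  | n, .rel R ts => relAut s w τ.code n R.1 (List.ofFn fun j => varIndex (ts j))
  | n, .imp φ ψ => impAut s w τ.code n (formulaAut s w φ) (formulaAut s w ψ)
  | n, .all φ => allAut s w τ.code n (formulaAut s w φ)

/-! ### Correctness of the automaton of a sentence -/

/-- The value of a letter or padding symbol. -/
def optCode {s : ℕ} (o : Option (Fin s)) : ℕ := (finSuccEquiv s).symm o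

theorem optCode_injective {s : ℕ} : (optCode (s := s)).Injective := fun _ _ h =>
  (finSuccEquiv s).symm.injective (Fin.ext h)

@[simp] theorem optCode_none {s : ℕ} : optCode (none : Option (Fin s)) = 0 := by
  simp [optCode]

theorem optCode_lt {s : ℕ} (o : Option (Fin s)) : optCode o < s + 1 := Fin.is_lt _

/-- The number of a label of a diagram for `r`-tuples: its position in the list of labels that
`layerCode` goes through. -/
def tupleCode {s r : ℕ} : Option (Fin r → Option (Fin s)) → ℕ
  | none => 0
  | some f => finFunctionFinEquiv (fun j => (finSuccEquiv s).symm (f j)) + 1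

theorem tupleCode_injective {s r : ℕ} : (tupleCode (s := s) (r := r)).Injective := by
  rintro (_ | f) (_ | g) h
  · rfl
  · simp [tupleCode] at h
  · simp [tupleCode] at h
  · simp only [tupleCode, add_left_inj] at h
    have := finFunctionFinEquiv.injective (Fin.ext h)
    congr 1
    ext1 j
    exact (finSuccEquiv s).symm.injective (congrFun this j)

theorem tupleCode_some {s r : ℕ} (f : Fin r → Option (Fin s)) :
    tupleCode (some f) = ∑ j, optCode (f j) * (s + 1) ^ (j : ℕ) + 1 := by
  simp [tupleCode, optCode]

theorem length_tensorLetters (s r : ℕ) : (tensorLetters s r).length = (s + 1) ^ r := by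
  simp [tensorLetters]

theorem getElem?_tensorLetters {s r : ℕ} (o : Option (Fin r → Option (Fin s))) :
    (none :: (tensorLetters s r).map some)[tupleCode o]? = some o := by
  cases o with
  | none => simp [tupleCode]
  | some f =>
    simp only [tupleCode, tensorLetters, List.map_map, List.getElem?_cons_succ, List.getElem?_map]
    have h : ∀ a : Fin ((s + 1) ^ r), (List.finRange ((s + 1) ^ r))[(a : ℕ)]? = some a := by simp
    rw [h]
    simp only [Option.map_some, Function.comp, Equiv.symm_apply_apply, Equiv.apply_symm_apply]

theorem getElem?_finRange {s : ℕ} (o : Option (Fin s)) :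
    (none :: (List.finRange s).map some)[optCode o]? = some o := by
  cases o with
  | none => simp
  | some f => simp [optCode]

theorem tupleCode_surj {s r c : ℕ} (hc : c < (s + 1) ^ r + 1) :
    ∃ o : Option (Fin r → Option (Fin s)), tupleCode o = c := by
  cases c with
  | zero => exact ⟨none, rfl⟩
  | succ c =>
    refine ⟨some fun j => finSuccEquiv s (finFunctionFinEquiv.symm ⟨c, by omega⟩ j), ?_⟩
    simp [tupleCode]

theorem foldr_ofFn_digits (m r : ℕ) (g : Fin r → ℕ) :
    (List.ofFn g).foldr (fun x d => x + m * d) 0 = ∑ j, g j * m ^ (j : ℕ) := by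
  induction r with
  | zero => simp
  | succ r ih =>
    rw [List.ofFn_succ, List.foldr_cons, ih, Fin.sum_univ_succ, Finset.mul_sum]
    simp only [Fin.val_zero, pow_zero, mul_one, Fin.val_succ, add_right_inj]
    exact Finset.sum_congr rfl fun j _ => by ring

theorem sum_digits_lt {m r : ℕ} {g : Fin r → ℕ} (hg : ∀ j, g j < m) :
    ∑ j, g j * m ^ (j : ℕ) < m ^ r := by
  have := (finFunctionFinEquiv (m := m) (n := r) fun j => ⟨g j, hg j⟩).2
  simpa [finFunctionFinEquiv_apply] using this

section Symbol
variable {s w : ℕ} {τ : Vocabulary} (a : LayerAlphabet (Fin s) w τ)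

theorem code_eq_map : τ.code = (List.finRange τ.num).map τ.arity := by
  rw [Vocabulary.code, List.ofFn_eq_map]

theorem length_flatMap_layerCode (l : List (Fin τ.num)) :
    (l.flatMap fun i => layerCode (tensorLetters s (τ.arity i)) (a.2 i)).length =
      ((l.map τ.arity).map fun r => layerLen w ((s + 1) ^ r + 1)).sum := by
  simp only [List.length_flatMap, length_layerCode, length_tensorLetters, List.map_map]
  rfl

theorem length_symbolCode : (symbolCode a).length = symbolLen s w τ.code := by
  rw [symbolCode, List.length_append, length_flatMap_layerCode, length_layerCode, symbolLen,
    code_eq_map]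
  simp

theorem symbolCode_zero_or_one {b : ℕ} (h : b ∈ symbolCode a) : b = 0 ∨ b = 1 := by
  simp only [symbolCode, List.mem_append, List.mem_flatMap] at h
  rcases h with h | ⟨i, -, h⟩ <;> exact layerCode_eq_one_iff_zero_or_one h

theorem symbolCode_dom {i b : ℕ} (h : (layerCode (List.finRange s) a.1)[i]? = some b) :
    (symbolCode a)[0 + i]? = some b := by
  rw [symbolCode, zero_add, List.getElem?_append_left (List.getElem?_eq_some_iff.1 h).1, h]

theorem symbolCode_rel {R : Fin τ.num} {i b : ℕ}
    (h : (layerCode (tensorLetters s (τ.arity R)) (a.2 R))[i]? = some b) :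
    (symbolCode a)[relOffset s w τ.code R + i]? = some b := by
  have hd : List.finRange τ.num = (List.finRange τ.num).take R ++ (R ::
      (List.finRange τ.num).drop (R + 1)) := by
    conv_lhs => rw [← List.take_append_drop R (List.finRange τ.num)]
    rw [List.drop_eq_getElem_cons (by simp)]
    simp
  have hlen : ((List.finRange s).length + 1) = s + 1 := by simp
  rw [symbolCode, hd, List.flatMap_append, ← List.append_assoc, List.getElem?_append_right]
  · rw [List.length_append, length_flatMap_layerCode, length_layerCode, hlen, List.map_take,
      ← code_eq_map, ← symbolLen, ← relOffset, Nat.add_sub_cancel_left, List.flatMap_cons,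
      List.getElem?_append_left (List.getElem?_eq_some_iff.1 h).1, h]
  · rw [List.length_append, length_flatMap_layerCode, length_layerCode, hlen, List.map_take,
      ← code_eq_map, ← symbolLen, ← relOffset]
    omega

end Symbol

section Semantics
variable {s w : ℕ} {τ : Vocabulary} {z : List (LayerAlphabet (Fin s) w τ)}

/-- The word over the letters of the automata for a string of symbols of the layer alphabet and
an assignment of strings to the variables. -/
def inputWord (z : List (LayerAlphabet (Fin s) w τ)) (env : List (List (Fin s))) : List Letter :=
  (List.range z.length).map fun i =>
    ((z[i]?.map symbolCode).getD [], env.map fun u => optCode u[i]?)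

theorem mem_alph_of_mem_inputWord {env : List (List (Fin s))} {a : Letter}
    (h : a ∈ inputWord z env) : a ∈ alph s (symbolLen s w τ.code) env.length := by
  simp only [inputWord, List.mem_map, List.mem_range] at h
  obtain ⟨i, hi, rfl⟩ := h
  rw [mem_alph]
  simp only [hi, List.getElem?_eq_getElem, Option.map_some, Option.getD_some, length_symbolCode,
    List.length_map, true_and, List.mem_map]
  refine ⟨fun b => symbolCode_zero_or_one _, ?_⟩
  rintro _ ⟨u, -, rfl⟩
  exact optCode_lt _

theorem ite_one_iff {p : Prop} [Decidable p] : some (if p then 1 else 0) = some 1 ↔ p := by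
  split <;> simp_all

theorem accepts_domAut {n : ℕ} {V : ℕ → Letter}
    (hV : ∀ i (h : i < z.length), (V i).1 = symbolCode z[i]) :
    (domAut s w τ.code (n + 1)).Accepts ((List.range z.length).map V) ↔
      (∀ i < z.length, V i ∈ alph s (symbolLen s w τ.code) (n + 1)) ∧
      ∃ u ∈ oddLang (tupleOfString z).dom, ∀ i < z.length, (V i).2.headI = optCode u[i]? := by
  have hlen : (tupleOfString z).dom.length = z.length := by simp [tupleOfString]
  have hget : ∀ i (h : i < (tupleOfString z).dom.length) (h' : i < z.length),
      ((tupleOfString z).dom[i]) = (z[i]).1 := by simp [tupleOfString]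
  have hl : (List.finRange s).length + 1 = s + 1 := by simp
  rw [domAut]
  have := accepts_oddAut (w := w) (off := 0) (A := s + 1) (D := (tupleOfString z).dom)
    (L := alph s (symbolLen s w τ.code) (n + 1)) (idx := fun a => a.2.headI)
    (enc := optCode (s := s)) (V := V) optCode_injective optCode_none ?_ ?_ ?_ ?_
  · rwa [hlen] at this
  · intro a ha
    rw [mem_alph] at ha
    obtain ⟨-, h1, h2⟩ := ha
    have : a.2.headI < s + 1 := by
      cases h : a.2 with
      | nil => simp [h] at h1
      | cons x v => exact h2 x (by simp [h])
    exact ⟨finSuccEquiv s ⟨_, this⟩, by simp [optCode]⟩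
  · intro i hi p q o
    have hi' : i < z.length := by omega
    rw [hV i hi', symbolCode_dom _ (hl ▸ getElem?_layerCode_trans (getElem?_finRange o)),
      hget i hi hi', ite_one_iff]
  · intro i hi p
    have hi' : i < z.length := by omega
    rw [hV i hi', symbolCode_dom _ (hl ▸ getElem?_layerCode_init), hget i hi hi', ite_one_iff]
  · intro i hi p
    have hi' : i < z.length := by omega
    rw [hV i hi', symbolCode_dom _ (hl ▸ getElem?_layerCode_final), hget i hi hi', ite_one_iff]

theorem accepts_relAut {n : ℕ} {R : Fin τ.num} {args : Fin (τ.arity R) → ℕ} {V : ℕ → Letter}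
    (hV : ∀ i (h : i < z.length), (V i).1 = symbolCode z[i]) :
    (relAut s w τ.code n R (List.ofFn args)).Accepts ((List.range z.length).map V) ↔
      (∀ i < z.length, V i ∈ alph s (symbolLen s w τ.code) n) ∧
      ∃ u ∈ oddLang ((tupleOfString z).rel R), ∀ i < z.length,
        labelIndex s n (List.ofFn args) (V i).2 = tupleCode u[i]? := by
  have hlen : ((tupleOfString z).rel R).length = z.length := by simp [tupleOfString]
  have hget : ∀ i (h : i < ((tupleOfString z).rel R).length) (h' : i < z.length),
      (((tupleOfString z).rel R)[i]) = (z[i]).2 R := by simp [tupleOfString]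
  have hl : (tensorLetters s (τ.arity R)).length + 1 = (s + 1) ^ (τ.arity R) + 1 := by
    rw [length_tensorLetters]
  have hR : τ.code.getD R 0 = τ.arity R := by
    rw [Vocabulary.code]; simp
  rw [relAut, hR]
  have := accepts_oddAut (w := w) (off := relOffset s w τ.code R) (A := (s + 1) ^ (τ.arity R) + 1)
    (D := (tupleOfString z).rel R)
    (L := alph s (symbolLen s w τ.code) n) (idx := fun a => labelIndex s n (List.ofFn args) a.2)
    (enc := tupleCode) (V := V) tupleCode_injective rfl ?_ ?_ ?_ ?_
  · rwa [hlen] at this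
  · intro a ha
    rw [mem_alph] at ha
    obtain ⟨-, h1, h2⟩ := ha
    apply tupleCode_surj
    have : (List.ofFn args).foldr (fun x d => a.2.getD (n - 1 - x) 0 + (s + 1) * d) 0 <
        (s + 1) ^ (τ.arity R) := by
      have := foldr_ofFn_digits (s + 1) _ fun j => a.2.getD (n - 1 - args j) 0
      rw [show (List.ofFn fun j => a.2.getD (n - 1 - args j) 0) =
        (List.ofFn args).map fun x => a.2.getD (n - 1 - x) 0 by rw [List.map_ofFn]; rfl,
        List.foldr_map] at this
      rw [this]
      refine sum_digits_lt fun j => ?_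
      rw [List.getD_eq_getElem?_getD]
      cases h : a.2[n - 1 - args j]? with
      | none => simp
      | some x => exact h2 x (List.mem_of_getElem? h)
    unfold labelIndex
    split <;> omega
  · intro i hi p q o
    have hi' : i < z.length := by omega
    rw [hV i hi', symbolCode_rel _ (hl ▸ getElem?_layerCode_trans (getElem?_tensorLetters o)),
      hget i hi hi', ite_one_iff]
  · intro i hi p
    have hi' : i < z.length := by omega
    rw [hV i hi', symbolCode_rel _ (hl ▸ getElem?_layerCode_init), hget i hi hi', ite_one_iff]
  · intro i hi p
    have hi' : i < z.length := by omega
    rw [hV i hi', symbolCode_rel _ (hl ▸ getElem?_layerCode_final), hget i hi hi', ite_one_iff]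

theorem eq_of_getElem?_eq {β : Type} {u v : List β} {k : ℕ} (hu : u.length ≤ k) (hv : v.length ≤ k)
    (h : ∀ i < k, u[i]? = v[i]?) : u = v := by
  apply List.ext_getElem?
  intro i
  by_cases hi : i < k
  · exact h i hi
  · rw [List.getElem?_eq_none (by omega), List.getElem?_eq_none (by omega)]

theorem getElem?_tensor {α : Type} {r : ℕ} (u : Fin r → List α) (i : ℕ) :
    (tensor u)[i]? = if ∃ j, i < (u j).length then some fun j => (u j)[i]? else none := by
  by_cases h : ∃ j, i < (u j).length
  · have : i < Finset.univ.sup fun j => (u j).length := by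
      rw [Finset.lt_sup_iff]; simpa using h
    simp [tensor, h, this]
  · have : ¬ i < Finset.univ.sup fun j => (u j).length := by
      rw [Finset.lt_sup_iff]; simpa using h
    rw [if_neg h, List.getElem?_eq_none]
    simpa [tensor] using h

theorem labelIndex_eq {r n i : ℕ} {args : Fin r → ℕ} {v : List ℕ} {u : Fin r → List (Fin s)}
    (h : ∀ j, v.getD (n - 1 - args j) 0 = optCode (u j)[i]?) :
    labelIndex s n (List.ofFn args) v = tupleCode (tensor u)[i]? := by
  have hd : (List.ofFn args).foldr (fun x d => v.getD (n - 1 - x) 0 + (s + 1) * d) 0 =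
      ∑ j, optCode (u j)[i]? * (s + 1) ^ (j : ℕ) := by
    rw [← foldr_ofFn_digits]
    rw [show (List.ofFn fun j => optCode (u j)[i]?) =
      (List.ofFn args).map fun x => v.getD (n - 1 - x) 0 by
        rw [List.map_ofFn]; congr 1; ext j; exact (h j).symm, List.foldr_map]
  have h0 : (∑ j, optCode (u j)[i]? * (s + 1) ^ (j : ℕ) = 0) ↔ ¬ ∃ j, i < (u j).length := by
    rw [Finset.sum_eq_zero_iff]
    push Not
    refine forall_congr' fun j => ?_
    have : optCode (u j)[i]? = 0 ↔ (u j)[i]? = none := by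
      rw [← optCode_none (s := s), optCode_injective.eq_iff]
    simp [this]
  rw [labelIndex, hd, getElem?_tensor]
  by_cases e : ∃ j, i < (u j).length
  · rw [if_neg (by rw [h0]; exact not_not.2 e), if_pos e, tupleCode_some]
  · rw [if_pos (h0.2 e), if_neg e]; rfl

theorem getElem?_reverse_ofFn {α : Type} {n : ℕ} (f : Fin n → α) (i : Fin n) :
    (List.ofFn f).reverse[n - 1 - i]? = some (f i) := by
  have := i.2
  rw [List.getElem?_reverse (by simp; omega)]
  simp [show n - 1 - (n - 1 - i) = i by omega]

theorem exists_var {n : ℕ} (t : τ.language.Term (Empty ⊕ Fin n)) :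
    ∃ i : Fin n, t = .var (.inr i) := by
  match t with
  | .var (.inl e) => exact e.elim
  | .var (.inr i) => exact ⟨i, rfl⟩
  | .func f _ => exact Empty.elim f

/-- The string that an element of the derived structure is. -/
def str (x : (tupleOfString z).Domain) : List (Fin s) := x.1

theorem str_mem (x : (tupleOfString z).Domain) : str x ∈ oddLang (tupleOfString z).dom := x.2

theorem str_injective : (str (z := z)).Injective := fun _ _ h => Subtype.ext h

/-- The automaton of a formula accepts the word of an assignment iff the assignment satisfies the
formula in the derived structure. -/
theorem accepts_formulaAut (z : List (LayerAlphabet (Fin s) w τ)) {n : ℕ}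
    (φ : τ.language.BoundedFormula Empty n) (v : Empty → (tupleOfString z).Domain)
    (xs : Fin n → (tupleOfString z).Domain) :
    (formulaAut s w φ).Accepts (inputWord z (List.ofFn fun j => str (xs j)).reverse) ↔
      φ.Realize v xs := by
  have hlen : (tupleOfString z).dom.length = z.length := by simp [tupleOfString]
  have hk : ∀ x : (tupleOfString z).Domain, (str x).length ≤ z.length := fun x => hlen ▸ (str_mem x).2.1
  have hV : ∀ (env : List (List (Fin s))) i (h : i < z.length),
      (((z[i]?.map symbolCode).getD [], env.map fun u => optCode u[i]?) : Letter).1 =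
        symbolCode z[i] := by
    intro env i h; simp [h]
  have halph : ∀ {n : ℕ} (xs : Fin n → (tupleOfString z).Domain),
      ∀ a ∈ inputWord z (List.ofFn fun j => str (xs j)).reverse,
        a ∈ alph s (symbolLen s w τ.code) n := by
    intro n xs a ha
    simpa using mem_alph_of_mem_inputWord ha
  induction φ with
  | falsum => simp [formulaAut, ListAut.Accepts, Language.BoundedFormula.Realize]
  | @equal n t₁ t₂ =>
    obtain ⟨i, rfl⟩ := exists_var t₁
    obtain ⟨j, rfl⟩ := exists_var t₂
    simp only [formulaAut, varIndex, Language.BoundedFormula.Realize, Language.Term.realize_var,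
      Sum.elim_inr]
    have hvar : ∀ (c : ℕ) (i : Fin n), ((List.ofFn fun j => str (xs j)).reverse.map
        fun u => optCode u[c]?)[n - 1 - (i : ℕ)]? = some (optCode (str (xs i))[c]?) := by
      intro c i
      rw [List.getElem?_map, getElem?_reverse_ofFn]
      rfl
    have hacc : (eqAut (alph s (symbolLen s w τ.code) n) (n - 1 - i) (n - 1 - j)).Accepts
        (inputWord z (List.ofFn fun j => str (xs j)).reverse) ↔
        ∀ c < z.length, (str (xs i))[c]? = (str (xs j))[c]? := by
      simp only [ListAut.Accepts, inputWord, path_map_range]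
      constructor
      · rintro ⟨_, -, _, -, st, -, -, hst⟩ c hc
        have := hst c hc
        simp only [ListAut.Tr, eqAut, List.mem_map, List.mem_filter, decide_eq_true_eq,
          Prod.mk.injEq] at this
        obtain ⟨a, ⟨-, h⟩, -, rfl, -⟩ := this
        simp only [hvar, Option.some.injEq, optCode_injective.eq_iff] at h
        exact h
      · intro h
        refine ⟨0, by simp [eqAut], 0, by simp [eqAut], fun _ => 0, rfl, rfl, fun c hc => ?_⟩
        simp only [ListAut.Tr, eqAut, List.mem_map, List.mem_filter, decide_eq_true_eq,
          Prod.mk.injEq]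
        refine ⟨_, ⟨halph xs _ ?_, ?_⟩, trivial, rfl, trivial⟩
        · exact List.mem_map.2 ⟨c, List.mem_range.2 hc, rfl⟩
        · simp only [hvar, h c hc]
    rw [hacc]
    constructor
    · intro h
      exact str_injective (eq_of_getElem?_eq (hk _) (hk _) h)
    · intro h c _
      rw [h]
  | @rel n r R ts =>
    obtain ⟨R, rfl⟩ := R
    choose i hi using fun j => exists_var (ts j)
    obtain rfl : ts = fun j => .var (.inr (i j)) := funext hi
    simp only [formulaAut, varIndex, Language.BoundedFormula.Realize, Language.Term.realize_var,
      Sum.elim_inr]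
    rw [inputWord, accepts_relAut (hV _)]
    have hidx : ∀ c : ℕ, labelIndex s n (List.ofFn fun j => (i j : ℕ))
        ((List.ofFn fun j => str (xs j)).reverse.map fun u => optCode u[c]?) =
        tupleCode (tensor fun j => str (xs (i j)))[c]? := by
      intro c
      apply labelIndex_eq
      intro j
      rw [List.getD_eq_getElem?_getD, List.getElem?_map, getElem?_reverse_ofFn]
      rfl
    simp only [hidx, tupleCode_injective.eq_iff]
    have htl : (tensor fun j => str (xs (i j))).length ≤ z.length := by
      simp only [tensor, List.length_map, List.length_range, Finset.sup_le_iff]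
      exact fun j _ => hk _
    have hlenR : ((tupleOfString z).rel R).length = z.length := by simp [tupleOfString]
    have hrel : (Language.Structure.RelMap (L := τ.language) (M := (tupleOfString z).Domain)
        (⟨R, rfl⟩ : τ.language.Relations (τ.arity R)) fun j => xs (i j)) ↔
        tensor (fun j => str (xs (i j))) ∈ oddLang ((tupleOfString z).rel R) := Iff.rfl
    rw [hrel]
    constructor
    · rintro ⟨-, u, hu, h⟩
      rwa [eq_of_getElem?_eq htl (hlenR ▸ hu.2.1) h]
    · intro h
      refine ⟨fun c hc => halph xs _ (List.mem_map.2 ⟨c, List.mem_range.2 hc, rfl⟩), _, h,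
        fun _ _ => rfl⟩
  | @imp n φ ψ ih₁ ih₂ =>
    rw [formulaAut, impAut, ListAut.accepts_union, ListAut.accepts_compl (halph xs), propext (ih₁ xs), propext (ih₂ xs),
      Language.BoundedFormula.realize_imp, imp_iff_not_or]
  | @all n φ ih =>
    rw [formulaAut, allAut, ListAut.accepts_compl (halph xs), ListAut.accepts_relabel,
      Language.BoundedFormula.realize_all, not_exists]
    have hsnoc : ∀ x : (tupleOfString z).Domain,
        (List.ofFn fun j => str ((Fin.snoc xs x : Fin (n + 1) → (tupleOfString z).Domain) j)).reverse
          = str x :: (List.ofFn fun j => str (xs j)).reverse := by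
      intro x
      rw [List.ofFn_succ']
      simp
    constructor
    · intro h x
      by_contra hx
      refine h (inputWord z (str x :: (List.ofFn fun j => str (xs j)).reverse)) ⟨?_, ?_⟩
      · simp [inputWord, forget]
      · rw [ListAut.accepts_inter, ← hsnoc, ListAut.accepts_compl (halph _), propext (ih (Fin.snoc xs x))]
        refine ⟨?_, hx⟩
        rw [inputWord, accepts_domAut (hV _)]
        refine ⟨fun c hc => halph _ _ (List.mem_map.2 ⟨c, List.mem_range.2 hc, rfl⟩), str x, str_mem x,
          fun c _ => ?_⟩
        rw [hsnoc]
        rfl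
    · rintro h l' ⟨hl, hacc⟩
      rw [ListAut.accepts_inter] at hacc
      have hl' : l'.length = z.length := by
        have := congrArg List.length hl
        simpa [inputWord] using this
      have hfor : ∀ c, c < z.length → forget (l'.getD c ([], [])) =
          ((z[c]?.map symbolCode).getD [],
            (List.ofFn fun j => str (xs j)).reverse.map fun u => optCode u[c]?) := by
        intro c hc
        have := congrArg (fun l => l[c]?) hl
        simpa [inputWord, hc, hl', List.getD_eq_getElem?_getD] using this
      have hrange : l' = (List.range z.length).map fun c => l'.getD c ([], []) := by
        apply List.ext_getElem
        · simp [hl']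
        · intro c h1 h2
          simp [List.getD_eq_getElem?_getD, h1]
      have hdom := hacc.1
      rw [hrange, accepts_domAut] at hdom
      swap
      · intro c hc
        have := congrArg Prod.fst (hfor c hc)
        simpa [forget, hc] using this
      obtain ⟨hmem, u, hu, hhead⟩ := hdom
      have hword : l' = inputWord z (u :: (List.ofFn fun j => str (xs j)).reverse) := by
        rw [hrange, inputWord]
        apply List.map_congr_left
        intro c hc
        rw [List.mem_range] at hc
        have h1 := hfor c hc
        have h2 := hhead c hc
        have h3 := (mem_alph.1 (hmem c hc)).2.1
        generalize l'.getD c ([], []) = a at h1 h2 h3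
        obtain ⟨b, t⟩ := a
        cases t with
        | nil => simp at h3
        | cons x t =>
          simp only [forget, List.tail_cons, Prod.mk.injEq] at h1
          simp only [List.headI_cons] at h2
          rw [h1.1, h1.2, h2]
          rfl
      obtain ⟨y, rfl⟩ : ∃ y, str y = u := ⟨⟨u, hu⟩, rfl⟩
      rw [← hsnoc y] at hword
      have := hacc.2
      rw [hword, ListAut.accepts_compl (halph _), propext (ih (Fin.snoc xs y))] at this
      exact this (h _)

end Semantics

/-! ### Parsing codes of sentences -/

/-- The length of the first token of `inp`, for a formula with `n` variables over a vocabulary with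
the arities `ar`, or `0` if there is none. -/
def tokenLen (ar : List ℕ) (n : ℕ) (inp : List ℕ) : ℕ :=
  if inp = [] then 0
  else if inp.getD 0 0 = 0 ∨ inp.getD 0 0 = 3 ∨ inp.getD 0 0 = 4 then 1
  else if inp.getD 0 0 = 1 then
    if 3 ≤ inp.length ∧ inp.getD 1 0 < n ∧ inp.getD 2 0 < n then 3 else 0
  else if inp.getD 0 0 = 2 then
    if inp.getD 1 0 < ar.length ∧ 2 + ar.getD (inp.getD 1 0) 0 ≤ inp.length ∧
      ∀ x ∈ (inp.drop 2).take (ar.getD (inp.getD 1 0) 0), x < n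
    then 2 + ar.getD (inp.getD 1 0) 0 else 0
  else 0

/-- The numbers of variables of the subformulas that a token of kind `c` calls for. -/
def subScopes (n c : ℕ) : List ℕ := if c = 3 then [n, n] else if c = 4 then [n + 1] else []

/-- One step of the parser. Its state consists of the numbers of variables of the formulas that
are still to be read, the rest of the input, and the tokens that have been read, the last one
first, each of them preceded by the number of variables at that place. -/
def parseStep (ar : List ℕ) (x : List ℕ × List ℕ × List (List ℕ)) :
    List ℕ × List ℕ × List (List ℕ) :=
  if x.1 = [] ∨ tokenLen ar x.1.headI x.2.1 = 0 then x
  else (subScopes x.1.headI (x.2.1.getD 0 0) ++ x.1.tail,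
    x.2.1.drop (tokenLen ar x.1.headI x.2.1),
    (x.1.headI :: x.2.1.take (tokenLen ar x.1.headI x.2.1)) :: x.2.2)

/-- The parser: as every step that changes the state consumes a part of the string `c`, its length
is a sufficient number of steps. The string is the code of a sentence if no formula and no input
is left. -/
def parse (ar c : List ℕ) : List ℕ × List ℕ × List (List ℕ) :=
  (parseStep ar)^[c.length] ([0], c, [])

/-- The tokens of a formula, in the order in which the parser leaves them. -/
def formulaTokens {τ : Vocabulary} : {n : ℕ} → τ.language.BoundedFormula Empty n → List (List ℕ)
  | n, .falsum => [ [n, 0] ]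
  | n, .equal t₁ t₂ => [ [n, 1, varIndex t₁, varIndex t₂] ]
  | n, .rel R ts => [ n :: 2 :: (R.1 : ℕ) :: List.ofFn fun j => varIndex (ts j) ]
  | n, .imp φ ψ => formulaTokens ψ ++ formulaTokens φ ++ [ [n, 3] ]
  | n, .all φ => formulaTokens φ ++ [ [n, 4] ]

section Parse
variable {τ : Vocabulary}

theorem varIndex_lt {n : ℕ} (t : τ.language.Term (Empty ⊕ Fin n)) : varIndex t < n := by
  obtain ⟨i, rfl⟩ := exists_var t
  exact i.2

theorem parseStep_formula {n : ℕ} (φ : τ.language.BoundedFormula Empty n) (st r : List ℕ)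
    (out : List (List ℕ)) :
    (parseStep τ.code)^[(formulaTokens φ).length] (n :: st, formulaCode φ ++ r, out) =
      (st, r, formulaTokens φ ++ out) := by
  induction φ generalizing st r out with
  | falsum => simp [formulaTokens, formulaCode, parseStep, tokenLen, subScopes]
  | @equal n t₁ t₂ =>
    simp [formulaTokens, formulaCode, parseStep, tokenLen, subScopes, varIndex_lt]
  | @rel n k R ts =>
    obtain ⟨R, rfl⟩ := R
    have hR : τ.code.getD R 0 = τ.arity R := by rw [Vocabulary.code]; simp
    have hn : (R : ℕ) < τ.code.length := by rw [Vocabulary.code]; simp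
    have hlen : tokenLen τ.code n (2 :: (R : ℕ) :: ((List.ofFn fun j => varIndex (ts j)) ++ r)) =
        2 + τ.arity R := by
      rw [tokenLen, if_neg (by simp), if_neg (by simp), if_neg (by simp), if_pos (by simp)]
      simp only [List.getD_cons_succ, List.getD_cons_zero, hR]
      rw [if_pos]
      refine ⟨hn, by simp; omega, ?_⟩
      intro x hx
      rw [List.drop_succ_cons, List.drop_succ_cons, List.drop_zero, List.take_append_of_le_length
        (by simp), List.take_of_length_le (by simp), List.mem_ofFn] at hx
      obtain ⟨j, rfl⟩ := hx
      exact varIndex_lt _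
    simp only [formulaTokens, formulaCode, List.length_singleton, Function.iterate_one,
      List.cons_append]
    rw [parseStep, if_neg]
    · simp only [List.headI_cons, hlen]
      rw [add_comm 2]
      simp [subScopes]
    · simp only [List.headI_cons, hlen]
      simp
  | @imp n φ ψ ih₁ ih₂ =>
    rw [formulaTokens, List.length_append, List.length_append, List.length_singleton,
      Function.iterate_succ_apply, Function.iterate_add_apply]
    have : parseStep τ.code (n :: st, formulaCode (φ.imp ψ) ++ r, out) =
        (n :: n :: st, formulaCode φ ++ (formulaCode ψ ++ r), [n, 3] :: out) := by
      simp [formulaCode, parseStep, tokenLen, subScopes]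
    rw [this, ih₁, ih₂]
    simp
  | @all n φ ih =>
    rw [formulaTokens, List.length_append, List.length_singleton, Function.iterate_succ_apply]
    have : parseStep τ.code (n :: st, formulaCode φ.all ++ r, out) =
        ((n + 1) :: st, formulaCode φ ++ r, [n, 4] :: out) := by
      simp [formulaCode, parseStep, tokenLen, subScopes]
    rw [this, ih]
    simp

theorem length_formulaTokens_le {n : ℕ} (φ : τ.language.BoundedFormula Empty n) :
    (formulaTokens φ).length ≤ (formulaCode φ).length := by
  induction φ <;> simp [formulaTokens, formulaCode] <;> omega

theorem parse_sentenceCode (φ : τ.language.Sentence) :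
    parse τ.code (sentenceCode φ) = ([], [], formulaTokens (n := 0) φ) := by
  have h := length_formulaTokens_le (n := 0) φ
  rw [parse, sentenceCode, show (formulaCode (n := 0) φ).length =
    (formulaCode (n := 0) φ).length - (formulaTokens (n := 0) φ).length +
      (formulaTokens (n := 0) φ).length by omega, Function.iterate_add_apply]
  have := parseStep_formula (n := 0) φ [] [] []
  rw [List.append_nil, List.append_nil] at this
  rw [this]
  exact Function.iterate_fixed (by simp [parseStep]) _

/-- The string `inp` is a sequence of codes of formulas, with the numbers of variables `st`. -/
def IsCodes (τ : Vocabulary) : List ℕ → List ℕ → Prop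
  | [], inp => inp = []
  | n :: st, inp => ∃ (φ : τ.language.BoundedFormula Empty n) (r : List ℕ),
      inp = formulaCode φ ++ r ∧ IsCodes τ st r

theorem isCodes_of_parseStep {x : List ℕ × List ℕ × List (List ℕ)}
    (h : IsCodes τ (parseStep τ.code x).1 (parseStep τ.code x).2.1) : IsCodes τ x.1 x.2.1 := by
  obtain ⟨st, inp, out⟩ := x
  by_cases h0 : st = [] ∨ tokenLen τ.code st.headI inp = 0
  · rwa [parseStep, if_pos h0] at h
  rw [parseStep, if_neg h0] at h
  push Not at h0
  obtain ⟨hst, hlen⟩ := h0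
  cases st with
  | nil => simp at hst
  | cons n st =>
  simp only [List.headI_cons, List.tail_cons] at h hlen ⊢
  cases inp with
  | nil => simp [tokenLen] at hlen
  | cons c inp =>
  simp only [List.getD_cons_zero] at h
  by_cases h034 : c = 0 ∨ c = 3 ∨ c = 4
  · have hl : tokenLen τ.code n (c :: inp) = 1 := by simp [tokenLen, h034]
    rw [hl] at h
    rcases h034 with rfl | rfl | rfl
    · exact ⟨.falsum, inp, rfl, by simpa [subScopes] using h⟩
    · simp only [subScopes, if_true, List.cons_append, List.nil_append] at h
      obtain ⟨φ, r, hr, ψ, r', rfl, h⟩ := h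
      refine ⟨.imp φ ψ, r', ?_, h⟩
      simp only [List.drop_succ_cons, List.drop_zero] at hr
      simp [formulaCode, hr]
    · simp only [subScopes, if_true] at h
      obtain ⟨φ, r, hr, h⟩ := h
      refine ⟨.all φ, r, ?_, h⟩
      simp only [List.drop_succ_cons, List.drop_zero] at hr
      simp [formulaCode, hr]
  by_cases h1 : c = 1
  · subst h1
    rw [tokenLen, if_neg (by simp), if_neg (by simp), if_pos (by simp)] at hlen
    split_ifs at hlen with hc
    · have hl : tokenLen τ.code n (1 :: inp) = 3 := by
        rw [tokenLen, if_neg (by simp), if_neg (by simp), if_pos (by simp), if_pos hc]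
      rw [hl] at h
      match inp, hc with
      | i :: j :: r, hc =>
        simp at hc
        exact ⟨.equal (.var (.inr ⟨i, hc.1⟩)) (.var (.inr ⟨j, hc.2⟩)), r, rfl,
          by simpa [subScopes] using h⟩
    · simp at hlen
  by_cases h2 : c = 2
  · subst h2
    rw [tokenLen, if_neg (by simp), if_neg (by simp), if_neg (by simp), if_pos (by simp)] at hlen
    split_ifs at hlen with hc
    · have hl : tokenLen τ.code n (2 :: inp) = 2 + τ.code.getD ((2 :: inp).getD 1 0) 0 := by
        rw [tokenLen, if_neg (by simp), if_neg (by simp), if_neg (by simp), if_pos (by simp),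
          if_pos hc]
      rw [hl] at h
      match inp, hc with
      | [], hc => simp at hc; omega
      | R :: r, hc =>
        simp only [List.getD_cons_succ, List.getD_cons_zero, List.drop_succ_cons,
          List.drop_zero] at hc h
        obtain ⟨hR, hle, hx⟩ := hc
        have hR' : R < τ.num := by simpa [Vocabulary.code] using hR
        have har : τ.code.getD R 0 = τ.arity ⟨R, hR'⟩ := by
          rw [Vocabulary.code]; simp [hR']
        rw [har] at h hle hx
        have hle' : τ.arity ⟨R, hR'⟩ ≤ r.length := by simp at hle; omega
        have hxj : ∀ j : Fin (τ.arity ⟨R, hR'⟩), r[(j : ℕ)] < n := fun j => hx _ (by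
          rw [List.mem_take_iff_getElem]
          exact ⟨j, by have := j.2; omega, rfl⟩)
        refine ⟨.rel ⟨⟨R, hR'⟩, rfl⟩ fun j => .var (.inr ⟨r[(j : ℕ)], hxj j⟩),
          r.drop (τ.arity ⟨R, hR'⟩), ?_, ?_⟩
        · simp only [formulaCode, varIndex, List.cons_append, List.cons.injEq, true_and]
          conv_lhs => rw [← List.take_append_drop (τ.arity ⟨R, hR'⟩) r]
          congr 1
          apply List.ext_getElem
          · simpa using hle'
          · intro i h1 h2
            simp
        · rw [add_comm 2] at h
          simpa [subScopes] using h
    · simp at hlen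
  · push Not at h034
    simp [tokenLen, h1, h2, h034] at hlen

theorem isCodes_of_iterate {x : List ℕ × List ℕ × List (List ℕ)} (k : ℕ)
    (h : IsCodes τ ((parseStep τ.code)^[k] x).1 ((parseStep τ.code)^[k] x).2.1) :
    IsCodes τ x.1 x.2.1 := by
  induction k generalizing x with
  | zero => exact h
  | succ k ih =>
    rw [Function.iterate_succ_apply] at h
    exact isCodes_of_parseStep (ih h)

/-- The parser recognizes the codes of sentences. -/
theorem exists_sentenceCode_iff (c : List ℕ) :
    (∃ φ : τ.language.Sentence, sentenceCode φ = c) ↔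
      (parse τ.code c).1 = [] ∧ (parse τ.code c).2.1 = [] := by
  constructor
  · rintro ⟨φ, rfl⟩
    simp [parse_sentenceCode]
  · rintro ⟨h1, h2⟩
    have := isCodes_of_iterate (τ := τ) (x := ([0], c, [])) c.length (by
      rw [parse] at h1 h2
      rw [h1, h2]; rfl)
    obtain ⟨φ, r, hr, rfl⟩ := this
    exact ⟨φ, by simpa [sentenceCode] using hr.symm⟩

end Parse

/-! ### The automaton of a sentence from its code -/

/-- Process a token, given the automata of the subformulas on a stack. The parser leaves the tokens
of the subformulas before that of the formula, so folding this over the list of tokens computes the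
automaton of the formula bottom up. -/
def evalToken (s w : ℕ) (ar : List ℕ) (stk : List (ListAut Letter)) (t : List ℕ) :
    List (ListAut Letter) :=
  if t.getD 1 0 = 0 then ([], [], []) :: stk
  else if t.getD 1 0 = 1 then
    eqAut (alph s (symbolLen s w ar) (t.getD 0 0)) (t.getD 0 0 - 1 - t.getD 2 0)
      (t.getD 0 0 - 1 - t.getD 3 0) :: stk
  else if t.getD 1 0 = 2 then relAut s w ar (t.getD 0 0) (t.getD 2 0) (t.drop 3) :: stk
  else if t.getD 1 0 = 3 then
    impAut s w ar (t.getD 0 0) (stk.getD 0 ([], [], [])) (stk.getD 1 ([], [], [])) :: stk.drop 2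
  else allAut s w ar (t.getD 0 0) (stk.getD 0 ([], [], [])) :: stk.drop 1

theorem foldl_evalToken {s w : ℕ} {τ : Vocabulary} {n : ℕ} (φ : τ.language.BoundedFormula Empty n)
    (stk : List (ListAut Letter)) :
    (formulaTokens φ).foldl (evalToken s w τ.code) stk = formulaAut s w φ :: stk := by
  induction φ generalizing stk with
  | falsum => simp [formulaTokens, formulaAut, evalToken]
  | equal t₁ t₂ => simp [formulaTokens, formulaAut, evalToken]
  | rel R ts => simp [formulaTokens, formulaAut, evalToken]
  | imp φ ψ ih₁ ih₂ =>
    simp [formulaTokens, formulaAut, evalToken, ih₁, ih₂]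
  | all φ ih => simp [formulaTokens, formulaAut, evalToken, ih]

/-- The automaton for the sentence with code `c` and a nonempty domain. The domain is required to
be nonempty because derived structures with empty domain do not count. -/
def codeAut (s w : ℕ) (ar c : List ℕ) : ListAut Letter :=
  (((parse ar c).2.2.foldl (evalToken s w ar) []).getD 0 ([], [], [])).inter
    ((domAut s w ar 1).relabel forget)

/-- What the machine computes from the parameters: the number of bits of a symbol, and the
transitions of the automaton of the sentence, with letters that are reduced to codes of the bits of
symbols. Letter `0` leads from state `0` to the initial states, letter `1` from the final states to
state `0`, and the codes of the other letters are shifted by `2`. State `0` need not be new: in the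
given automaton, which is treated alike, the letters `0` and `1` occur only at the ends of a word
from the initial to the final state (`eq_of_path_bracket`). -/
def compiledAut (x : ℕ × ℕ × List ℕ × List ℕ) : ℕ × List (ℕ × ℕ × ℕ) :=
  (symbolLen x.1 x.2.1 x.2.2.1,
    (codeAut x.1 x.2.1 x.2.2.1 x.2.2.2).1.map (fun q => (0, 0, q)) ++
    ((codeAut x.1 x.2.1 x.2.2.1 x.2.2.2).2.2.map (fun q => (q, 1, 0)) ++
    (codeAut x.1 x.2.1 x.2.2.1 x.2.2.2).2.1.map
      (fun t => (t.1, Encodable.encode t.2.1.1 + 2, t.2.2))))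

section Primrec
open Primrec
variable {γ : Type} [Primcodable γ] {s w n i j off A p q : γ → ℕ} {ar l : γ → List ℕ}

theorem primrec_getD {f : γ → List ℕ} {i : γ → ℕ} (hf : Primrec f) (hi : Primrec i) :
    Primrec fun c => (f c).getD (i c) 0 :=
  (Primrec.list_getD 0).comp hf hi

theorem primrec_tokenLen (har : Primrec ar) (hn : Primrec n) (hl : Primrec l) :
    Primrec fun c => tokenLen (ar c) (n c) (l c) := by
  have g (i : ℕ) : Primrec fun c => (l c).getD i 0 := primrec_getD hl (.const i)
  have e (i k : ℕ) : PrimrecPred fun c => (l c).getD i 0 = k := Primrec.eq.comp (g i) (.const k)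
  have a : Primrec fun c => (ar c).getD ((l c).getD 1 0) 0 := primrec_getD har (g 1)
  have a2 := Primrec.nat_add.comp (.const 2) a
  have hlen := list_length.comp hl
  refine Primrec.ite (Primrec.eq.comp hl (.const [])) (.const 0) (Primrec.ite
    ((e 0 0).or ((e 0 3).or (e 0 4))) (.const 1) (Primrec.ite (e 0 1) (Primrec.ite
      ((Primrec.nat_le.comp (.const 3) hlen).and ((Primrec.nat_lt.comp (g 1) hn).and
        (Primrec.nat_lt.comp (g 2) hn))) (.const 3) (.const 0)) (Primrec.ite (e 0 2)
    (Primrec.ite ((Primrec.nat_lt.comp (g 1) (list_length.comp har)).and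
      ((Primrec.nat_le.comp a2 hlen).and ?_)) a2 (.const 0)) (.const 0))))
  exact (PrimrecRel.forall_mem_list Primrec.nat_lt).comp
    (list_take.comp a (list_drop.comp (.const 2) hl)) hn

theorem primrec_parse {ar l : γ → List ℕ} (har : Primrec ar) (hl : Primrec l) :
    Primrec fun c => parse (ar c) (l c) := by
  refine Primrec.nat_iterate (h := fun c => parseStep (ar c)) (list_length.comp hl)
    (.pair (.const [0]) (.pair hl (.const []))) (.mk ?_)
  have hh : Primrec fun p : γ × List ℕ × List ℕ × List (List ℕ) => p.2.1.headI :=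
    list_headI.comp (fst.comp snd)
  have hi : Primrec fun p : γ × List ℕ × List ℕ × List (List ℕ) => p.2.2.1 :=
    fst.comp (snd.comp snd)
  have ht := primrec_tokenLen (har.comp fst) hh hi
  have hc := primrec_getD hi (.const 0)
  have hs : Primrec fun p : γ × List ℕ × List ℕ × List (List ℕ) =>
      subScopes p.2.1.headI (p.2.2.1.getD 0 0) :=
    Primrec.ite (Primrec.eq.comp hc (.const 3))
      (list_cons.comp hh (list_cons.comp hh (.const [])))
      (Primrec.ite (Primrec.eq.comp hc (.const 4))
        (list_cons.comp (Primrec.succ.comp hh) (.const [])) (.const []))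
  exact Primrec.ite ((Primrec.eq.comp (fst.comp snd) (.const [])).or
    (Primrec.eq.comp ht (.const 0))) snd (.pair
      (list_append.comp hs (list_tail.comp (fst.comp snd))) (.pair (list_drop.comp ht hi)
        (list_cons.comp (list_cons.comp hh (list_take.comp ht hi)) (snd.comp (snd.comp snd)))))

theorem primrec_pow : Primrec₂ fun a b : ℕ => a ^ b := Primrec₂.unpaired'.1 Nat.Primrec.pow

theorem primrec_layerLen (hw : Primrec w) (hA : Primrec A) :
    Primrec fun c => layerLen (w c) (A c) :=
  nat_add.comp (nat_add.comp (nat_add.comp (nat_mul.comp (.const 2) hw)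
    (nat_mul.comp hw (nat_mul.comp hA hw))) (nat_mul.comp (.const 2) hw)) (.const 2)

theorem primrec_symbolLen (hs : Primrec s) (hw : Primrec w) (har : Primrec ar) :
    Primrec fun c => symbolLen (s c) (w c) (ar c) := by
  have hs1 := Primrec.succ.comp hs
  refine nat_add.comp (primrec_layerLen hw hs1) ?_
  refine (list_foldr (h := fun (_ : γ) (p : ℕ × ℕ) => p.1 + p.2) (list_map
    (g := fun c r => layerLen (w c) ((s c + 1) ^ r + 1)) har (.mk
    (primrec_layerLen (hw.comp fst)
    (Primrec.succ.comp (primrec_pow.comp (hs1.comp fst) snd))))) (.const 0)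
    (.mk (nat_add.comp (fst.comp snd) (snd.comp snd)))).of_eq fun c => ?_
  rfl

theorem primrec_listsOver (hl : Primrec l) (hn : Primrec n) :
    Primrec fun c => listsOver (l c) (n c) := by
  refine Primrec.nat_iterate (h := fun c W => W.flatMap fun v => (l c).map (· :: v)) hn
    (.const [ [] ]) (.mk ?_)
  exact list_flatMap snd (.mk (list_map (hl.comp (fst.comp fst)) (.mk
    (list_cons.comp snd (snd.comp fst)))))

theorem primrec_alph (hs : Primrec s) (hi : Primrec i) (hn : Primrec n) :
    Primrec fun c => alph (s c) (i c) (n c) :=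
  list_flatMap (primrec_listsOver (.const [0, 1]) hi) (.mk (list_map
    (primrec_listsOver (list_range.comp (Primrec.succ.comp (hs.comp fst))) (hn.comp fst))
    (.mk (Primrec.pair (snd.comp fst) snd))))

theorem primrec_transPos (hw : Primrec w) (hA : Primrec A) (hp : Primrec p) (hi : Primrec i)
    (hq : Primrec q) : Primrec fun c => transPos (w c) (A c) (p c) (i c) (q c) :=
  nat_add.comp (nat_mul.comp (.const 2) hw) (nat_add.comp (nat_mul.comp hp (nat_mul.comp hA hw))
    (nat_add.comp (nat_mul.comp hi hw) hq))

theorem primrec_initPos (hw : Primrec w) (hA : Primrec A) (hp : Primrec p) :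
    Primrec fun c => initPos (w c) (A c) (p c) :=
  nat_add.comp (nat_add.comp (nat_mul.comp (.const 2) hw) (nat_mul.comp hw (nat_mul.comp hA hw))) hp

theorem primrec_finalPos (hw : Primrec w) (hA : Primrec A) (hp : Primrec p) :
    Primrec fun c => finalPos (w c) (A c) (p c) :=
  nat_add.comp (nat_add.comp (nat_add.comp (nat_mul.comp (.const 2) hw)
    (nat_mul.comp hw (nat_mul.comp hA hw))) hw) hp

theorem primrec_oddTrans {a : γ → Letter} (hw : Primrec w) (hoff : Primrec off) (hA : Primrec A)
    (ha : Primrec a) (hi : Primrec i) (hp : Primrec p) (hq : Primrec q) :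
    Primrec fun c => oddTrans (w c) (off c) (A c) (a c) (i c) (p c) (q c) := by
  have hb {m : γ → ℕ} (hm : Primrec m) : PrimrecPred fun c => (a c).1[off c + m c]? = some 1 :=
    Primrec.eq.comp (list_getElem?.comp (fst.comp ha) (nat_add.comp hoff hm)) (.const (some 1))
  have h0 : PrimrecPred fun c => i c = 0 := Primrec.eq.comp hi (.const 0)
  have h2 {m : γ → ℕ} (hm : Primrec m) : Primrec fun c => 2 * m c := nat_mul.comp (.const 2) hm
  have hS : Primrec fun c => (2 * p c + 2) :: (if i c = 0 then [2 * p c + 3] else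
      if (a c).1[off c + initPos (w c) (A c) (p c)]? = some 1 then [0] else []) :=
    list_cons.comp (nat_add.comp (h2 hp) (.const 2)) (Primrec.ite h0
      (list_cons.comp (nat_add.comp (h2 hp) (.const 3)) (.const []))
      (Primrec.ite (hb (primrec_initPos hw hA hp)) (.const [0]) (.const [])))
  have hT : Primrec fun c => (2 * q c + 2 + if i c = 0 then 1 else 0) ::
      (if (a c).1[off c + finalPos (w c) (A c) (q c)]? = some 1 then [1] else []) :=
    list_cons.comp (nat_add.comp (nat_add.comp (h2 hq) (.const 2))
      (Primrec.ite h0 (.const 1) (.const 0)))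
      (Primrec.ite (hb (primrec_finalPos hw hA hq)) (.const [1]) (.const []))
  exact Primrec.ite (hb (primrec_transPos hw hA hp hi hq)) (list_flatMap hS (.mk (list_map
    (hT.comp fst) (.mk (Primrec.pair (snd.comp fst) (.pair (ha.comp (fst.comp fst)) snd))))))
    (.const [])

theorem primrec_oddAut {Λ : γ → List (Letter × ℕ)} (hw : Primrec w) (hoff : Primrec off)
    (hA : Primrec A) (hΛ : Primrec Λ) :
    Primrec fun c => oddAut (w c) (off c) (A c) (Λ c) := by
  refine .pair (.const [0]) (.pair ?_ (.const [1]))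
  refine list_flatMap hΛ (.mk (list_flatMap (list_range.comp (hw.comp fst)) (.mk (list_flatMap
    (list_range.comp (hw.comp (fst.comp fst))) (.mk ?_)))))
  have hc : Primrec fun c : ((γ × Letter × ℕ) × ℕ) × ℕ => c.1.1.1 := fst.comp (fst.comp fst)
  exact primrec_oddTrans (hw.comp hc) (hoff.comp hc) (hA.comp hc)
    (fst.comp (snd.comp (fst.comp fst))) (snd.comp (snd.comp (fst.comp fst))) (snd.comp fst) snd

theorem primrec_labelIndex (hs : Primrec s) (hn : Primrec n) (hl : Primrec l)
    (har : Primrec ar) : Primrec fun c => labelIndex (s c) (n c) (l c) (ar c) := by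
  have h : Primrec fun c => (l c).foldr
      (fun x d => (ar c).getD (n c - 1 - x) 0 + (s c + 1) * d) 0 :=
    list_foldr (h := fun c (p : ℕ × ℕ) => (ar c).getD (n c - 1 - p.1) 0 + (s c + 1) * p.2) hl
      (.const 0) (.mk (nat_add.comp (primrec_getD (har.comp fst)
        (nat_sub.comp (nat_sub.comp (hn.comp fst) (.const 1)) (fst.comp snd)))
        (nat_mul.comp (Primrec.succ.comp (hs.comp fst)) (snd.comp snd))))
  exact Primrec.ite (Primrec.eq.comp h (.const 0)) (.const 0) (Primrec.succ.comp h)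

theorem primrec_relAut (hs : Primrec s) (hw : Primrec w) (har : Primrec ar) (hn : Primrec n)
    (hi : Primrec i) (hl : Primrec l) :
    Primrec fun c => relAut (s c) (w c) (ar c) (n c) (i c) (l c) := by
  refine primrec_oddAut hw (primrec_symbolLen hs hw (list_take.comp hi har))
    (Primrec.succ.comp (primrec_pow.comp (Primrec.succ.comp hs) (primrec_getD har hi)))
    (list_map (primrec_alph hs (primrec_symbolLen hs hw har) hn) (.mk (Primrec.pair snd
      (primrec_labelIndex (hs.comp fst) (hn.comp fst) (hl.comp fst) (snd.comp snd)))))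

theorem primrec_domAut (hs : Primrec s) (hw : Primrec w) (har : Primrec ar) (hn : Primrec n) :
    Primrec fun c => domAut (s c) (w c) (ar c) (n c) :=
  primrec_oddAut hw (.const 0) (Primrec.succ.comp hs)
    (list_map (primrec_alph hs (primrec_symbolLen hs hw har) hn) (.mk (Primrec.pair snd
      (list_headI.comp (snd.comp snd)))))

theorem primrec_forget : Primrec forget := .pair fst (list_tail.comp snd)

theorem primrec_eqAut {L : γ → List Letter} (hL : Primrec L) (hi : Primrec i) (hj : Primrec j) :
    Primrec fun c => eqAut (L c) (i c) (j c) := by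
  refine .pair (.const [0]) (.pair (list_map (ListAut.primrec_filter hL (.mk (PrimrecPred.decide
    (Primrec.eq.comp ?_ ?_)))) (.mk (Primrec.pair (.const 0) (.pair snd (.const 0))))) (.const [0]))
  · exact list_getElem?.comp (snd.comp snd) (hi.comp fst)
  · exact list_getElem?.comp (snd.comp snd) (hj.comp fst)

theorem primrec_impAut {B C : γ → ListAut Letter} (hs : Primrec s) (hw : Primrec w)
    (har : Primrec ar) (hn : Primrec n) (hB : Primrec B) (hC : Primrec C) :
    Primrec fun c => impAut (s c) (w c) (ar c) (n c) (B c) (C c) :=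
  ListAut.primrec_union (ListAut.primrec_compl hB
    (primrec_alph hs (primrec_symbolLen hs hw har) hn)) hC

theorem primrec_allAut {B : γ → ListAut Letter} (hs : Primrec s) (hw : Primrec w)
    (har : Primrec ar) (hn : Primrec n) (hB : Primrec B) :
    Primrec fun c => allAut (s c) (w c) (ar c) (n c) (B c) := by
  have hL := primrec_symbolLen hs hw har
  have hn1 := Primrec.succ.comp hn
  exact ListAut.primrec_compl (ListAut.primrec_relabel primrec_forget (ListAut.primrec_inter
    (primrec_domAut hs hw har hn1) (ListAut.primrec_compl hB (primrec_alph hs hL hn1))))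
    (primrec_alph hs hL hn)

theorem primrec_evalToken {stk : γ → List (ListAut Letter)} (hs : Primrec s) (hw : Primrec w)
    (har : Primrec ar) (hstk : Primrec stk) (hl : Primrec l) :
    Primrec fun c => evalToken (s c) (w c) (ar c) (stk c) (l c) := by
  have g (i : ℕ) : Primrec fun c => (l c).getD i 0 := primrec_getD hl (.const i)
  have e (k : ℕ) : PrimrecPred fun c => (l c).getD 1 0 = k := Primrec.eq.comp (g 1) (.const k)
  have v (i : ℕ) : Primrec fun c => (l c).getD 0 0 - 1 - (l c).getD i 0 :=
    nat_sub.comp (nat_sub.comp (g 0) (.const 1)) (g i)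
  have t (i : ℕ) : Primrec fun c => (stk c).getD i ([], [], []) :=
    (Primrec.list_getD _).comp hstk (.const i)
  exact Primrec.ite (e 0) (list_cons.comp (.const _) hstk) (Primrec.ite (e 1) (list_cons.comp
    (primrec_eqAut (primrec_alph hs (primrec_symbolLen hs hw har) (g 0)) (v 2) (v 3)) hstk)
    (Primrec.ite (e 2) (list_cons.comp (primrec_relAut hs hw har (g 0) (g 2)
      (list_drop.comp (.const 3) hl)) hstk) (Primrec.ite (e 3) (list_cons.comp
        (primrec_impAut hs hw har (g 0) (t 0) (t 1)) (list_drop.comp (.const 2) hstk))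
        (list_cons.comp (primrec_allAut hs hw har (g 0) (t 0))
          (list_drop.comp (.const 1) hstk)))))

theorem primrec_codeAut (hs : Primrec s) (hw : Primrec w) (har : Primrec ar) (hl : Primrec l) :
    Primrec fun c => codeAut (s c) (w c) (ar c) (l c) := by
  refine ListAut.primrec_inter ((Primrec.list_getD _).comp (list_foldl
    (h := fun c p => evalToken (s c) (w c) (ar c) p.1 p.2)
    (snd.comp (snd.comp (primrec_parse har hl))) (.const []) (.mk ?_)) (.const 0))
    (ListAut.primrec_relabel primrec_forget (primrec_domAut hs hw har (.const 1)))
  exact primrec_evalToken (hs.comp fst) (hw.comp fst) (har.comp fst) (fst.comp snd) (snd.comp snd)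

theorem primrec_compiledAut : Primrec compiledAut := by
  have hs : Primrec fun x : ℕ × ℕ × List ℕ × List ℕ => x.1 := fst
  have hw : Primrec fun x : ℕ × ℕ × List ℕ × List ℕ => x.2.1 := fst.comp snd
  have ha : Primrec fun x : ℕ × ℕ × List ℕ × List ℕ => x.2.2.1 := fst.comp (snd.comp snd)
  have hc : Primrec fun x : ℕ × ℕ × List ℕ × List ℕ => x.2.2.2 := snd.comp (snd.comp snd)
  have hA := primrec_codeAut hs hw ha hc
  refine .pair (primrec_symbolLen hs hw ha) (list_append.comp (list_map (fst.comp hA) (.mk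
    (Primrec.pair (.const 0) (.pair (.const 0) snd)))) (list_append.comp
      (list_map (snd.comp (snd.comp hA)) (.mk (Primrec.pair snd (.const (1, 0))))) (list_map
        (fst.comp (snd.comp hA)) (.mk (Primrec.pair (fst.comp snd) (.pair ?_
          (snd.comp (snd.comp snd))))))))
  exact nat_add.comp (Primrec.encode.comp (fst.comp (fst.comp (snd.comp snd)))) (.const 2)

end Primrec

/-! ### Lists in the input and their numerical codes -/

/-- The list `l` stands in the input from position `o` on. -/
def InputAt (inp : ℕ → ℕ) (base o : ℕ) (l : List ℕ) : Prop :=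
  o + l.length ≤ base ∧ ∀ i, (h : i < l.length) → inp (o + i) = l[i]

theorem inputAt_append {inp : ℕ → ℕ} {base o : ℕ} {l₁ l₂ : List ℕ} :
    InputAt inp base o (l₁ ++ l₂) ↔ InputAt inp base o l₁ ∧ InputAt inp base (o + l₁.length) l₂ := by
  constructor
  · rintro ⟨h, h'⟩
    rw [List.length_append] at h
    refine ⟨⟨by omega, fun i hi => ?_⟩, by omega, fun i hi => ?_⟩
    · rw [h' i (by simp; omega), List.getElem_append_left hi]
    · rw [add_assoc, h' _ (by simp; omega), List.getElem_append_right (by omega)]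
      simp
  · rintro ⟨⟨h₁, h₁'⟩, h₂, h₂'⟩
    refine ⟨by simp; omega, fun i hi => ?_⟩
    by_cases h : i < l₁.length
    · rw [h₁' i h, List.getElem_append_left h]
    · rw [List.getElem_append_right (by omega), ← h₂' _ (by simp at hi; omega)]
      congr 1; omega

theorem inputAt_cons {inp : ℕ → ℕ} {base o c : ℕ} {l : List ℕ} :
    InputAt inp base o (c :: l) ↔ (o < base ∧ inp o = c) ∧ InputAt inp base (o + 1) l := by
  rw [← List.singleton_append, inputAt_append]
  simp [InputAt]

theorem encode_le_of_suffix {α : Type} [Encodable α] {l₁ l₂ : List α} (h : l₁ <:+ l₂) :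
    Encodable.encode l₁ ≤ Encodable.encode l₂ := by
  induction l₂ with
  | nil => simp [List.suffix_nil.1 h]
  | cons a l ih =>
    obtain rfl | h := List.suffix_cons_iff.1 h
    · exact le_rfl
    · rw [Encodable.encode_list_cons]
      exact (ih h).trans ((Nat.right_le_pair _ _).trans (Nat.le_succ _))

theorem length_le_encode {α : Type} [Encodable α] (l : List α) : l.length ≤ Encodable.encode l := by
  induction l with
  | nil => simp
  | cons a l ih =>
    rw [Encodable.encode_list_cons, List.length_cons]
    exact Nat.succ_le_succ (ih.trans (Nat.right_le_pair _ _))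

/-- A bound for the codes of lists of zeros and ones of a given length. -/
def bitsBound (L : ℕ) : ℕ := Nat.rec 0 (fun _ B => Nat.pair 1 B + 1) L

theorem encode_le_bitsBound {l : List ℕ} (h : ∀ b ∈ l, b = 0 ∨ b = 1) :
    Encodable.encode l ≤ bitsBound l.length := by
  induction l with
  | nil => simp [bitsBound]
  | cons a l ih =>
    have h1 : a ≤ 1 := by have := h a (by simp); omega
    have h2 := ih fun b hb => h b (by simp [hb])
    rw [Encodable.encode_list_cons, List.length_cons]
    refine Nat.succ_le_succ ?_
    exact (StrictMono.monotone (f := Nat.pair a) (fun _ _ h => Nat.pair_lt_pair_right a h) h2).trans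
      (StrictMono.monotone (f := fun a => Nat.pair a (bitsBound l.length))
        (fun _ _ h => Nat.pair_lt_pair_left _ h) h1)

/-- Put the code of the list that stands in the input from `reg 8` to `reg 9` (exclusively) into
register `20`. The list is read backwards, as the code of a list is built from its tail. -/
def Cmd.encodeRange : Cmd :=
  .const 20 0 ;; .move 18 9 ;; .sub 19 9 8 ;;
  .loop 19 (.sub 18 18 1 ;; .move 21 20 ;; .get 20 18 ;; .pairing 20 ;; .add 20 20 1 ;;
    .sub 19 19 1)

/-- The time in which a list with code `r` is encoded. -/
def encodeTime (r : ℕ) : ℕ := r * (4 * r + 30) + 10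

theorem wp_encodeRange {inp : ℕ → ℕ} {base : ℕ} {Q : Store → Prop} {σ : Store} {l : List ℕ}
    (hl : InputAt inp base (σ.reg 8) l) (h9 : σ.reg 9 = σ.reg 8 + l.length) (h1 : σ.reg 1 = 1)
    (h : ∀ σ', Keeps 18 σ σ' → σ'.reg 20 = Encodable.encode l →
      σ'.time ≤ σ.time + encodeTime (Encodable.encode l) → Q σ') :
    wp inp base .encodeRange Q σ := by
  simp only [Cmd.encodeRange, wp_seq, wp_const]
  rw [wp_move (by simp)]
  simp only [wp_sub]
  obtain ⟨hb, hget⟩ := hl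
  have hlen := length_le_encode l
  apply wp_loop (m := l.length) (fun m σ' => m ≤ l.length ∧ σ'.reg 18 = σ.reg 8 + m ∧
    σ'.reg 19 = m ∧ σ'.reg 20 = Encodable.encode (l.drop m) ∧ Keeps 18 σ σ' ∧
    σ'.time ≤ σ.time + (l.length - m) * (4 * Encodable.encode l + 30) + 8)
  · refine ⟨le_rfl, by simp [h9], by simp [h9], by simp, ⟨fun i hi => ?_, rfl⟩, by simp⟩
    simp (disch := omega) only [Store.set_reg, if_neg]
  · rintro m σ' ⟨hm, h2, h3, h4, h5, h6⟩ h0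
    obtain ⟨m, rfl⟩ : ∃ k, m = k + 1 := ⟨m - 1, by omega⟩
    have e1 : σ'.reg 1 = 1 := (h5.reg 1 (by omega)).trans h1
    have hd : l.drop m = l[m] :: l.drop (m + 1) := List.drop_eq_getElem_cons (by omega)
    have hi := hget m (by omega)
    have hc := encode_le_of_suffix (List.drop_suffix m l)
    rw [hd, Encodable.encode_list_cons] at hc
    simp only [wp_seq, wp_sub]
    rw [wp_move (by simp), wp_get]
    refine ⟨by simp [h2, e1]; omega, wp_pairing fun σ₁ k₁ r₁ t₁ => ?_⟩
    simp [h2, h4, e1, hi] at r₁ t₁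
    have e1' := k₁.reg 1 (by omega)
    have e18 := k₁.reg 18 (by omega)
    have e19 := k₁.reg 19 (by omega)
    simp [e1, h2, h3] at e1' e18 e19
    simp only [wp_add]
    refine ⟨m, by omega, by omega, by simp [e18], by simp [e19, e1'],
      by rw [hd, Encodable.encode_list_cons]; simp [r₁, e1'], ⟨fun i hi => ?_, ?_⟩, ?_⟩
    · simp (disch := omega) only [Store.set_reg, Store.tick_reg, if_neg]
      rw [k₁.reg i (by omega)]
      simp (disch := omega) only [Store.set_reg, Store.tick_reg, if_neg]
      exact h5.reg i hi
    · simp only [Store.tick_arr, Store.set_arr]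
      rw [k₁.arr]
      exact h5.arr
    · have : l.length - m = (l.length - (m + 1)) + 1 := by omega
      rw [this, Nat.succ_mul]
      simp only [Encodable.encode_nat] at hc
      simp
      omega
  · rintro m σ' ⟨hm, h2, h3, h4, h5, h6⟩ h0
    obtain rfl : m = 0 := by omega
    refine h _ ⟨h5.reg, h5.arr⟩ (by simpa using h4) ?_
    simp only [Store.tick_time, encodeTime]
    have := Nat.mul_le_mul_right (4 * Encodable.encode l + 30) hlen
    simp only [Nat.sub_zero] at h6
    omega

/-! ### Building a graph with adjacency lists -/

/-- The cells from `e` on form a linked list with the entries `l`; each cell points to an older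
one, and `0` is the end. -/
def Chain (nx dst : ℕ → ℕ) : ℕ → List ℕ → Prop
  | e, [] => e = 0
  | e, v :: l => e ≠ 0 ∧ dst e = v ∧ nx e < e ∧ Chain nx dst (nx e) l

theorem Chain.congr {nx dst nx' dst' : ℕ → ℕ} {e : ℕ} {l : List ℕ} (h : Chain nx dst e l)
    (h' : ∀ i ≤ e, nx' i = nx i ∧ dst' i = dst i) : Chain nx' dst' e l := by
  induction l generalizing e with
  | nil => exact h
  | cons v l ih =>
    obtain ⟨h1, h2, h3, h4⟩ := h
    have he := h' e le_rfl
    refine ⟨h1, he.2.trans h2, by rw [he.1]; exact h3, ?_⟩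
    rw [he.1]
    exact ih h4 fun i hi => h' i (by omega)

/-- The list of successors of `u` in a list of edges. -/
def succsOf (E : List (ℕ × ℕ)) (u : ℕ) : List ℕ := (E.filter (·.1 = u)).map (·.2)

theorem succsOf_cons (e : ℕ × ℕ) (E : List (ℕ × ℕ)) (u : ℕ) :
    succsOf (e :: E) u = if e.1 = u then e.2 :: succsOf E u else succsOf E u := by
  by_cases h : e.1 = u <;> simp [succsOf, h]

theorem mem_succsOf {E : List (ℕ × ℕ)} {u v : ℕ} : v ∈ succsOf E u ↔ (u, v) ∈ E := by
  simp [succsOf]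

/-- The arrays `0` (heads), `1` (targets) and `2` (next cells) hold the adjacency lists of `E`, and
register `4` is the first free cell. -/
structure HoldsGraph (σ : Store) (E : List (ℕ × ℕ)) : Prop where
  pos : 0 < σ.reg 4
  lt : ∀ u, σ.arr 0 u < σ.reg 4
  chain : ∀ u, Chain (σ.arr 2) (σ.arr 1) (σ.arr 0 u) (succsOf E u)

/-- Add the edge from register `22` to register `23`. -/
def Cmd.addEdge : Cmd :=
  .store 1 4 23 ;; .load 24 0 22 ;; .store 2 4 24 ;; .store 0 22 4 ;; .add 4 4 1

/-- What the construction of the graph leaves unchanged. -/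
structure GraphFrame (σ σ' : Store) : Prop where
  reg : ∀ i < 18, i ≠ 4 → σ'.reg i = σ.reg i
  arr : ∀ j ≥ 3, ∀ i, σ'.arr j i = σ.arr j i

theorem wp_addEdge {inp : ℕ → ℕ} {base : ℕ} {Q : Store → Prop} {σ : Store} {E : List (ℕ × ℕ)}
    (h0 : σ.reg 0 = base) (h1 : σ.reg 1 = 1) (hE : HoldsGraph σ E)
    (h : ∀ σ', (∀ i < 20, i ≠ 4 → σ'.reg i = σ.reg i) → (∀ j ≥ 3, ∀ i, σ'.arr j i = σ.arr j i) →
      HoldsGraph σ' ((σ.reg 22, σ.reg 23) :: E) → σ'.time = σ.time + 29 → Q σ') :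
    wp inp base .addEdge Q σ := by
  simp only [Cmd.addEdge, wp_seq, wp_store, wp_load, wp_add]
  refine ⟨h0, by omega, h0, by omega, by simpa using h0, by omega, by simpa using h0, by omega, ?_⟩
  obtain ⟨hp, hlt, hc⟩ := hE
  refine h _ (fun i hi h4 => ?_) (fun j hj i => ?_) ⟨?_, fun u => ?_, fun u => ?_⟩ ?_
  · simp (disch := omega) only [Store.set_reg, Store.put_reg, if_neg]
  · have e0 : j ≠ 0 := by omega
    have e1 : j ≠ 1 := by omega
    have e2 : j ≠ 2 := by omega
    simp [e0, e1, e2]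
  · simp; omega
  · have := hlt u
    simp [h1]
    split_ifs <;> omega
  · have hu := hlt u
    rw [succsOf_cons]
    by_cases hu' : σ.reg 22 = u
    · subst hu'
      rw [if_pos rfl]
      refine ⟨?_, ?_, ?_, ?_⟩
      · simp; omega
      · simp
      · simpa using hu
      · have := hc (σ.reg 22)
        simp
        refine this.congr fun i hi => ?_
        have : i ≠ σ.reg 4 := by omega
        simp [this]
    · rw [if_neg hu']
      have := hc u
      simp [Ne.symm hu']
      refine this.congr fun i hi => ?_
      have : i ≠ σ.reg 4 := by omega
      simp [this]
  · simp

/-- For each transition in the list with code `reg 2` that is labelled by `reg 14`, from `q` to `q'`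
say, add an edge from `reg 13 + q * reg 3` to `reg 15 + q' * reg 3`. -/
def Cmd.addEdges : Cmd :=
  .move 19 2 ;; .loop 19 (
    .move 20 19 ;; .sub 20 20 1 ;; .unpairing 20 ;; .move 19 21 ;; .unpairing 20 ;;
    .move 18 20 ;; .move 20 21 ;; .unpairing 20 ;;
    .sub 22 20 14 ;; .sub 23 14 20 ;; .add 22 22 23 ;;
    .ite 22 (.const 22 0) (
      .move 22 13 ;; .addMul 22 18 3 24 ;; .move 23 15 ;; .addMul 23 21 3 24 ;; .addEdge))

theorem wp_addEdges {inp : ℕ → ℕ} {base : ℕ} {Q : Store → Prop} {σ : Store} {E : List (ℕ × ℕ)}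
    {trs : List (ℕ × ℕ × ℕ)} (h0 : σ.reg 0 = base) (h1 : σ.reg 1 = 1)
    (h2 : σ.reg 2 = Encodable.encode trs) (hE : HoldsGraph σ E)
    (h : ∀ σ' E', GraphFrame σ σ' → HoldsGraph σ' E' →
      (∀ u v, (u, v) ∈ E' ↔ (u, v) ∈ E ∨ ∃ q q', (q, σ.reg 14, q') ∈ trs ∧
        u = σ.reg 13 + q * σ.reg 3 ∧ v = σ.reg 15 + q' * σ.reg 3) →
      E'.length ≤ E.length + trs.length →
      σ'.time ≤ σ.time + trs.length * (40 * Encodable.encode trs + 200) + 3 → Q σ') :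
    wp inp base .addEdges Q σ := by
  rw [Cmd.addEdges, wp_seq, wp_move (by simp)]
  apply wp_loop (m := trs.length) (fun m σ' => ∃ done rest E', trs = done ++ rest ∧
    rest.length = m ∧ σ'.reg 19 = Encodable.encode rest ∧ GraphFrame σ σ' ∧ HoldsGraph σ' E' ∧
    (∀ u v, (u, v) ∈ E' ↔ (u, v) ∈ E ∨ ∃ q q', (q, σ.reg 14, q') ∈ done ∧
        u = σ.reg 13 + q * σ.reg 3 ∧ v = σ.reg 15 + q' * σ.reg 3) ∧
    E'.length ≤ E.length + done.length ∧
    σ'.time ≤ σ.time + done.length * (40 * Encodable.encode trs + 200) + 2)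
  · refine ⟨[], trs, E, rfl, rfl, by simp [h2], ⟨fun i hi _ => ?_, fun _ _ _ => rfl⟩, ⟨?_, ?_, ?_⟩,
      by simp, by simp, by simp⟩
    · simp (disch := omega) only [Store.set_reg, if_neg]
    · simpa using hE.pos
    · simpa using hE.lt
    · simpa using hE.chain
  · rintro m σ₀ ⟨done, rest, E', htrs, rfl, hr, hF, hG, hE', hlen, ht⟩ hne
    obtain _ | ⟨⟨q, γ, q'⟩, rest⟩ := rest
    · simp [hr] at hne
    have hcode : Encodable.encode ((q, γ, q') :: rest) ≤ Encodable.encode trs :=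
      encode_le_of_suffix ⟨done, htrs.symm⟩
    have hcode' : Encodable.encode ((q, γ, q') :: rest) =
      Nat.pair (Nat.pair q (Nat.pair γ q')) (Encodable.encode rest) + 1 := rfl
    rw [hcode'] at hr hcode
    have b1 := Nat.left_le_pair (Nat.pair q (Nat.pair γ q')) (Encodable.encode rest)
    have b2 := Nat.left_le_pair q (Nat.pair γ q')
    have b3 := Nat.right_le_pair q (Nat.pair γ q')
    have b4 := Nat.right_le_pair γ q'
    have f0 := (hF.reg 0 (by omega) (by omega)).trans h0
    have f1 := (hF.reg 1 (by omega) (by omega)).trans h1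
    have f3 := hF.reg 3 (by omega) (by omega)
    have f13 := hF.reg 13 (by omega) (by omega)
    have f14 := hF.reg 14 (by omega) (by omega)
    have f15 := hF.reg 15 (by omega) (by omega)
    rw [wp_seq, wp_move (by simp), wp_seq, wp_sub, wp_seq]
    refine wp_unpairing fun σ₁ k₁ r₁ r₁' t₁ => ?_
    simp [hr, f1] at r₁ r₁' t₁
    rw [wp_seq, wp_move (by simp), wp_seq]
    refine wp_unpairing fun σ₂ k₂ r₂ r₂' t₂ => ?_
    have g₂ := k₂.reg 19 (by omega)
    simp [r₁, r₁'] at r₂ r₂' t₂ g₂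
    rw [wp_seq, wp_move (by simp), wp_seq, wp_move (by simp), wp_seq]
    refine wp_unpairing fun σ₃ k₃ r₃ r₃' t₃ => ?_
    have g₃ := k₃.reg 18 (by omega)
    have g₃' := k₃.reg 19 (by omega)
    simp [r₂, r₂', g₂] at r₃ r₃' t₃ g₃ g₃'
    have K : ∀ i < 18, σ₃.reg i = σ₀.reg i := by
      intro i hi
      rw [k₃.reg i (by omega)]
      simp (disch := omega) only [Store.set_reg, if_neg]
      rw [k₂.reg i (by omega)]
      simp (disch := omega) only [Store.set_reg, if_neg]
      rw [k₁.reg i (by omega)]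
      simp (disch := omega) only [Store.set_reg, Store.tick_reg, if_neg]
    have KA : σ₃.arr = σ₀.arr := by
      rw [k₃.arr]
      simp only [Store.set_arr]
      rw [k₂.arr]
      simp only [Store.set_arr]
      rw [k₁.arr]
      rfl
    have hT : σ₃.time ≤ σ₀.time + 32 * Encodable.encode trs + 80 := by omega
    have e0 := K 0 (by omega)
    have e1 := K 1 (by omega)
    have e3 := K 3 (by omega)
    have e4 := K 4 (by omega)
    have e13 := K 13 (by omega)
    have e14 := K 14 (by omega)
    have e15 := K 15 (by omega)
    simp only [f0, f1, f3, f13, f14, f15] at e0 e1 e3 e13 e14 e15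
    simp only [wp_seq, wp_sub, wp_add]
    rw [wp_ite]
    constructor
    · intro hcond
      have hγ : γ ≠ σ.reg 14 := by
        simp [r₃, e14] at hcond
        omega
      rw [wp_const]
      refine ⟨rest.length, by simp, done ++ [(q, γ, q')], rest, E', by simp [htrs], rfl, ?_, ⟨?_, ?_⟩,
        ⟨?_, ?_, ?_⟩, ?_, ?_, ?_⟩
      · simp [g₃']
      · intro i hi h4
        simp (disch := omega) only [Store.set_reg, Store.tick_reg, if_neg]
        rw [K i hi, hF.reg i hi h4]
      · intro j hj i
        simp [KA, hF.arr j hj i]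
      · simpa [e4] using hG.pos
      · simpa [e4, KA] using hG.lt
      · simpa [KA] using hG.chain
      · intro u v
        rw [hE']
        simp [hγ.symm]
      · simp; omega
      · rw [List.length_append, List.length_singleton, Nat.add_mul, one_mul]
        simp
        omega
    · intro hcond
      have hγ : γ = σ.reg 14 := by
        simp [r₃, e14] at hcond
        omega
      rw [wp_seq, wp_move (by simp), wp_seq]
      refine wp_addMul (by simp) (by simp) (by simp) (by simp) (by simp) (by simp) fun σ₄ r₄ k₄ a₄ t₄ => ?_
      rw [wp_seq, wp_move (by simp), wp_seq]
      refine wp_addMul (by simp) (by simp) (by simp) (by simp) (by simp) (by simp) fun σ₅ r₅ k₅ a₅ t₅ => ?_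
      have f5 : ∀ i < 18, σ₅.reg i = σ₀.reg i := by
        intro i hi
        rw [k₅ i (by omega) (by omega) (by omega)]
        simp (disch := omega) only [Store.set_reg, if_neg]
        rw [k₄ i (by omega) (by omega) (by omega)]
        simp (disch := omega) only [Store.set_reg, Store.tick_reg, if_neg]
        exact K i hi
      have fa : σ₅.arr = σ₀.arr := by
        rw [a₅, Store.set_arr, Store.set_arr, a₄]
        exact KA
      have q15 := k₄ 15 (by omega) (by omega) (by omega)
      have q21 := k₄ 21 (by omega) (by omega) (by omega)
      have q3 := k₄ 3 (by omega) (by omega) (by omega)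
      have q22 := k₅ 22 (by omega) (by omega) (by omega)
      have q19 := k₅ 19 (by omega) (by omega) (by omega)
      have q19' := k₄ 19 (by omega) (by omega) (by omega)
      simp [r₃', e15, e3, r₄, e13, g₃, g₃', q19'] at q15 q21 q3 q22 q19
      simp [q15, q21, q3] at r₅ t₅
      simp [g₃, e13, e3] at r₄ t₄
      refine wp_addEdge (E := E') ?_ ?_ ⟨?_, ?_, ?_⟩ fun σ₆ k₆ a₆ G₆ t₆ => ?_
      · rw [f5 0 (by omega), f0]
      · rw [f5 1 (by omega), f1]
      · rw [f5 4 (by omega)]; exact hG.pos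
      · rw [f5 4 (by omega), fa]; exact hG.lt
      · rw [fa]; exact hG.chain
      rw [q22, r₅] at G₆
      refine ⟨rest.length, by simp, done ++ [(q, γ, q')], rest, _, by simp [htrs], rfl, ?_, ⟨?_, ?_⟩,
        ⟨G₆.pos, G₆.lt, G₆.chain⟩, ?_, ?_, ?_⟩
      · simp only [Store.tick_reg]
        rw [k₆ 19 (by omega) (by omega), q19]
      · intro i hi h4
        simp only [Store.tick_reg]
        rw [k₆ i (by omega) h4, f5 i hi, hF.reg i hi h4]
      · intro j hj i
        simp only [Store.tick_arr]
        rw [a₆ j hj i, fa, hF.arr j hj i]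
      · intro u v
        simp only [List.mem_cons, Prod.mk.injEq, hE', List.mem_append, List.not_mem_nil, or_false, hγ,
          true_and]
        constructor
        · rintro (h | h | ⟨a, b, h, h'⟩)
          · exact .inr ⟨q, q', .inr ⟨rfl, rfl⟩, h⟩
          · exact .inl h
          · exact .inr ⟨a, b, .inl h, h'⟩
        · rintro (h | ⟨a, b, h | ⟨rfl, rfl⟩, h'⟩)
          · exact .inr (.inl h)
          · exact .inr (.inr ⟨a, b, h, h'⟩)
          · exact .inl h'
      · simp; omega
      · rw [List.length_append, List.length_singleton, Nat.add_mul, one_mul]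
        simp only [Store.tick_time]
        omega
  · rintro m σ' ⟨done, rest, E', htrs, rfl, hr, hF, hG, hE', hlen, ht⟩ hz
    rw [hr] at hz
    obtain rfl : rest = [] := by
      cases rest with
      | nil => rfl
      | cons a l => simp at hz
    simp only [List.append_nil] at htrs
    subst htrs
    exact h _ E' ⟨hF.reg, hF.arr⟩ ⟨hG.pos, hG.lt, hG.chain⟩ hE' hlen
      (by simp only [Store.tick_time]; omega)

/-! ### Searching the graph -/

theorem Store.set_reg_ne {σ : Store} {r v t k : ℕ} (h : k ≠ r) :
    (σ.set r v t).reg k = σ.reg k := by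
  simp [h]

theorem exists_remove_edge {E : List (ℕ × ℕ)} {u v : ℕ} {l : List ℕ} (h : succsOf E u = v :: l) :
    ∃ E', E.length = E'.length + 1 ∧ succsOf E' u = l ∧
      ∀ u' ≠ u, succsOf E' u' = succsOf E u' := by
  induction E generalizing l with
  | nil => simp [succsOf] at h
  | cons e E ih =>
    rw [succsOf_cons] at h
    split_ifs at h with he
    · exact ⟨E, rfl, (List.cons.inj h).2, fun u' hu => by
        rw [succsOf_cons, if_neg (by rw [he]; exact hu.symm)]⟩
    · obtain ⟨E', h1, h2, h3⟩ := ih h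
      refine ⟨e :: E', by simp [h1], by rw [succsOf_cons, if_neg he, h2], fun u' hu => ?_⟩
      rw [succsOf_cons, succsOf_cons, h3 u' hu]

/-- Reachability in the graph with the list of edges `E`. -/
def Reaches (E : List (ℕ × ℕ)) : ℕ → ℕ → Prop := Relation.ReflTransGen fun u v => (u, v) ∈ E

/-- Depth first search from the vertex in register `10`: array `3` marks the visited vertices and
array `4`, of height `reg 12`, is the stack. -/
def Cmd.search : Cmd :=
  .const 12 0 ;; .store 3 10 1 ;; .store 4 12 10 ;; .const 12 1 ;;
  .loop 12 (.sub 13 12 1 ;; .load 14 4 13 ;; .load 15 0 14 ;;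
    .ite 15 (.load 16 2 15 ;; .store 0 14 16 ;; .load 17 1 15 ;; .load 18 3 17 ;;
      .ite 18 (.const 18 0) (.store 3 17 1 ;; .store 4 12 17 ;; .add 12 12 1))
    (.sub 12 12 1))

/-- The invariant of the search from `s` in the graph `E`; the adjacency lists hold the edges `R`
that have not been used. The functions are the contents of the arrays. -/
structure SearchInv (E R : List (ℕ × ℕ)) (s : ℕ) (head nx dst vis stk : ℕ → ℕ) (sp : ℕ) :
    Prop where
  chain : ∀ u, Chain nx dst (head u) (succsOf R u)
  bool : ∀ v, vis v = 0 ∨ vis v = 1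
  start : vis s = 1
  sound : ∀ v, vis v = 1 → Reaches E s v
  closed : ∀ u v, (u, v) ∈ E → vis v = 1 ∨ (u, v) ∈ R
  sub : ∀ u v, (u, v) ∈ R → (u, v) ∈ E
  stack : ∀ i < sp, vis (stk i) = 1
  active : ∀ u v, (u, v) ∈ R → vis u = 1 → ∃ i < sp, stk i = u

section SearchInv
variable {E R : List (ℕ × ℕ)} {s p : ℕ} {head nx dst vis stk head' nx' dst' vis' stk' : ℕ → ℕ}

theorem SearchInv.pop (h : SearchInv E R s head nx dst vis stk (p + 1)) (hz : head (stk p) = 0) :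
    SearchInv E R s head nx dst vis stk p := by
  refine { h with
    stack := fun i hi => h.stack i (by omega)
    active := fun u v he hu => ?_ }
  obtain ⟨i, hi, rfl⟩ := h.active u v he hu
  refine ⟨i, ?_, rfl⟩
  by_contra hip
  obtain rfl : i = p := by omega
  have hc := h.chain (stk i)
  rw [← mem_succsOf] at he
  obtain ⟨a, l, hl⟩ := List.exists_cons_of_ne_nil (List.ne_nil_of_mem he)
  rw [hl] at hc
  exact hc.1 hz

theorem SearchInv.step (h : SearchInv E R s head nx dst vis stk (p + 1)) (hne : head (stk p) ≠ 0) :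
    ∃ R', R.length = R'.length + 1 ∧ (stk p, dst (head (stk p))) ∈ E ∧
      (∀ u v, (u, v) ∈ R → (u, v) ∈ R' ∨ u = stk p ∧ v = dst (head (stk p))) ∧
      (∀ u v, (u, v) ∈ R' → (u, v) ∈ R) ∧
      ∀ u, Chain nx dst (if u = stk p then nx (head (stk p)) else head u) (succsOf R' u) := by
  have hc := h.chain (stk p)
  obtain ⟨w, l, hl⟩ : ∃ w l, succsOf R (stk p) = w :: l := by
    cases hl : succsOf R (stk p) with
    | nil => rw [hl] at hc; exact absurd hc hne
    | cons w l => exact ⟨w, l, rfl⟩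
  rw [hl] at hc
  obtain ⟨-, hw, -, hch⟩ := hc
  obtain ⟨R', h1, h2, h3⟩ := exists_remove_edge hl
  have hsub : ∀ u v, (u, v) ∈ R' → (u, v) ∈ R := by
    intro u v huv
    rw [← mem_succsOf] at huv ⊢
    by_cases hu : u = stk p
    · subst hu; rw [hl]; rw [h2] at huv; exact List.mem_cons_of_mem _ huv
    · rwa [h3 u hu] at huv
  refine ⟨R', h1, h.sub _ _ ?_, fun u v huv => ?_, hsub, fun u => ?_⟩
  · rw [← mem_succsOf, hl, hw]; simp
  · rw [← mem_succsOf] at huv ⊢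
    by_cases hu : u = stk p
    · subst hu
      rw [hl, List.mem_cons] at huv
      rw [h2, hw]
      tauto
    · rw [h3 u hu]; exact .inl huv
  · split_ifs with hu
    · rw [hu, h2]; exact hch
    · rw [h3 u hu]; exact h.chain u

/-- Using an edge to a visited vertex. -/
theorem SearchInv.skip (h : SearchInv E R s head nx dst vis stk (p + 1)) (hne : head (stk p) ≠ 0)
    (hvis : vis (dst (head (stk p))) ≠ 0)
    (hhead : ∀ u, head' u = if u = stk p then nx (head (stk p)) else head u)
    (hnx : ∀ i, nx' i = nx i) (hdst : ∀ i, dst' i = dst i) (hv : ∀ i, vis' i = vis i)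
    (hs : ∀ i, stk' i = stk i) :
    ∃ R', R.length = R'.length + 1 ∧ SearchInv E R' s head' nx' dst' vis' stk' (p + 1) := by
  obtain rfl := funext hnx
  obtain rfl := funext hdst
  obtain rfl := funext hv
  obtain rfl := funext hs
  obtain ⟨R', h1, h2, h3, h4, h5⟩ := h.step hne
  refine ⟨R', h1, { h with
    chain := fun u => by rw [hhead]; exact h5 u
    closed := fun u v he => ?_
    sub := fun u v he => h.sub u v (h4 u v he)
    active := fun u v he => h.active u v (h4 u v he) }⟩
  obtain h' | h' := h.closed u v he
  · exact .inl h'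
  · obtain h' | ⟨rfl, rfl⟩ := h3 u v h'
    · exact .inr h'
    · exact .inl ((h.bool _).resolve_left hvis)

/-- Using an edge to a new vertex, which is visited and pushed on the stack. -/
theorem SearchInv.push (h : SearchInv E R s head nx dst vis stk (p + 1)) (hne : head (stk p) ≠ 0)
    (hhead : ∀ u, head' u = if u = stk p then nx (head (stk p)) else head u)
    (hnx : ∀ i, nx' i = nx i) (hdst : ∀ i, dst' i = dst i)
    (hv : ∀ i, vis' i = if i = dst (head (stk p)) then 1 else vis i)
    (hs : ∀ i, stk' i = if i = p + 1 then dst (head (stk p)) else stk i) :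
    ∃ R', R.length = R'.length + 1 ∧ SearchInv E R' s head' nx' dst' vis' stk' (p + 2) := by
  obtain rfl := funext hnx
  obtain rfl := funext hdst
  obtain ⟨R', h1, h2, h3, h4, h5⟩ := h.step hne
  have hmono : ∀ i, vis i = 1 → vis' i = 1 := by
    intro i hi; rw [hv]; split_ifs <;> simp [hi]
  refine ⟨R', h1, ⟨fun u => by rw [hhead]; exact h5 u, fun v => ?_, hmono _ h.start, fun v hvis => ?_,
    fun u v he => ?_, fun u v he => h.sub u v (h4 u v he), fun i hi => ?_, fun u v he hu => ?_⟩⟩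
  · rw [hv]
    split_ifs
    · exact .inr rfl
    · exact h.bool v
  · rw [hv] at hvis
    split_ifs at hvis with hw
    · rw [hw]
      exact (h.sound _ (h.stack p (by omega))).tail h2
    · exact h.sound v hvis
  · obtain h' | h' := h.closed u v he
    · exact .inl (hmono _ h')
    · obtain h' | ⟨-, rfl⟩ := h3 u v h'
      · exact .inr h'
      · exact .inl (by rw [hv, if_pos rfl])
  · rw [hs]
    split_ifs
    · rw [hv, if_pos rfl]
    · exact hmono _ (h.stack i (by omega))
  · rw [hv u] at hu
    split_ifs at hu with hw
    · exact ⟨p + 1, by omega, by rw [hs, if_pos rfl, hw]⟩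
    · obtain ⟨i, hi, rfl⟩ := h.active u v (h4 u v he) hu
      exact ⟨i, by omega, by rw [hs, if_neg (by omega)]⟩

end SearchInv

/-- The form in which a step of the search that uses an edge re-establishes the invariant. -/
theorem exists_measure {E R : List (ℕ × ℕ)} {n k m T : ℕ} {σ σ' : Store}
    (h : ∃ R', R.length = R'.length + 1 ∧
      SearchInv E R' n (σ'.arr 0) (σ'.arr 2) (σ'.arr 1) (σ'.arr 3) (σ'.arr 4) k)
    (hk : σ'.reg 12 = k) (hr : ∀ i < 12, σ'.reg i = σ.reg i) (hm : k + 2 * R.length < m + 2)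
    (ht : σ'.time + 80 * (k + 2 * R.length) ≤ T + 160) :
    ∃ m' < m, ∃ R', m' = 2 * R'.length + σ'.reg 12 ∧ (∀ i < 12, σ'.reg i = σ.reg i) ∧
      SearchInv E R' n (σ'.arr 0) (σ'.arr 2) (σ'.arr 1) (σ'.arr 3) (σ'.arr 4) (σ'.reg 12) ∧
      σ'.time + 80 * m' ≤ T := by
  obtain ⟨R', h1, h2⟩ := h
  subst hk
  exact ⟨2 * R'.length + σ'.reg 12, by omega, R', rfl, hr, h2, by omega⟩

theorem wp_search {inp : ℕ → ℕ} {base : ℕ} {Q : Store → Prop} {σ : Store} {E : List (ℕ × ℕ)}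
    (h0 : σ.reg 0 = base) (h1 : σ.reg 1 = 1) (hE : HoldsGraph σ E) (h3 : ∀ v, σ.arr 3 v = 0)
    (h : ∀ σ', (∀ i < 12, σ'.reg i = σ.reg i) → (∀ v, Reaches E (σ.reg 10) v → σ'.arr 3 v = 1) →
      (∀ v, ¬ Reaches E (σ.reg 10) v → σ'.arr 3 v = 0) →
      σ'.time ≤ σ.time + 80 * (2 * E.length + 1) + 20 → Q σ') :
    wp inp base .search Q σ := by
  simp only [Cmd.search, wp_seq, wp_const, wp_store]
  refine ⟨by simpa using h0, by omega, by simpa using h0, by omega, ?_⟩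
  obtain ⟨n, hn⟩ : ∃ n, σ.reg 10 = n := ⟨_, rfl⟩
  rw [hn] at h
  -- Each round uses up an edge (and pushes at most one vertex) or pops a vertex, so twice the
  -- number of unused edges plus the height of the stack decreases.
  apply wp_loop (m := 2 * E.length + 1) (fun m σ' => ∃ R, m = 2 * R.length + σ'.reg 12 ∧
    (∀ i < 12, σ'.reg i = σ.reg i) ∧
    SearchInv E R n (σ'.arr 0) (σ'.arr 2) (σ'.arr 1) (σ'.arr 3) (σ'.arr 4) (σ'.reg 12) ∧
    σ'.time + 80 * m ≤ σ.time + 80 * (2 * E.length + 1) + 16)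
  · refine ⟨E, by simp, fun i hi => ?_, ⟨?_, ?_, ?_, ?_, ?_, ?_, ?_, ?_⟩, ?_⟩
    · simp (disch := omega) only [Store.set_reg, Store.put_reg, if_neg]
    · intro u
      refine Chain.congr (by simpa using hE.chain u) (by simp)
    · intro v
      by_cases hv : v = n <;> simp [h3, hn, h1, hv]
    · simp [hn, h1]
    · intro v
      by_cases hv : v = n <;> simp [h3, hn, h1, hv]
      exact .refl
    · exact fun u v he => .inr he
    · exact fun _ _ => id
    · simp [h1]
    · intro u v _
      by_cases hv : u = n <;> simp [h3, hn, h1, hv]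
    · simp; omega
  · rintro m σ₀ ⟨R, rfl, hr, hI, ht⟩ hne
    have e0 := (hr 0 (by omega)).trans h0
    have e1 := (hr 1 (by omega)).trans h1
    obtain ⟨p, hp⟩ : ∃ p, σ₀.reg 12 = p + 1 := ⟨σ₀.reg 12 - 1, by omega⟩
    rw [hp] at hI ht
    simp only [wp_seq, wp_sub, wp_load, wp_ite, wp_store, wp_add, wp_const]
    refine ⟨by simpa using e0, by omega, by simpa using e0, by omega, fun hnz => ?_, fun hz => ?_⟩
    · simp [hp, e1] at hnz
      refine ⟨by simpa using e0, by omega, by simpa using e0, by omega, by simpa using e0, by omega,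
        by simpa using e0, by omega, fun hv => ?_, fun hv => ?_⟩
      · simp [hp, e1] at hv
        refine exists_measure (hI.skip hnz hv ?_ ?_ ?_ ?_ ?_) (by simp [hp]) ?_ (by omega) ?_
        any_goals solve | simp [hp, e1]
        · intro i hi
          simp (disch := omega) only [↓Store.set_reg_ne, ↓Store.put_reg, ↓Store.tick_reg, hr]
        · simp; omega
      · simp [hp, e1] at hv
        refine ⟨by simpa using e0, by omega, by simpa using e0, by omega, ?_⟩
        refine exists_measure (hI.push hnz ?_ ?_ ?_ ?_ ?_) (by simp [hp, e1]) ?_ (by omega) ?_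
        any_goals solve | simp [hp, e1]
        · intro i hi
          simp (disch := omega) only [↓Store.set_reg_ne, ↓Store.put_reg, ↓Store.tick_reg, hr]
        · simp; omega
    · simp [hp, e1] at hz
      refine ⟨2 * R.length + p, by omega, R, by simp [hp, e1], fun i hi => ?_, ?_, ?_⟩
      · simp (disch := omega) only [Store.set_reg, Store.tick_reg, if_neg, hr]
      · simpa [hp, e1] using hI.pop hz
      · simp; omega
  · rintro m σ₀ ⟨R, rfl, hr, hI, ht⟩ hz
    have hcl : ∀ v, Reaches E n v → σ₀.arr 3 v = 1 := by
      intro v hv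
      induction hv with
      | refl => exact hI.start
      | tail _ he ih =>
        obtain h' | h' := hI.closed _ _ he
        · exact h'
        · obtain ⟨i, hi, -⟩ := hI.active _ _ h' ih
          omega
    refine h _ hr hcl (fun v hv => (hI.bool v).resolve_right fun h' => hv (hI.sound v h')) ?_
    simp only [Store.tick_time]
    omega

/-! ### The graph of the product automaton -/

/-- The registers and arrays while the graph is built, after the tasks `K`: here a task is a
transition, by the code of a letter, of the given automaton with `n` states and two new ones; it is
combined with all transitions in `trs` with this letter. The pair of the state `p` of the given
automaton and the state `q` of `trs` is the vertex `p + q * (n + 2)`. -/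
structure Ready (base n m L : ℕ) (trs K : List (ℕ × ℕ × ℕ)) (σ : Store) : Prop where
  r0 : σ.reg 0 = base
  r1 : σ.reg 1 = 1
  r2 : σ.reg 2 = Encodable.encode trs
  r3 : σ.reg 3 = n + 2
  r7 : σ.reg 7 = L
  r10 : σ.reg 10 = n
  r11 : σ.reg 11 = m
  a3 : ∀ v, σ.arr 3 v = 0
  graph : ∃ E, HoldsGraph σ E ∧ (∀ u v, (u, v) ∈ E ↔ ∃ k ∈ K, ∃ q q', (q, k.2.1, q') ∈ trs ∧
    u = k.1 + q * (n + 2) ∧ v = k.2.2 + q' * (n + 2)) ∧ E.length ≤ K.length * trs.length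

/-- A bound for the time of `Cmd.addEdges`. -/
def addEdgesTime (trs : List (ℕ × ℕ × ℕ)) : ℕ := trs.length * (40 * Encodable.encode trs + 200) + 3

section
variable {inp : ℕ → ℕ} {base n m L : ℕ} {Q : Store → Prop} {σ σ' : Store}
  {trs K : List (ℕ × ℕ × ℕ)}

theorem Ready.congr (h : Ready base n m L trs K σ)
    (hr : ∀ i < 12, i ≠ 8 → i ≠ 9 → σ'.reg i = σ.reg i) (ha : σ'.arr = σ.arr) :
    Ready base n m L trs K σ' := by
  have hr' : ∀ i < 12, i ≠ 8 → i ≠ 9 → ∀ {v}, σ.reg i = v → σ'.reg i = v :=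
    fun i h h8 h9 v e => (hr i h h8 h9).trans e
  refine ⟨hr' 0 (by omega) (by omega) (by omega) h.r0, hr' 1 (by omega) (by omega) (by omega) h.r1,
    hr' 2 (by omega) (by omega) (by omega) h.r2, hr' 3 (by omega) (by omega) (by omega) h.r3,
    hr' 7 (by omega) (by omega) (by omega) h.r7, hr' 10 (by omega) (by omega) (by omega) h.r10,
    hr' 11 (by omega) (by omega) (by omega) h.r11, by rw [ha]; exact h.a3, ?_⟩
  obtain ⟨E, ⟨hp, hl, hc⟩, h1, h2⟩ := h.graph
  have h4 := hr 4 (by omega) (by omega) (by omega)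
  exact ⟨E, ⟨by rwa [h4], by rwa [h4, ha], by rwa [ha]⟩, h1, h2⟩

theorem Ready.wp_addEdges (hR : Ready base n m L trs K σ)
    (h : ∀ σ', (∀ i < 18, i ≠ 4 → σ'.reg i = σ.reg i) →
      Ready base n m L trs (K ++ [(σ.reg 13, σ.reg 14, σ.reg 15)]) σ' →
      σ'.time ≤ σ.time + addEdgesTime trs → Q σ') :
    wp inp base .addEdges Q σ := by
  obtain ⟨E, hE, hm, hl⟩ := hR.graph
  refine Decisional.wp_addEdges hR.r0 hR.r1 hR.r2 hE fun σ' E' hF hG hE' hl' ht => ?_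
  have hr' : ∀ i < 18, i ≠ 4 → ∀ {v}, σ.reg i = v → σ'.reg i = v :=
    fun i h h4 v e => (hF.reg i h h4).trans e
  refine h σ' hF.reg ⟨hr' 0 (by omega) (by omega) hR.r0, hr' 1 (by omega) (by omega) hR.r1,
    hr' 2 (by omega) (by omega) hR.r2, hr' 3 (by omega) (by omega) hR.r3,
    hr' 7 (by omega) (by omega) hR.r7, hr' 10 (by omega) (by omega) hR.r10,
    hr' 11 (by omega) (by omega) hR.r11, fun v => (hF.arr 3 le_rfl v).trans (hR.a3 v), E', hG,
    fun u v => ?_, ?_⟩ (by simpa [addEdgesTime, add_assoc] using ht)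
  · rw [hE', hm]
    simp only [List.mem_append, List.mem_singleton, or_and_right, exists_or, exists_eq_left, hR.r3]
  · rw [List.length_append, List.length_singleton, Nat.add_mul, one_mul]
    omega

/-- Run through the list of flags at `reg 9` of the `reg 10` states; for each flag that is set, let
the command `d` prepare a task, and add its edges. -/
def Cmd.stateLoop (d : Cmd) : Cmd :=
  .move 12 10 ;; .const 16 0 ;; .loop 12 (.get 17 9 ;; .ite 17 (d ;; .addEdges) (.const 17 0) ;;
    .add 9 9 1 ;; .add 16 16 1 ;; .sub 12 12 1)

theorem Ready.wp_stateLoop {d : Cmd} {task : ℕ → ℕ × ℕ × ℕ}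
    (hd : ∀ (Q : Store → Prop) (σ : Store), σ.reg 10 = n → σ.reg 1 = 1 →
      (∀ σ', (∀ i < 18, i ≠ 13 → i ≠ 14 → i ≠ 15 → σ'.reg i = σ.reg i) → σ'.arr = σ.arr →
        (σ'.reg 13, σ'.reg 14, σ'.reg 15) = task (σ.reg 16) → σ'.time ≤ σ.time + 10 → Q σ') →
      wp inp base d Q σ)
    (hR : Ready base n m L trs K σ) {b : List ℕ} (hb : b.length = n)
    (hin : InputAt inp base (σ.reg 9) b)
    (h : ∀ σ', Ready base n m L trs
        (K ++ ((List.range n).filter fun p => b.getD p 0 ≠ 0).map task) σ' →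
      σ'.reg 9 = σ.reg 9 + n →
      σ'.time ≤ σ.time + n * (addEdgesTime trs + 30) + 10 → Q σ') :
    wp inp base (.stateLoop d) Q σ := by
  rw [Cmd.stateLoop, wp_seq, wp_move (by simp), wp_seq, wp_const]
  apply wp_loop (m := n) (fun m' σ' => m' ≤ n ∧ σ'.reg 12 = m' ∧ σ'.reg 16 = n - m' ∧
    σ'.reg 9 = σ.reg 9 + (n - m') ∧
    Ready base n m L trs
        (K ++ ((List.range (n - m')).filter fun p => b.getD p 0 ≠ 0).map task) σ' ∧
    σ'.time ≤ σ.time + (n - m') * (addEdgesTime trs + 30) + 5)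
  · refine ⟨le_rfl, by simp [hR.r10], by simp, by simp, ?_, by simp⟩
    simp only [Nat.sub_self, List.range_zero, List.filter_nil, List.map_nil, List.append_nil]
    refine hR.congr (fun i hi h8 h9 => ?_) rfl
    simp (disch := omega) only [↓Store.set_reg_ne]
  · rintro m' σ₀ ⟨hm, h12, h16, h9, hR₀, ht⟩ hne
    obtain ⟨m', rfl⟩ : ∃ k, m' = k + 1 := ⟨m' - 1, by omega⟩
    obtain ⟨p, hp⟩ : ∃ p, n - (m' + 1) = p := ⟨_, rfl⟩
    have hp' : n - m' = p + 1 := by omega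
    rw [hp] at h16 h9 hR₀ ht
    have hrange : (List.range (p + 1)).filter (fun p => b.getD p 0 ≠ 0) =
        (List.range p).filter (fun p => b.getD p 0 ≠ 0) ++ if b.getD p 0 ≠ 0 then [p] else [] := by
      rw [List.range_succ, List.filter_append]
      congr 1
      by_cases hbp : b.getD p 0 = 0 <;>
        simp [-List.getD_eq_getElem?_getD, hbp]
    have hget : inp (σ.reg 9 + p) = b.getD p 0 := by
      rw [hin.2 p (by omega)]; simp [show p < b.length by omega]
    have hlt := hin.1
    rw [wp_seq, wp_get]
    refine ⟨by simp [h9]; omega, ?_⟩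
    rw [wp_seq, wp_ite]
    constructor
    · intro hf
      have hf' : b.getD p 0 ≠ 0 := by simpa [h9, hget] using hf
      rw [wp_seq]
      refine hd _ _ (by simp [hR₀.r10]) (by simp [hR₀.r1]) fun σ₁ k₁ a₁ e₁ t₁ => ?_
      have R₁ : Ready base n m L trs
          (K ++ ((List.range p).filter fun p => b.getD p 0 ≠ 0).map task) σ₁ := by
        refine hR₀.congr (fun i hi _ _ => ?_) a₁
        rw [k₁ i (by omega) (by omega) (by omega) (by omega)]
        simp (disch := omega) only [↓Store.set_reg_ne, ↓Store.tick_reg]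
      refine R₁.wp_addEdges fun σ₂ k₂ R₂ t₂ => ?_
      have f9 := (k₂ 9 (by omega) (by omega)).trans (k₁ 9 (by omega) (by omega) (by omega) (by omega))
      have f12 := (k₂ 12 (by omega) (by omega)).trans
        (k₁ 12 (by omega) (by omega) (by omega) (by omega))
      have f16 := (k₂ 16 (by omega) (by omega)).trans
        (k₁ 16 (by omega) (by omega) (by omega) (by omega))
      simp [h9, h12, h16] at f9 f12 f16 e₁ t₁
      have r1 := R₂.r1
      simp only [wp_seq, wp_add, wp_sub]
      refine ⟨m', by omega, by omega, by simp [f12, r1], by simp [f16, r1, hp'],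
        by simp [f9, r1, hp']; omega, ?_, ?_⟩
      · rw [hp', hrange, if_pos hf', List.map_append, ← List.append_assoc, List.map_singleton, ← e₁]
        refine R₂.congr (fun i hi h8 h9 => ?_) rfl
        simp (disch := omega) only [↓Store.set_reg_ne, ↓Store.tick_reg]
      · rw [hp', Nat.add_mul, one_mul]
        simp
        omega
    · intro hf
      have hf' : b.getD p 0 = 0 := by simpa [h9, hget] using hf
      simp only [wp_seq, wp_add, wp_sub, wp_const]
      have r1 := hR₀.r1
      refine ⟨m', by omega, by omega, by simp [h12, r1], by simp [h16, r1, hp'],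
        by simp [h9, r1, hp']; omega, ?_, ?_⟩
      · rw [hp', hrange, if_neg (by simpa using hf'), List.append_nil]
        refine hR₀.congr (fun i hi h8 h9 => ?_) rfl
        simp (disch := omega) only [↓Store.set_reg_ne, ↓Store.tick_reg]
      · rw [hp', Nat.add_mul, one_mul]
        simp
        omega
  · rintro m' σ₀ ⟨hm, h12, h16, h9, hR₀, ht⟩ hz
    obtain rfl : m' = 0 := by omega
    simp only [Nat.sub_zero] at h9 hR₀ ht
    refine h _ (hR₀.congr (fun _ _ _ _ => rfl) rfl) (by simpa using h9) ?_
    simp only [Store.tick_time]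
    omega

/-- The input for a list of transitions, with the codes of their letters. -/
def transInput (ts : List (ℕ × List ℕ × ℕ)) : List ℕ :=
  ts.flatMap fun t => t.1 :: t.2.2 :: t.2.1

/-- Run through the list of the `reg 11` transitions at `reg 9`, whose letters consist of `reg 7`
bits. -/
def Cmd.transLoop : Cmd :=
  .move 12 11 ;; .loop 12 (.get 13 9 ;; .add 9 9 1 ;; .get 15 9 ;; .add 8 9 1 ;; .add 9 8 7 ;;
    .encodeRange ;; .const 14 2 ;; .add 14 20 14 ;; .addEdges ;; .sub 12 12 1)

theorem encodeTime_mono : Monotone encodeTime := fun a b h => by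
  unfold encodeTime; gcongr

theorem Ready.wp_transLoop (hR : Ready base n m L trs K σ) {ts : List (ℕ × List ℕ × ℕ)} {B : ℕ}
    (hts : ts.length = m) (hL : ∀ t ∈ ts, t.2.1.length = L)
    (hB : ∀ t ∈ ts, Encodable.encode t.2.1 ≤ B)
    (hin : InputAt inp base (σ.reg 9) (transInput ts))
    (h : ∀ σ', Ready base n m L trs
        (K ++ ts.map fun t => (t.1, Encodable.encode t.2.1 + 2, t.2.2)) σ' →
      σ'.time ≤ σ.time + m * (addEdgesTime trs + encodeTime B + 30) + 10 → Q σ') :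
    wp inp base .transLoop Q σ := by
  rw [Cmd.transLoop, wp_seq, wp_move (by simp)]
  apply wp_loop (m := m) (fun m' σ' => ∃ done rest, ts = done ++ rest ∧ rest.length = m' ∧
    σ'.reg 12 = m' ∧ InputAt inp base (σ'.reg 9) (transInput rest) ∧
    Ready base n m L trs
        (K ++ done.map fun t => (t.1, Encodable.encode t.2.1 + 2, t.2.2)) σ' ∧
    σ'.time ≤ σ.time + done.length * (addEdgesTime trs + encodeTime B + 30) + 5)
  · refine ⟨[], ts, rfl, hts, by simp [hR.r11], by simpa using hin, ?_, by simp⟩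
    rw [List.map_nil, List.append_nil]
    refine hR.congr (fun i hi h8 h9 => ?_) rfl
    simp (disch := omega) only [↓Store.set_reg_ne]
  · rintro m' σ₀ ⟨done, rest, hdr, rfl, h12, hin₀, hR₀, ht⟩ hne
    obtain _ | ⟨⟨p, a, p'⟩, rest⟩ := rest
    · simp [h12] at hne
    have hmem : (p, a, p') ∈ ts := by rw [hdr]; simp
    have ha : a.length = L := hL _ hmem
    have hB' := encodeTime_mono (hB _ hmem)
    simp only at hB'
    have hin₁ : InputAt inp base (σ₀.reg 9) (p :: p' :: (a ++ transInput rest)) := hin₀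
    rw [inputAt_cons, inputAt_cons, inputAt_append] at hin₁
    obtain ⟨⟨hlt, hget⟩, ⟨hlt', hget'⟩, hia, hir⟩ := hin₁
    have r1 := hR₀.r1
    have r7 := hR₀.r7
    rw [wp_seq, wp_get]
    refine ⟨by simpa using hlt, ?_⟩
    rw [wp_seq, wp_add, wp_seq, wp_get]
    refine ⟨by simpa [r1] using hlt', ?_⟩
    rw [wp_seq, wp_add, wp_seq, wp_add, wp_seq]
    refine wp_encodeRange (l := a) (by simpa [r1] using hia) (by simp [r7, ha]) (by simp [r1])
      fun σ₁ k₁ e₁ t₁ => ?_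
    have f9 := k₁.reg 9 (by omega)
    have f12 := k₁.reg 12 (by omega)
    have f13 := k₁.reg 13 (by omega)
    have f15 := k₁.reg 15 (by omega)
    simp [r1, r7, hget, hget', h12] at f9 f12 f13 f15 t₁
    rw [wp_seq, wp_const, wp_seq, wp_add, wp_seq]
    have R₁ : Ready base n m L trs
        (K ++ done.map fun t => (t.1, Encodable.encode t.2.1 + 2, t.2.2)) σ₁ := by
      refine hR₀.congr (fun i hi h8 h9 => ?_) k₁.arr
      rw [k₁.reg i (by omega)]
      simp (disch := omega) only [↓Store.set_reg_ne, ↓Store.tick_reg]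
    have R₂ := R₁.congr (σ' := (σ₁.set 14 2 1).set 14 ((σ₁.set 14 2 1).reg 20 +
      (σ₁.set 14 2 1).reg 14) 1) (fun i hi h8 h9 => by
        simp (disch := omega) only [↓Store.set_reg_ne]) rfl
    refine R₂.wp_addEdges fun σ₂ k₂ R₂ t₂ => ?_
    have g9 := k₂ 9 (by omega) (by omega)
    have g12 := k₂ 12 (by omega) (by omega)
    simp [f9, f12, f13, f15, e₁] at g9 g12 R₂ t₂
    rw [wp_sub]
    refine ⟨rest.length, by simp, done ++ [(p, a, p')], rest, by simp [hdr], rfl, ?_, ?_, ?_, ?_⟩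
    · simp [g12, R₂.r1]
    · simpa [g9, ha] using hir
    · rw [List.map_append, ← List.append_assoc, List.map_singleton]
      refine Ready.congr (σ := σ₂) (by simpa using R₂) (fun i hi h8 h9 => ?_) rfl
      simp (disch := omega) only [↓Store.set_reg_ne, ↓Store.tick_reg]
    · rw [List.length_append, List.length_singleton, Nat.add_mul, one_mul]
      simp
      omega
  · rintro m' σ₀ ⟨done, rest, hdr, rfl, h12, hin₀, hR₀, ht⟩ hz
    obtain rfl : rest = [] := List.length_eq_zero_iff.1 (by omega)
    rw [List.append_nil] at hdr
    subst hdr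
    refine h _ (hR₀.congr (fun _ _ _ _ => rfl) rfl) ?_
    simp only [Store.tick_time]
    rw [hts] at ht
    omega

end

/-! ### The program -/

/-- Read the parameters, encode them as a number, and let `d` compute the automaton of the
sentence. -/
def Cmd.readParameters (d : Cmd) : Cmd :=
  .const 1 1 ;; .const 8 2 ;; .get 9 8 ;; .const 8 3 ;; .add 9 8 9 ;; .encodeRange ;;
  .move 10 20 ;; .get 11 9 ;; .add 8 9 1 ;; .add 9 8 11 ;; .encodeRange ;;
  .move 21 20 ;; .move 20 10 ;; .pairing 20 ;;
  .move 21 20 ;; .const 10 1 ;; .get 20 10 ;; .pairing 20 ;;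
  .move 21 20 ;; .const 10 0 ;; .get 20 10 ;; .pairing 20 ;;
  d ;; .sub 20 20 1 ;; .unpairing 20 ;; .move 7 20 ;; .move 2 21

/-- The function `compiledAut` on codes. -/
def compiledCode (x : ℕ) : ℕ :=
  Encodable.encode ((Encodable.decode x : Option (ℕ × ℕ × List ℕ × List ℕ)).map compiledAut)

theorem natPrimrec_compiledCode : Nat.Primrec compiledCode :=
  (Primrec.nat_iff.1 (Primrec.encode.comp
    (Primrec.option_map Primrec.decode (.mk (primrec_compiledAut.comp Primrec.snd)))))

theorem compiledCode_encode (x : ℕ × ℕ × List ℕ × List ℕ) :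
    compiledCode (Encodable.encode x) = Encodable.encode (compiledAut x) + 1 := by
  simp only [compiledCode, Encodable.encodek, Option.map_some, Encodable.encode_some]

/-- A bound for the time of `Cmd.readParameters`, if its command `d` takes time `t`. -/
def parameterTime (t : ℕ → ℕ) (x : ℕ × ℕ × List ℕ × List ℕ) : ℕ :=
  2 * encodeTime (Encodable.encode x) + 12 * Encodable.encode x + t (Encodable.encode x) +
    8 * Encodable.encode (compiledAut x) + 100

section
variable {inp : ℕ → ℕ} {base : ℕ} {Q : Store → Prop} {σ : Store}

theorem wp_readParameters {d : Cmd} {t : ℕ → ℕ}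
    (hd : ∀ inp base σ, wp inp base d (fun σ' => Keeps 20 σ σ' ∧
      σ'.reg 20 = compiledCode (σ.reg 20) ∧ σ'.time ≤ σ.time + t (σ.reg 20)) σ)
    {s w : ℕ} {ar c : List ℕ}
    (hin : InputAt inp base 0 (s :: w :: ar.length :: (ar ++ c.length :: c)))
    (h : ∀ σ', σ'.arr = σ.arr → σ'.reg 1 = 1 →
      σ'.reg 2 = Encodable.encode (compiledAut (s, w, ar, c)).2 →
      σ'.reg 7 = (compiledAut (s, w, ar, c)).1 → σ'.reg 9 = 4 + ar.length + c.length →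
      σ'.time ≤ σ.time + parameterTime t (s, w, ar, c) → Q σ') :
    wp inp base (.readParameters d) Q σ := by
  simp only [inputAt_cons, inputAt_append] at hin
  obtain ⟨⟨l0, g0⟩, ⟨l1, g1⟩, ⟨l2, g2⟩, har, ⟨l3, g3⟩, hc⟩ := hin
  norm_num at l1 l2 g1 g2 har l3 g3 hc
  have hx : Encodable.encode (s, w, ar, c) = Nat.pair s (Nat.pair w
    (Nat.pair (Encodable.encode ar) (Encodable.encode c))) := rfl
  have b1 := Nat.right_le_pair s (Nat.pair w (Nat.pair (Encodable.encode ar) (Encodable.encode c)))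
  have b2 := Nat.right_le_pair w (Nat.pair (Encodable.encode ar) (Encodable.encode c))
  have b3 := Nat.right_le_pair (Encodable.encode ar) (Encodable.encode c)
  have b4 := Nat.left_le_pair (Encodable.encode ar) (Encodable.encode c)
  rw [← hx] at b1
  have m1 := encodeTime_mono (b4.trans (b2.trans b1))
  have m2 := encodeTime_mono (b3.trans (b2.trans b1))
  rw [Cmd.readParameters, wp_seq, wp_const, wp_seq, wp_const, wp_seq, wp_get]
  refine ⟨by simpa using l2, ?_⟩
  rw [wp_seq, wp_const, wp_seq, wp_add, wp_seq]
  refine wp_encodeRange (l := ar) (by simpa using har) (by simp [g2]) (by simp) fun σ₁ k₁ r₁ t₁ => ?_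
  have p1 := k₁.reg 1 (by omega)
  have p9 := k₁.reg 9 (by omega)
  have ka := k₁.arr
  simp [g2] at p1 p9 t₁ ka
  rw [wp_seq, wp_move (by simp), wp_seq, wp_get]
  refine ⟨by simpa [p9] using l3, ?_⟩
  rw [wp_seq, wp_add, wp_seq, wp_add, wp_seq]
  refine wp_encodeRange (l := c) (by simpa [p9, p1] using hc) (by simp [p9, g3, p1]) (by simp [p1])
    fun σ₂ k₂ r₂ t₂ => ?_
  have q1 := k₂.reg 1 (by omega)
  have q9 := k₂.reg 9 (by omega)
  have q10 := k₂.reg 10 (by omega)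
  have kb := k₂.arr
  simp [p1, p9, g3, r₁] at q1 q9 q10 t₂ kb
  rw [wp_seq, wp_move (by simp), wp_seq, wp_move (by simp), wp_seq]
  refine wp_pairing fun σ₃ k₃ r₃ t₃ => ?_
  have u1 := k₃.reg 1 (by omega)
  have u9 := k₃.reg 9 (by omega)
  have kc := k₃.arr
  simp [q1, q9, q10, r₂] at u1 u9 r₃ t₃ kc
  rw [wp_seq, wp_move (by simp), wp_seq, wp_const, wp_seq, wp_get]
  refine ⟨by simpa using l1, ?_⟩
  rw [wp_seq]
  refine wp_pairing fun σ₄ k₄ r₄ t₄ => ?_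
  have v1 := k₄.reg 1 (by omega)
  have v9 := k₄.reg 9 (by omega)
  have kd := k₄.arr
  simp [u1, u9, r₃, g1] at v1 v9 r₄ t₄ kd
  rw [wp_seq, wp_move (by simp), wp_seq, wp_const, wp_seq, wp_get]
  refine ⟨by simpa using l0, ?_⟩
  rw [wp_seq]
  refine wp_pairing fun σ₅ k₅ r₅ t₅ => ?_
  have w1 := k₅.reg 1 (by omega)
  have w9 := k₅.reg 9 (by omega)
  have ke := k₅.arr
  simp [v1, v9, r₄, g0] at w1 w9 r₅ t₅ ke
  rw [← hx] at r₅ t₅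
  rw [wp_seq]
  refine wp_mono (hd _ _ _) fun σ₆ ⟨k₆, r₆, t₆⟩ => ?_
  rw [r₅] at r₆ t₆
  rw [compiledCode_encode] at r₆
  have x1 := (k₆.reg 1 (by omega)).trans w1
  have x9 := (k₆.reg 9 (by omega)).trans w9
  have kf := k₆.arr
  rw [wp_seq, wp_sub, wp_seq]
  refine wp_unpairing fun σ₇ k₇ r₇ r₇' t₇ => ?_
  have y1 := k₇.reg 1 (by omega)
  have y9 := k₇.reg 9 (by omega)
  have kg := k₇.arr
  have hy : Nat.unpair (Encodable.encode (compiledAut (s, w, ar, c))) =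
    ((compiledAut (s, w, ar, c)).1, Encodable.encode (compiledAut (s, w, ar, c)).2) :=
    Nat.unpair_pair _ _
  simp [x1, x9, r₆, hy] at y1 y9 r₇ r₇' t₇ kg
  rw [wp_seq, wp_move (by simp), wp_move (by simp)]
  refine h _ (by simp [kg, kf, ke, kd, kc, kb, ka]) (by simp [y1]) (by simp [r₇']) (by simp [r₇])
    (by simp [y9]; omega) ?_
  simp only [parameterTime, Store.set_time]
  omega

/-- Read the numbers of states and transitions of the given automaton, and compute the length of
the input. -/
def Cmd.readHeader : Cmd :=
  .get 10 9 ;; .add 9 9 1 ;; .get 11 9 ;; .add 9 9 1 ;; .const 3 2 ;; .add 3 3 10 ;;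
  .move 0 9 ;; .add 0 0 10 ;; .add 0 0 10 ;; .const 12 2 ;; .add 12 12 7 ;; .move 13 11 ;;
  .addMul 0 13 12 14 ;; .const 4 1

theorem wp_readHeader {n m L pos : ℕ} {trs : List (ℕ × ℕ × ℕ)} (h1 : σ.reg 1 = 1)
    (h2 : σ.reg 2 = Encodable.encode trs) (h7 : σ.reg 7 = L) (h9 : σ.reg 9 = pos)
    (hin : InputAt inp base pos [n, m]) (hbase : base = pos + 2 + 2 * n + m * (2 + L))
    (harr : ∀ j i, σ.arr j i = 0)
    (h : ∀ σ', Ready base n m L trs [] σ' → σ'.reg 9 = pos + 2 →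
      σ'.time ≤ σ.time + 4 * m + 20 → Q σ') :
    wp inp base .readHeader Q σ := by
  simp only [inputAt_cons] at hin
  obtain ⟨⟨l0, g0⟩, ⟨l1, g1⟩, -⟩ := hin
  rw [Cmd.readHeader, wp_seq, wp_get]
  refine ⟨by rwa [h9], ?_⟩
  rw [wp_seq, wp_add, wp_seq, wp_get]
  refine ⟨by simpa [h9, h1] using l1, ?_⟩
  rw [wp_seq, wp_add, wp_seq, wp_const, wp_seq, wp_add, wp_seq, wp_move (by simp), wp_seq, wp_add,
    wp_seq, wp_add, wp_seq, wp_const, wp_seq, wp_add, wp_seq, wp_move (by simp), wp_seq]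
  refine wp_addMul (by simp) (by simp) (by simp) (by simp) (by simp) (by simp)
    fun σ₁ r₁ k₁ a₁ t₁ => ?_
  rw [wp_const]
  have K : ∀ i, i ≠ 0 → i ≠ 13 → i ≠ 14 → i ≠ 4 → (σ₁.set 4 1 1).reg i = σ₁.reg i := by
    intro i _ _ _ h4
    rw [Store.set_reg_ne h4]
  have f1 := k₁ 1 (by omega) (by omega) (by omega)
  have f2 := k₁ 2 (by omega) (by omega) (by omega)
  have f3 := k₁ 3 (by omega) (by omega) (by omega)
  have f7 := k₁ 7 (by omega) (by omega) (by omega)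
  have f9 := k₁ 9 (by omega) (by omega) (by omega)
  have f10 := k₁ 10 (by omega) (by omega) (by omega)
  have f11 := k₁ 11 (by omega) (by omega) (by omega)
  simp [h1, h2, h7, h9, g0, g1] at f1 f2 f3 f7 f9 f10 f11 r₁ t₁
  have ha : σ₁.arr = σ.arr := a₁
  refine h _ ⟨by simp [r₁, hbase]; ring, by simp [f1], by simp [f2], by simp [f3, add_comm],
    by simp [f7], by simp [f10], by simp [f11], by simp [ha, harr], [], ⟨by simp, ?_, ?_⟩, by simp,
    by simp⟩ (by simp [f9]) (by simp; omega)
  · simp [ha, harr]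
  · simp [ha, harr, succsOf, Chain]

/-- Prepare the transition from the new initial state to the state in register `16`. -/
def Cmd.initialTask : Cmd := .move 13 10 ;; .const 14 0 ;; .move 15 16

/-- Prepare the transition from the state in register `16` to the new final state. -/
def Cmd.finalTask : Cmd := .move 13 16 ;; .const 14 1 ;; .add 15 10 1

/-- The whole algorithm; the answer is left in register `5`. -/
def Cmd.decideRealized (d : Cmd) : Cmd :=
  .readParameters d ;; .readHeader ;; .stateLoop .initialTask ;; .stateLoop .finalTask ;;
  .transLoop ;; .search ;; .add 10 10 1 ;; .load 5 3 10

/-- The transitions of the given automaton with a new initial state `n` and a new final state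
`n + 1`, for flags `ini` and `fin` of its states and its list `ts` of transitions. -/
def tasks (n : ℕ) (ini fin : List ℕ) (ts : List (ℕ × List ℕ × ℕ)) : List (ℕ × ℕ × ℕ) :=
  (((List.range n).filter fun p => ini.getD p 0 ≠ 0).map fun p => (n, 0, p)) ++
  ((((List.range n).filter fun p => fin.getD p 0 ≠ 0).map fun p => (p, 1, n + 1)) ++
  ts.map fun t => (t.1, Encodable.encode t.2.1 + 2, t.2.2))

/-- The edges of the product of two lists of transitions. The states of the first are below `N`, so
that `p + q * N` determines the pair of states `(p, q)`. -/
def ProductEdge (N : ℕ) (K trs : List (ℕ × ℕ × ℕ)) (u v : ℕ) : Prop :=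
  ∃ k ∈ K, ∃ q q', (q, k.2.1, q') ∈ trs ∧ u = k.1 + q * N ∧ v = k.2.2 + q' * N

/-- The time bound per state and transition of the given automaton. -/
def totalTime (t : ℕ → ℕ) (x : ℕ × ℕ × List ℕ × List ℕ) : ℕ :=
  parameterTime t x + 2 * addEdgesTime (compiledAut x).2 +
    encodeTime (bitsBound (compiledAut x).1) + 320 * (compiledAut x).2.length + 300

theorem wp_decideRealized {d : Cmd} {t : ℕ → ℕ}
    (hd : ∀ inp base σ, wp inp base d (fun σ' => Keeps 20 σ σ' ∧
      σ'.reg 20 = compiledCode (σ.reg 20) ∧ σ'.time ≤ σ.time + t (σ.reg 20)) σ)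
    {s w n : ℕ} {ar c ini fin : List ℕ} {ts : List (ℕ × List ℕ × ℕ)}
    (hini : ini.length = n) (hfin : fin.length = n)
    (hts : ∀ t ∈ ts, t.2.1.length = (compiledAut (s, w, ar, c)).1 ∧ ∀ b ∈ t.2.1, b = 0 ∨ b = 1)
    (hin : InputAt inp base 0 ((s :: w :: ar.length :: (ar ++ c.length :: c)) ++
      (n :: ts.length :: (ini ++ fin ++ transInput ts))))
    (hbase : base = ((s :: w :: ar.length :: (ar ++ c.length :: c)) ++
      (n :: ts.length :: (ini ++ fin ++ transInput ts))).length)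
    (harr : ∀ j i, σ.arr j i = 0)
    (h : ∀ σ', (Relation.ReflTransGen (ProductEdge (n + 2) (tasks n ini fin ts)
        (compiledAut (s, w, ar, c)).2) n (n + 1) → σ'.reg 5 = 1) →
      (¬ Relation.ReflTransGen (ProductEdge (n + 2) (tasks n ini fin ts)
        (compiledAut (s, w, ar, c)).2) n (n + 1) → σ'.reg 5 = 0) →
      σ'.time ≤ σ.time + totalTime t (s, w, ar, c) * (n + ts.length + 1) → Q σ') :
    wp inp base (.decideRealized d) Q σ := by
  obtain ⟨L, trs, hA⟩ : ∃ L trs, compiledAut (s, w, ar, c) = (L, trs) := ⟨_, _, rfl⟩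
  have hlen : (transInput ts).length = ts.length * (2 + L) := by
    clear hin hbase h
    induction ts with
    | nil => simp [transInput]
    | cons a ts ih =>
      have h1 := (hts a (by simp)).1
      have h2 := ih fun t ht => hts t (by simp [ht])
      rw [hA] at h1
      simp only [transInput, List.flatMap_cons, List.length_append, List.length_cons] at h2 ⊢
      rw [h2, h1]; ring
  rw [inputAt_append] at hin
  obtain ⟨hin₁, hin₂⟩ := hin
  have hpos : 0 + (s :: w :: ar.length :: (ar ++ c.length :: c)).length =
    4 + ar.length + c.length := by simp; ring
  rw [hpos] at hin₂
  change InputAt inp base _ ([n, ts.length] ++ ((ini ++ fin) ++ transInput ts)) at hin₂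
  rw [inputAt_append, inputAt_append, inputAt_append] at hin₂
  obtain ⟨hhead, ⟨hini', hfin'⟩, hts'⟩ := hin₂
  simp only [List.length_cons, List.length_nil, List.length_append, hini,
    hfin, Nat.zero_add, Nat.reduceAdd] at hini' hfin' hts'
  rw [Cmd.decideRealized, wp_seq]
  refine wp_readParameters hd hin₁ fun σ₁ a₁ p1 p2 p7 p9 t₁ => ?_
  rw [hA] at p2 p7
  rw [wp_seq]
  refine wp_readHeader p1 p2 p7 p9 hhead ?_ (by rw [a₁]; exact harr) fun σ₂ R₂ p9 t₂ => ?_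
  · rw [hbase, List.length_append, ← Nat.zero_add (List.length _), hpos]
    simp [hlen, hini, hfin]; ring
  rw [wp_seq]
  refine R₂.wp_stateLoop (task := fun p => (n, 0, p)) (fun Q σ h10 _ h => ?_) hini
    (by rw [p9]; exact hini') fun σ₃ R₃ q9 t₃ => ?_
  · rw [Cmd.initialTask, wp_seq, wp_move (by simp), wp_seq, wp_const, wp_move (by simp)]
    refine h _ (fun i hi h1 h2 h3 => ?_) rfl (by simp [h10]) (by simp)
    simp (disch := omega) only [↓Store.set_reg_ne]
  rw [wp_seq]
  refine R₃.wp_stateLoop (task := fun p => (p, 1, n + 1)) (fun Q σ h10 h1 h => ?_) hfin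
    (by rw [q9, p9]; exact hfin') fun σ₄ R₄ u9 t₄ => ?_
  · rw [Cmd.finalTask, wp_seq, wp_move (by simp), wp_seq, wp_const, wp_add]
    refine h _ (fun i hi h1 h2 h3 => ?_) rfl (by simp [h10, h1]) (by simp)
    simp (disch := omega) only [↓Store.set_reg_ne]
  rw [wp_seq]
  refine R₄.wp_transLoop (ts := ts) (B := bitsBound L) rfl (fun t ht => ?_) (fun t ht => ?_)
    ?_ fun σ₅ R₅ t₅ => ?_
  · rw [(hts t ht).1, hA]
  · have := encode_le_bitsBound (hts t ht).2
    rwa [(hts t ht).1, hA] at this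
  · rw [u9, q9, p9]
    convert hts' using 1
    ring
  obtain ⟨E, hE, hmem, hEl⟩ := R₅.graph
  rw [wp_seq]
  refine wp_search R₅.r0 R₅.r1 hE R₅.a3 fun σ₆ k₆ hyes hno t₆ => ?_
  have e0 := (k₆ 0 (by omega)).trans R₅.r0
  have e1 := (k₆ 1 (by omega)).trans R₅.r1
  have e10 := (k₆ 10 (by omega)).trans R₅.r10
  rw [R₅.r10] at hyes hno
  have hreach : Reaches E n = Relation.ReflTransGen (ProductEdge (n + 2) (tasks n ini fin ts)
      (compiledAut (s, w, ar, c)).2) n := by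
    rw [Reaches]
    congr 1
    funext u v
    rw [hmem, ProductEdge, hA, tasks]
    simp only [List.nil_append, List.append_assoc]
  rw [hreach] at hyes hno
  simp only [wp_seq, wp_add, wp_load]
  refine ⟨by simp [e0], by omega, h _ (fun hr => ?_) (fun hr => ?_) ?_⟩
  · simpa [e10, e1] using hyes _ hr
  · simpa [e10, e1] using hno _ hr
  · have hK : E.length ≤ (2 * n + ts.length) * trs.length := by
      refine hEl.trans (Nat.mul_le_mul_right _ ?_)
      simp only [List.length_append, List.length_map, List.length_nil]
      have h1 := List.length_filter_le (fun p => decide (ini.getD p 0 ≠ 0)) (List.range n)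
      have h2 := List.length_filter_le (fun p => decide (fin.getD p 0 ≠ 0)) (List.range n)
      rw [List.length_range] at h1 h2
      omega
    simp only [totalTime, hA, Store.set_time]
    generalize addEdgesTime trs = a at *
    generalize encodeTime (bitsBound L) = b at *
    generalize parameterTime t (s, w, ar, c) = e at *
    generalize trs.length = T at *
    generalize ts.length = m at *
    have : (e + 2 * a + b + 320 * T + 300) * (n + m + 1) = e + e * (n + m) + 2 * (n * a) + 2 * (m * a)
      + 2 * a + b * n + m * b + b + 160 * ((2 * n + m) * T) + 160 * (m * T) + 320 * T + 300 * n +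
      300 * m + 300 := by ring
    rw [this]
    have d1 : n * (a + 30) = n * a + 30 * n := by ring
    have d2 : m * (a + b + 30) = m * a + m * b + 30 * m := by ring
    rw [d1] at t₃ t₄
    rw [d2] at t₅
    omega

end

/-! ### Paths in the product -/

/-- The relation of a list of transitions. -/
def Rel (K : List (ℕ × ℕ × ℕ)) (p a q : ℕ) : Prop := (p, a, q) ∈ K

theorem reflTransGen_productEdge {N p p' q q' : ℕ} {K trs : List (ℕ × ℕ × ℕ)}
    (hK : ∀ k ∈ K, k.1 < N ∧ k.2.2 < N) (hp : p < N) (hp' : p' < N) :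
    Relation.ReflTransGen (ProductEdge N K trs) (p + q * N) (p' + q' * N) ↔
      ∃ word, Path (Rel K) word p p' ∧ Path (Rel trs) word q q' := by
  have inj : ∀ {a b c d : ℕ}, a < N → c < N → a + b * N = c + d * N → a = c ∧ b = d := by
    intro a b c d ha hc h
    have h1 := congrArg (· % N) h
    have h2 := congrArg (· / N) h
    simp only [Nat.add_mul_mod_self_right, Nat.mod_eq_of_lt ha, Nat.mod_eq_of_lt hc,
      Nat.add_mul_div_right _ _ (show 0 < N by omega), Nat.div_eq_of_lt ha, Nat.div_eq_of_lt hc,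
      Nat.zero_add] at h1 h2
    exact ⟨h1, h2⟩
  constructor
  · intro h
    obtain ⟨u, hu⟩ : ∃ u, p + q * N = u := ⟨_, rfl⟩
    rw [hu] at h
    induction h using Relation.ReflTransGen.head_induction_on generalizing p q with
    | refl =>
      obtain ⟨rfl, rfl⟩ := inj hp hp' hu
      exact ⟨[], rfl, rfl⟩
    | head he _ ih =>
      obtain ⟨⟨k, a, k'⟩, hk, r, r', hr, h1, rfl⟩ := he
      obtain ⟨hk1, hk2⟩ := hK _ hk
      rw [← hu] at h1
      obtain ⟨rfl, rfl⟩ := inj hp hk1 h1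
      obtain ⟨word, w1, w2⟩ := ih hk2 rfl
      exact ⟨a :: word, ⟨_, hk, w1⟩, _, hr, w2⟩
  · rintro ⟨word, h1, h2⟩
    induction word generalizing p q with
    | nil => obtain rfl := h1; obtain rfl := h2; exact .refl
    | cons a word ih =>
      obtain ⟨r, hr, h1⟩ := h1
      obtain ⟨r', hr', h2⟩ := h2
      exact .head ⟨_, hr, _, _, hr', rfl, rfl⟩ (ih (hK _ hr).2 h1 h2)

/-- The transitions `tr`, with letters shifted by 2, and transitions with letter 0 from `S` to the
states in `I` and with letter 1 from the states in `F` to `S'`. -/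
def bracket (S S' : ℕ) (I : List ℕ) (tr : List (ℕ × ℕ × ℕ)) (F : List ℕ) : List (ℕ × ℕ × ℕ) :=
  I.map (fun p => (S, 0, p)) ++ (F.map (fun p => (p, 1, S')) ++
    tr.map fun t => (t.1, t.2.1 + 2, t.2.2))

section bracket
variable {S S' : ℕ} {I F : List ℕ} {tr : List (ℕ × ℕ × ℕ)}

theorem rel_bracket {p a q : ℕ} : Rel (bracket S S' I tr F) p a q ↔
    (p = S ∧ a = 0 ∧ q ∈ I) ∨ (p ∈ F ∧ a = 1 ∧ q = S') ∨ ∃ b, a = b + 2 ∧ Rel tr p b q := by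
  simp only [Rel, bracket, List.mem_append, List.mem_map, Prod.mk.injEq, Prod.exists]
  refine or_congr ?_ (or_congr ?_ ?_)
  · exact ⟨by rintro ⟨_, h, rfl, rfl, rfl⟩; exact ⟨rfl, rfl, h⟩,
      by rintro ⟨rfl, rfl, h⟩; exact ⟨_, h, rfl, rfl, rfl⟩⟩
  · exact ⟨by rintro ⟨_, h, rfl, rfl, rfl⟩; exact ⟨h, rfl, rfl⟩,
      by rintro ⟨h, rfl, rfl⟩; exact ⟨_, h, rfl, rfl, rfl⟩⟩
  · exact ⟨by rintro ⟨_, b, _, h, rfl, rfl, rfl⟩; exact ⟨b, rfl, h⟩,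
      by rintro ⟨b, rfl, h⟩; exact ⟨_, _, _, h, rfl, rfl, rfl⟩⟩

theorem path_bracket {mid : List ℕ} :
    Path (Rel (bracket S S' I tr F)) (0 :: (mid.map (· + 2) ++ [1])) S S' ↔
      ∃ p ∈ I, ∃ q ∈ F, Path (Rel tr) mid p q := by
  have h2 : ∀ p q, Path (Rel (bracket S S' I tr F)) (mid.map (· + 2)) p q ↔
      Path (Rel tr) mid p q := by
    intro p q
    induction mid generalizing p with
    | nil => rfl
    | cons a mid ih => simp [Path, ih, rel_bracket]
  simp only [Path, path_append, h2, rel_bracket]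
  constructor
  · rintro ⟨p, h, q, hpq, _, h', rfl⟩
    have hp : p ∈ I := by simpa using h
    have hq : q ∈ F := by simpa using h'
    exact ⟨p, hp, q, hq, hpq⟩
  · rintro ⟨p, hp, q, hq, hpq⟩
    exact ⟨p, by simpa using hp, q, hpq, _, by simpa using hq, rfl⟩

/-- If the states `n` and `n + 1` are new, then all words from `n` to `n + 1` begin with 0, end with
1, and have no further letters of this kind. -/
theorem eq_of_path_bracket {n : ℕ} {word : List ℕ} (hI : ∀ p ∈ I, p < n) (hF : ∀ p ∈ F, p < n)
    (htr : ∀ t ∈ tr, t.1 < n ∧ t.2.2 < n)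
    (h : Path (Rel (bracket n (n + 1) I tr F)) word n (n + 1)) :
    ∃ mid : List ℕ, word = 0 :: (mid.map (· + 2) ++ [1]) := by
  have hend : ∀ word, Path (Rel (bracket n (n + 1) I tr F)) word (n + 1) (n + 1) → word = [] := by
    rintro (_ | ⟨a, word⟩) h
    · rfl
    · obtain ⟨r, hr, -⟩ := h
      rw [rel_bracket] at hr
      obtain ⟨h, -⟩ | ⟨h, -⟩ | ⟨b, -, h⟩ := hr
      · omega
      · have := hF _ h; omega
      · have := (htr _ h).1; simp at this
  have hmid : ∀ word, ∀ p < n, Path (Rel (bracket n (n + 1) I tr F)) word p (n + 1) →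
      ∃ mid : List ℕ, word = mid.map (· + 2) ++ [1] := by
    intro word
    induction word with
    | nil => intro p hp h; simp only [Path] at h; omega
    | cons a word ih =>
      rintro p hp ⟨r, hr, h⟩
      rw [rel_bracket] at hr
      obtain ⟨h', -⟩ | ⟨-, rfl, rfl⟩ | ⟨b, rfl, h'⟩ := hr
      · omega
      · exact ⟨[], by simp [hend _ h]⟩
      · obtain ⟨mid, rfl⟩ := ih r (htr _ h').2 h
        exact ⟨b :: mid, by simp⟩
  match word, h with
  | [], h => simp only [Path] at h; omega
  | a :: word, ⟨r, hr, h⟩ =>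
    rw [rel_bracket] at hr
    obtain ⟨-, rfl, h'⟩ | ⟨h', -⟩ | ⟨b, -, h'⟩ := hr
    · obtain ⟨mid, rfl⟩ := hmid _ r (hI _ h') h
      exact ⟨mid, rfl⟩
    · have := hF _ h'; omega
    · have := (htr _ h').1; simp at this

end bracket

/-! ### The meaning of the compiled automaton -/

section Meaning
variable {s w : ℕ} {τ : Vocabulary}

/-- The automaton of a sentence accepts a string of symbols of the layer alphabet iff the derived
structure is nonempty and satisfies the sentence. -/
theorem accepts_codeAut (φ : τ.language.Sentence) (z : List (LayerAlphabet (Fin s) w τ)) :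
    (∃ W : List Letter, W.map Prod.fst = z.map symbolCode ∧
        (codeAut s w τ.code (sentenceCode φ)).Accepts W) ↔
      Nonempty (tupleOfString z).Domain ∧
        FirstOrder.Language.Sentence.Realize (tupleOfString z).Domain φ := by
  have hcode : codeAut s w τ.code (sentenceCode φ) =
      (formulaAut s w (n := 0) φ).inter ((domAut s w τ.code 1).relabel forget) := by
    rw [codeAut, parse_sentenceCode]
    simp only [foldl_evalToken, List.getD_cons_zero]
  have hreal : (formulaAut s w (n := 0) φ).Accepts (inputWord z []) ↔
      FirstOrder.Language.Sentence.Realize (tupleOfString z).Domain φ := by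
    have := accepts_formulaAut z φ (default : Empty → (tupleOfString z).Domain) default
    exact this
  have hdom : ∀ W : List Letter, W.map Prod.fst = z.map symbolCode →
      (((domAut s w τ.code 1).relabel forget).Accepts W ↔
        W = inputWord z [] ∧ Nonempty (tupleOfString z).Domain) := by
    intro W hW
    rw [ListAut.accepts_relabel]
    constructor
    · rintro ⟨W', rfl, h⟩
      have hW' : W'.map Prod.fst = z.map symbolCode := by
        rw [← hW, List.map_map]; rfl
      have hlen : W'.length = z.length := by simpa using congrArg List.length hW'
      have hget : ∀ i (h : i < z.length), (W'[i]).1 = symbolCode z[i] := by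
        intro i h
        have := congrArg (fun l => l[i]?) hW'
        simpa [h, hlen] using this
      have hr : W' = (List.range z.length).map fun i => W'.getD i ([], []) := by
        refine List.ext_getElem (by simp [hlen]) fun i h1 h2 => ?_
        simp [h1]
      rw [hr, accepts_domAut (fun i h => by simp [hlen, h, hget])] at h
      obtain ⟨hal, u, hu, -⟩ := h
      refine ⟨List.ext_getElem (by simp [inputWord, hlen]) fun i h1 h2 => ?_, ⟨⟨u, hu⟩⟩⟩
      have hi : i < z.length := by simpa [hlen] using h1
      have h3 := (mem_alph.1 (hal i hi)).2.1
      have h4 : (W'[i]).2.length = 1 := by simpa [hlen, hi] using h3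
      have h5 : (W'[i]).2.tail = [] := by rw [← List.length_eq_zero_iff]; simp [h4]
      simp [forget, inputWord, hget i hi, h5, hi]
    · rintro ⟨rfl, ⟨u, hu⟩⟩
      refine ⟨inputWord z [u], by simp [inputWord, forget], ?_⟩
      rw [inputWord, accepts_domAut (fun i h => by simp [h])]
      refine ⟨fun i hi => ?_, u, hu, fun i hi => by simp⟩
      refine mem_alph_of_mem_inputWord (z := z) (env := [u]) ?_
      exact List.mem_map.2 ⟨i, List.mem_range.2 hi, rfl⟩
  have hfst : (inputWord z []).map Prod.fst = z.map symbolCode := by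
    refine List.ext_getElem (by simp [inputWord]) fun i h1 h2 => ?_
    have hi : i < z.length := by simpa using h2
    simp [inputWord, hi]
  simp only [hcode, ListAut.accepts_inter]
  constructor
  · rintro ⟨W, hW, h1, h2⟩
    obtain ⟨rfl, hne⟩ := (hdom W hW).1 h2
    exact ⟨hne, hreal.1 h1⟩
  · rintro ⟨hne, h⟩
    exact ⟨_, hfst, hreal.2 h, (hdom _ hfst).2 ⟨rfl, hne⟩⟩

theorem mem_accepts_iff {Γ : Type} {n : ℕ} (A : FinAut Γ n) (z : List Γ) :
    z ∈ A.toNFA.accepts ↔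
      ∃ p ∈ A.init, ∃ q ∈ A.final, Path (fun p a q => (p, a, q) ∈ A.trans) z p q := by
  have h : ∀ (S : Set (Fin n)), z ∈ A.toNFA.acceptsFrom S ↔
      ∃ p ∈ S, ∃ q ∈ A.final, Path (fun p a q => (p, a, q) ∈ A.trans) z p q := by
    induction z with
    | nil =>
      intro S
      rw [NFA.nil_mem_acceptsFrom]
      simp [Path, FinAut.toNFA]
    | cons a z ih =>
      intro S
      rw [NFA.cons_mem_acceptsFrom, ih]
      simp only [NFA.mem_stepSet, Path]
      constructor
      · rintro ⟨r, ⟨p, hp, hr⟩, q, hq, h⟩; exact ⟨p, hp, q, hq, r, hr, h⟩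
      · rintro ⟨p, hp, q, hq, r, hr, h⟩; exact ⟨r, ⟨p, hp, hr⟩, q, hq, h⟩
  rw [NFA.accepts_eq_acceptsFrom_start]
  exact h _

/-- The flags of the states in a set. -/
def flags {n : ℕ} (S : Finset (Fin n)) : List ℕ :=
  (List.finRange n).map fun p => if p ∈ S then 1 else 0

theorem mem_filter_flags {n : ℕ} {S : Finset (Fin n)} {x : ℕ} :
    x ∈ (List.range n).filter (fun p => (flags S).getD p 0 ≠ 0) ↔ ∃ p ∈ S, (p : ℕ) = x := by
  simp only [List.mem_filter, List.mem_range, flags]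
  constructor
  · rintro ⟨hx, h⟩
    exact ⟨⟨x, hx⟩, by simpa [hx] using h, rfl⟩
  · rintro ⟨p, hp, rfl⟩
    simp [hp]

/-- The numerical form of a list of transitions. -/
def codedTrans {n : ℕ} (l : List (Fin n × LayerAlphabet (Fin s) w τ × Fin n)) :
    List (ℕ × List ℕ × ℕ) :=
  l.map fun t => ((t.1 : ℕ), symbolCode t.2.1, (t.2.2 : ℕ))

theorem path_codedTrans {n : ℕ} {A : FinAut (LayerAlphabet (Fin s) w τ) n}
    {l : List (Fin n × LayerAlphabet (Fin s) w τ × Fin n)} (hl : ∀ t, t ∈ l ↔ t ∈ A.trans)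
    {mid : List ℕ} {p q : Fin n} :
    Path (Rel ((codedTrans l).map fun t => (t.1, Encodable.encode t.2.1, t.2.2))) mid p q ↔
      ∃ z, z.map (fun a => Encodable.encode (symbolCode a)) = mid ∧
        Path (fun p a q => (p, a, q) ∈ A.trans) z p q := by
  rw [path_embed (T := fun p b q => ∃ a, Encodable.encode (symbolCode a) = b ∧ (p, a, q) ∈ A.trans)
    (fun p : Fin n => (p : ℕ)) fun p a y => ?_]
  · simp only [← path_relabel (T := fun p a q => (p, a, q) ∈ A.trans)
      (T' := fun p b q => ∃ a, Encodable.encode (symbolCode a) = b ∧ (p, a, q) ∈ A.trans)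
      (fun a => Encodable.encode (symbolCode a)) (fun _ _ _ => Iff.rfl)]
    constructor
    · rintro ⟨q', h, hp⟩
      obtain rfl := Fin.ext h
      exact hp
    · exact fun h => ⟨q, rfl, h⟩
  · simp only [Rel, codedTrans, List.map_map, List.mem_map, hl, Function.comp, Prod.mk.injEq]
    constructor
    · rintro ⟨⟨p', a, q⟩, h, h1, rfl, rfl⟩
      obtain rfl := Fin.ext h1
      exact ⟨q, rfl, a, rfl, h⟩
    · rintro ⟨q, rfl, a, rfl, h⟩
      exact ⟨(p, a, q), h, rfl, rfl, rfl⟩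

theorem path_codeAut {A : ListAut Letter} {z : List (LayerAlphabet (Fin s) w τ)} {p q : ℕ} :
    Path (Rel (A.2.1.map fun t => (t.1, Encodable.encode t.2.1.1, t.2.2)))
      (z.map fun a => Encodable.encode (symbolCode a)) p q ↔
      ∃ W : List Letter, W.map Prod.fst = z.map symbolCode ∧ Path A.Tr W p q := by
  rw [path_relabel (T := A.Tr) (fun a : Letter => Encodable.encode a.1)]
  · refine exists_congr fun W => and_congr_left fun _ => ?_
    constructor
    · intro h
      refine List.map_injective_iff.2 (Encodable.encode_injective (α := List ℕ)) ?_
      simpa [Function.comp_def] using h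
    · intro h
      simpa [Function.comp_def] using congrArg (List.map Encodable.encode) h
  · intro p b q
    simp only [Rel, List.mem_map, Prod.mk.injEq, ListAut.Tr]
    constructor
    · rintro ⟨t, h, rfl, rfl, rfl⟩; exact ⟨_, rfl, h⟩
    · rintro ⟨a, rfl, h⟩; exact ⟨_, h, rfl, rfl, rfl⟩

/-- The question that the search answers: the product of the given automaton and that of the
sentence has an accepting path iff some string of the given automaton derives a nonempty structure
that satisfies the sentence. -/
theorem reflTransGen_iff_exists_realize {n : ℕ} {A : FinAut (LayerAlphabet (Fin s) w τ) n}
    {l : List (Fin n × LayerAlphabet (Fin s) w τ × Fin n)} (hl : ∀ t, t ∈ l ↔ t ∈ A.trans)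
    (φ : τ.language.Sentence) :
    Relation.ReflTransGen (ProductEdge (n + 2)
        (tasks n (flags A.init) (flags A.final) (codedTrans l))
        (compiledAut (s, w, τ.code, sentenceCode φ)).2) n (n + 1) ↔
      ∃ z ∈ A.lang, Nonempty (tupleOfString z).Domain ∧
        FirstOrder.Language.Sentence.Realize (tupleOfString z).Domain φ := by
  obtain ⟨B, hB⟩ : ∃ B, codeAut s w τ.code (sentenceCode φ) = B := ⟨_, rfl⟩
  have hK : tasks n (flags A.init) (flags A.final) (codedTrans l) =
      bracket n (n + 1) ((List.range n).filter (fun p => (flags A.init).getD p 0 ≠ 0))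
        ((codedTrans l).map fun t => (t.1, Encodable.encode t.2.1, t.2.2))
        ((List.range n).filter (fun p => (flags A.final).getD p 0 ≠ 0)) := by
    simp [tasks, bracket, Function.comp_def]
  have hT : (compiledAut (s, w, τ.code, sentenceCode φ)).2 =
      bracket 0 0 B.1 (B.2.1.map fun t => (t.1, Encodable.encode t.2.1.1, t.2.2)) B.2.2 := by
    simp [compiledAut, bracket, Function.comp_def, hB]
  have hI : ∀ p ∈ (List.range n).filter (fun p => (flags A.init).getD p 0 ≠ 0), p < n :=
    fun p hp => List.mem_range.1 (List.mem_filter.1 hp).1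
  have hF : ∀ p ∈ (List.range n).filter (fun p => (flags A.final).getD p 0 ≠ 0), p < n :=
    fun p hp => List.mem_range.1 (List.mem_filter.1 hp).1
  have htr : ∀ t ∈ (codedTrans l).map fun t => (t.1, Encodable.encode t.2.1, t.2.2),
      t.1 < n ∧ t.2.2 < n := by
    intro t ht
    simp only [codedTrans, List.map_map, List.mem_map] at ht
    obtain ⟨t, -, rfl⟩ := ht
    exact ⟨t.1.2, t.2.2.2⟩
  have hstates : ∀ k ∈ tasks n (flags A.init) (flags A.final) (codedTrans l),
      k.1 < n + 2 ∧ k.2.2 < n + 2 := by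
    rintro ⟨p, a, q⟩ hk
    rw [hK] at hk
    obtain ⟨rfl, -, h⟩ | ⟨h, -, rfl⟩ | ⟨b, -, h⟩ := rel_bracket.1 hk
    · have := hI _ h; exact ⟨by simp, by simp only; omega⟩
    · have := hF _ h; exact ⟨by simp only; omega, by simp⟩
    · have := htr _ h; constructor <;> simp at this ⊢ <;> omega
  have hprod := reflTransGen_productEdge (p := n) (p' := n + 1) (q := 0) (q' := 0) hstates
    (trs := (compiledAut (s, w, τ.code, sentenceCode φ)).2) (by omega) (by omega)
  simp only [Nat.zero_mul, Nat.add_zero] at hprod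
  rw [hprod, hK, hT]
  have hsem := accepts_codeAut (s := s) (w := w) φ
  simp only [hB] at hsem
  constructor
  · rintro ⟨word, h1, h2⟩
    obtain ⟨mid, rfl⟩ := eq_of_path_bracket hI hF htr h1
    rw [path_bracket] at h1 h2
    obtain ⟨p, hp, q, hq, h1⟩ := h1
    obtain ⟨b, hb, b', hb', h2⟩ := h2
    obtain ⟨p, hpA, rfl⟩ := mem_filter_flags.1 hp
    obtain ⟨q, hqA, rfl⟩ := mem_filter_flags.1 hq
    obtain ⟨z, rfl, hpath⟩ := (path_codedTrans hl).1 h1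
    obtain ⟨W, hW, h2⟩ := path_codeAut.1 h2
    have hz := (hsem z).1 ⟨W, hW, b, hb, b', hb', h2⟩
    refine ⟨z, ⟨?_, (mem_accepts_iff A z).2 ⟨p, hpA, q, hqA, hpath⟩⟩, hz⟩
    -- The domain that is derived from the empty string is empty.
    rintro rfl
    obtain ⟨u, h, h', -⟩ := hz.1
    exact h (List.length_eq_zero_iff.1 (by simpa [tupleOfString] using h'))
  · rintro ⟨z, ⟨-, hz⟩, h⟩
    obtain ⟨p, hp, q, hq, h1⟩ := (mem_accepts_iff A z).1 hz
    obtain ⟨W, hW, b, hb, b', hb', h2⟩ := (hsem z).2 h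
    refine ⟨0 :: ((z.map fun a => Encodable.encode (symbolCode a)).map (· + 2) ++ [1]), ?_, ?_⟩
    · rw [path_bracket]
      exact ⟨p, mem_filter_flags.2 ⟨p, hp, rfl⟩, q, mem_filter_flags.2 ⟨q, hq, rfl⟩,
        (path_codedTrans hl).2 ⟨z, rfl, h1⟩⟩
    · rw [path_bracket]
      exact ⟨b, hb, b', hb', path_codeAut.2 ⟨W, hW, h2⟩⟩

theorem finite_oddLang {α : Type} [Finite α] {w : ℕ} (D : List (Layer α w)) : (oddLang D).Finite :=
  (List.finite_length_le α D.length).subset fun _ h => h.2.1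

theorem exists_classOf_realize (R : Set (DiagramTuple (Fin s) w τ)) (φ : τ.language.Sentence) :
    (∃ S ∈ classOf R, FirstOrder.Language.Sentence.Realize S φ) ↔
      ∃ T ∈ R, Nonempty T.Domain ∧ FirstOrder.Language.Sentence.Realize T.Domain φ := by
  constructor
  · rintro ⟨S, ⟨-, hne, T, hT, ⟨e⟩⟩, h⟩
    exact ⟨T, hT, hne.map e.symm, (FirstOrder.Language.StrongHomClass.realize_sentence e φ).2 h⟩
  · rintro ⟨T, hT, hne, h⟩
    exact ⟨⟨T.Domain, inferInstance⟩, ⟨(finite_oddLang T.dom).to_subtype, hne, T, hT,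
      ⟨FirstOrder.Language.Equiv.refl _ _⟩⟩, h⟩

end Meaning

/-! ### Time bounds -/

section Primrec
open Primrec

theorem primrec_bitsBound : Primrec bitsBound :=
  (Primrec.nat_rec₁ 0 (.mk (Primrec.succ.comp (Primrec₂.natPair.comp (.const 1) snd))))

theorem primrec_totalTime {t : ℕ → ℕ} (ht : Primrec t) : Primrec (totalTime t) := by
  have hx : Primrec fun x : ℕ × ℕ × List ℕ × List ℕ => Encodable.encode x := Primrec.encode
  have hy : Primrec fun x => Encodable.encode (compiledAut x) :=
    Primrec.encode.comp primrec_compiledAut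
  have hy2 : Primrec fun x => Encodable.encode (compiledAut x).2 :=
    Primrec.encode.comp (snd.comp primrec_compiledAut)
  have hlen : Primrec fun x => (compiledAut x).2.length :=
    list_length.comp (snd.comp primrec_compiledAut)
  have he : Primrec encodeTime := nat_add.comp (nat_mul.comp Primrec.id (nat_add.comp
    (nat_mul.comp (.const 4) Primrec.id) (.const 30))) (.const 10)
  have hp : Primrec (parameterTime t) := nat_add.comp (nat_add.comp (nat_add.comp (nat_add.comp
    (nat_mul.comp (.const 2) (he.comp hx)) (nat_mul.comp (.const 12) hx)) (ht.comp hx))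
    (nat_mul.comp (.const 8) hy)) (.const 100)
  have ha : Primrec fun x => addEdgesTime (compiledAut x).2 := nat_add.comp (nat_mul.comp hlen
    (nat_add.comp (nat_mul.comp (.const 40) hy2) (.const 200))) (.const 3)
  exact nat_add.comp (nat_add.comp (nat_add.comp (nat_add.comp hp (nat_mul.comp (.const 2) ha))
    (he.comp (primrec_bitsBound.comp (fst.comp primrec_compiledAut))))
    (nat_mul.comp (.const 320) hlen)) (.const 300)

end Primrec

instance {α : Type} [Finite α] {w : ℕ} : Finite (Layer α w) := by
  refine Finite.of_injective (fun B : Layer α w =>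
    (B.left, B.right, B.trans, B.init, B.final, B.initFlag, B.finalFlag)) ?_
  rintro ⟨⟩ ⟨⟩ h
  simpa using h

/-- A layer without states. -/
def emptyLayer (α : Type) (w : ℕ) (b : Bool) : Layer α w where
  left := ∅
  right := ∅
  trans := ∅
  init := ∅
  final := ∅
  initFlag := b
  finalFlag := false
  trans_left := by simp
  trans_right := by simp
  init_subset := by simp
  final_subset := by simp
  init_empty := by simp
  final_empty := by simp

theorem two_le_card_layerAlphabet (s w : ℕ) (τ : Vocabulary) :
    2 ≤ Nat.card (LayerAlphabet (Fin s) w τ) := by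
  have : Nontrivial (LayerAlphabet (Fin s) w τ) :=
    ⟨(emptyLayer _ _ true, fun _ => emptyLayer _ _ true),
      (emptyLayer _ _ false, fun _ => emptyLayer _ _ true), fun h => by
        simpa [emptyLayer] using congrArg (fun a => a.1.initFlag) h⟩
  exact Finite.one_lt_card

/-- The size of an automaton bounds the length of its description: since there are at least two
letters, each transition contributes at least 1. -/
theorem add_length_le_size {s w n : ℕ} {τ : Vocabulary} {A : FinAut (LayerAlphabet (Fin s) w τ) n}
    {l : List (Fin n × LayerAlphabet (Fin s) w τ × Fin n)} (hd : l.Nodup)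
    (hl : ∀ t, t ∈ l ↔ t ∈ A.trans) : ((n + l.length : ℕ) : ℝ) ≤ A.size := by
  have hcard : l.length = A.trans.card := by
    classical
    rw [← List.toFinset_card_of_nodup hd]
    congr 1
    ext t
    simp [hl]
  have hlog : 1 ≤ Real.logb 2 (Nat.card (LayerAlphabet (Fin s) w τ)) := by
    rw [Real.le_logb_iff_rpow_le (by norm_num)
      (by exact_mod_cast lt_of_lt_of_le Nat.zero_lt_two (two_le_card_layerAlphabet s w τ)),
      Real.rpow_one]
    exact_mod_cast two_le_card_layerAlphabet s w τ
  rw [FinAut.size, hcard]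
  push_cast
  have : (0 : ℝ) ≤ A.trans.card := Nat.cast_nonneg _
  nlinarith

/-! ### Correctness of the machine -/

/-- A command, followed by an instruction that moves its register `5` (machine register `8`) to the
machine register `0`, as a program for the machine. -/
def Cmd.toProgram (c : Cmd) : Program := c.compile 0 ++ [.add 0 8 1]

/-- A total correctness statement for a command, started with empty arrays and registers, is a
statement on the halting computation of its program. -/
theorem Cmd.toProgram_halts {c : Cmd} {x : List ℕ} {Q : Store → Prop}
    (h : wp (fun i => x[i]?.getD 0) x.length c Q ⟨fun _ => 0, fun _ _ => 0, 0⟩) :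
    ∃ k σ', Q σ' ∧ k = σ'.time + 1 ∧
      c.toProgram.length ≤ ((c.toProgram.step)^[k] (initialState x)).pc ∧
      ((c.toProgram.step)^[k] (initialState x)).reg 0 = σ'.reg 5 := by
  obtain ⟨σ', he, hQ⟩ := h
  have hcode : CodeAt c.toProgram 0 (c.compile 0 ++ [.add 0 8 1]) := fun i _ => by
    rw [Nat.zero_add]; rfl
  rw [codeAt_append, codeAt_cons, Cmd.length_compile] at hcode
  obtain ⟨k, m', ht, hk, hS⟩ := he.sim (P := c.toProgram) (o := 0) (m := initialState x)
    ⟨rfl, rfl, fun _ => rfl, fun _ _ => rfl, fun j _ i => by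
      simp only [initialState]
      rw [List.getElem?_eq_none (by omega)]; rfl⟩ hcode.1
  refine ⟨k + 1, σ', hQ, by simp at ht; omega, ?_⟩
  rw [Function.iterate_succ_apply', hk, step_of_codeAt (by rw [hS.pc]; exact hcode.2.1)]
  refine ⟨?_, ?_⟩
  · simp [Instr.exec, hS.pc, Cmd.toProgram]
  · simpa [Instr.exec, hS.zero] using hS.reg 5

theorem inputAt_self (x : List ℕ) : InputAt (fun i => x[i]?.getD 0) x.length 0 x :=
  ⟨by simp, fun i hi => by simp [hi]⟩

/-- The machine decides in linear time whether a sentence is satisfied in a regular-decisional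
class; alphabet and width may even be empty. -/
theorem exists_program :
    ∃ (P : Program) (f : ℕ × ℕ × List ℕ × List ℕ → ℕ), Computable f ∧
      ∀ (s w : ℕ) (τ : Vocabulary) (φ : τ.language.Sentence)
        (n : ℕ) (A : FinAut (LayerAlphabet (Fin s) w τ) n)
        (l : List (Fin n × LayerAlphabet (Fin s) w τ × Fin n)),
        l.Nodup → (∀ t, t ∈ l ↔ t ∈ A.trans) →
        ∀ C : Set (CategoryTheory.Bundled.{0} τ.language.Structure), Represents A C →
          P.DecidesInTime (parameterInput s w τ φ ++ automatonInput A l)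
            (f (s, w, τ.code, sentenceCode φ) * max 1 A.size)
            (∃ S ∈ C, FirstOrder.Language.Sentence.Realize S φ) := by
  obtain ⟨t, ht, hR⟩ := exists_realizesIn natPrimrec_compiledCode
  obtain ⟨d, hd⟩ := hR 20
  refine ⟨(Cmd.decideRealized d).toProgram, fun x => 2 * (totalTime t x + 1),
    (Primrec.nat_mul.comp (.const 2) (Primrec.succ.comp (primrec_totalTime ht))).to_comp, ?_⟩
  rintro s w τ φ n A l hnd hl C ⟨-, rfl⟩
  have hinput : parameterInput s w τ φ ++ automatonInput A l =
      (s :: w :: τ.code.length :: (τ.code ++ (sentenceCode φ).length :: sentenceCode φ)) ++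
      (n :: (codedTrans l).length :: (flags A.init ++ flags A.final ++
        transInput (codedTrans l))) := by
    simp [parameterInput, automatonInput, flags, transInput, codedTrans, Vocabulary.code,
      List.flatMap_map]
  rw [hinput]
  obtain ⟨x, hx⟩ : ∃ x, x = (s :: w :: τ.code.length :: (τ.code ++ (sentenceCode φ).length :: sentenceCode φ)) ++
      (n :: (codedTrans l).length :: (flags A.init ++ flags A.final ++
        transInput (codedTrans l))) := ⟨_, rfl⟩
  rw [← hx]
  have hts : ∀ t ∈ codedTrans l, t.2.1.length =
      (compiledAut (s, w, τ.code, sentenceCode φ)).1 ∧ ∀ b ∈ t.2.1, b = 0 ∨ b = 1 := by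
    intro t ht
    obtain ⟨t, -, rfl⟩ := List.mem_map.1 ht
    exact ⟨length_symbolCode _, fun b => symbolCode_zero_or_one _⟩
  obtain ⟨k, σ', ⟨hyes, hno, htime⟩, hk, hpc, hreg⟩ := Cmd.toProgram_halts
    (wp_decideRealized (inp := fun i => x[i]?.getD 0) (base := x.length)
      (σ := ⟨fun _ => 0, fun _ _ => 0, 0⟩)
      (Q := fun σ' => (Relation.ReflTransGen (ProductEdge (n + 2)
        (tasks n (flags A.init) (flags A.final) (codedTrans l))
        (compiledAut (s, w, τ.code, sentenceCode φ)).2) n (n + 1) → σ'.reg 5 = 1) ∧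
        (¬ Relation.ReflTransGen (ProductEdge (n + 2)
        (tasks n (flags A.init) (flags A.final) (codedTrans l))
        (compiledAut (s, w, τ.code, sentenceCode φ)).2) n (n + 1) → σ'.reg 5 = 0) ∧
        σ'.time ≤ 0 + totalTime t (s, w, τ.code, sentenceCode φ) * (n + (codedTrans l).length + 1))
      hd (n := n) (by simp [flags]) (by simp [flags]) hts (hx ▸ inputAt_self x)
      (congrArg List.length hx)
      (fun _ _ => rfl) fun σ' h1 h2 h3 => ⟨h1, h2, h3⟩)
  have hgoal : (∃ S ∈ classOf (tupleOfString '' A.lang),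
      FirstOrder.Language.Sentence.Realize S φ) ↔ Relation.ReflTransGen (ProductEdge (n + 2)
        (tasks n (flags A.init) (flags A.final) (codedTrans l))
        (compiledAut (s, w, τ.code, sentenceCode φ)).2) n (n + 1) := by
    rw [exists_classOf_realize, reflTransGen_iff_exists_realize hl, Set.exists_mem_image]
  refine ⟨k, ?_, hpc, fun h => hreg.trans (hyes (hgoal.1 h)),
    fun h => hreg.trans (hno fun h' => h (hgoal.2 h'))⟩
  have hsize := add_length_le_size hnd hl
  have h1 : k ≤ (totalTime t (s, w, τ.code, sentenceCode φ) + 1) * (n + l.length + 1) := by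
    simp only [codedTrans, List.length_map] at htime
    rw [Nat.add_mul, one_mul]
    omega
  have h2 : ((n + l.length + 1 : ℕ) : ℝ) ≤ 2 * max 1 A.size := by
    push_cast at hsize ⊢
    have := le_max_left 1 A.size
    have := le_max_right 1 A.size
    linarith
  change (k : ℝ) ≤ ((2 * (totalTime t (s, w, τ.code, sentenceCode φ) + 1) : ℕ) : ℝ) * max 1 A.size
  generalize totalTime t (s, w, τ.code, sentenceCode φ) = T at h1
  calc (k : ℝ) ≤ ((T + 1 : ℕ) : ℝ) * ((n + l.length + 1 : ℕ) : ℝ) := by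
        rw [← Nat.cast_mul]; exact Nat.cast_le.2 h1
    _ ≤ ((T + 1 : ℕ) : ℝ) * (2 * max 1 A.size) := by gcongr
    _ = _ := by push_cast; ring

/-! ### Decidability of the theory -/

theorem iterate_step_of_halted {P : Program} {m : MachineState} (h : P.length ≤ m.pc) (k : ℕ) :
    (P.step)^[k] m = m := by
  have : P.step m = m := by simp [Program.step, List.getElem?_eq_none h]
  exact Function.iterate_fixed this k

/-- The answer can be read at any time after the time bound, as the machine rests. -/
theorem Program.DecidesInTime.reg_eq {P : Program} {x : List ℕ} {t : ℝ} {p : Prop}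
    (h : P.DecidesInTime x t p) {k : ℕ} (hk : t ≤ k) :
    p ↔ ((P.step)^[k] (initialState x)).reg 0 = 1 := by
  obtain ⟨k', hk', hpc, h1, h0⟩ := h
  obtain ⟨j, rfl⟩ := Nat.exists_eq_add_of_le (show k' ≤ k by exact_mod_cast hk'.trans hk)
  rw [Nat.add_comm, Function.iterate_add_apply, iterate_step_of_halted hpc]
  refine ⟨h1, fun h => ?_⟩
  by_contra hp
  rw [h0 hp] at h
  exact absurd h (by omega)

/-- The theory of a regular-decisional class is decidable: run the program on the code of a
sentence, with a fixed automaton for the class, for as many steps as its time bound allows. -/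
theorem computablePred_exists_realize {s w : ℕ} {τ : Vocabulary}
    {C : Set (CategoryTheory.Bundled.{0} τ.language.Structure)}
    (hC : IsRegularDecisional (Fin s) w C) :
    ComputablePred fun c : List ℕ => ∃ φ : τ.language.Sentence,
      sentenceCode φ = c ∧ ∃ S ∈ C, FirstOrder.Language.Sentence.Realize S φ := by
  obtain ⟨P, f, hf, hP⟩ := exists_program
  obtain ⟨n, A, hA⟩ := hC
  have hd := hP s w τ
  obtain ⟨N, hN⟩ := exists_nat_ge (max 1 A.size)
  have hrun : ∀ φ : τ.language.Sentence, (∃ S ∈ C, FirstOrder.Language.Sentence.Realize S φ) ↔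
      ((P.step)^[f (s, w, τ.code, sentenceCode φ) * N] (initialState
        ((s :: w :: τ.num :: (τ.code ++ (sentenceCode φ).length :: sentenceCode φ)) ++
          automatonInput A A.trans.toList))).reg 0 = 1 := fun φ =>
    (hd φ n A A.trans.toList A.trans.nodup_toList (fun _ => Finset.mem_toList) C hA).reg_eq (by
      push_cast
      gcongr)
  have hiff : ∀ c : List ℕ, (∃ φ : τ.language.Sentence,
      sentenceCode φ = c ∧ ∃ S ∈ C, FirstOrder.Language.Sentence.Realize S φ) ↔
      (((parse τ.code c).1 = [] ∧ (parse τ.code c).2.1 = []) ∧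
      ((P.step)^[f (s, w, τ.code, c) * N] (initialState
        ((s :: w :: τ.num :: (τ.code ++ c.length :: c)) ++
          automatonInput A A.trans.toList))).reg 0 = 1) := by
    intro c
    rw [← exists_sentenceCode_iff]
    constructor
    · rintro ⟨φ, rfl, h⟩
      exact ⟨⟨φ, rfl⟩, (hrun φ).1 h⟩
    · rintro ⟨⟨φ, rfl⟩, h⟩
      exact ⟨φ, rfl, (hrun φ).2 h⟩
  have hparse : Primrec fun c : List ℕ => parse τ.code c :=
    primrec_parse (.const _) Primrec.id
  have h1 : Primrec fun c : List ℕ =>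
      decide ((parse τ.code c).1 = [] ∧ (parse τ.code c).2.1 = []) :=
    PrimrecPred.decide ((Primrec.eq.comp (Primrec.fst.comp hparse) (.const [])).and
      (Primrec.eq.comp (Primrec.fst.comp (Primrec.snd.comp hparse)) (.const [])))
  have hinput : Primrec fun c : List ℕ => (s :: w :: τ.num :: (τ.code ++ c.length :: c)) ++
      automatonInput A A.trans.toList :=
    Primrec.list_append.comp (Primrec.list_cons.comp (.const s) (Primrec.list_cons.comp (.const w)
      (Primrec.list_cons.comp (.const _) (Primrec.list_append.comp (.const _)
        (Primrec.list_cons.comp Primrec.list_length Primrec.id))))) (.const _)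
  have hsteps : Computable fun c : List ℕ => f (s, w, τ.code, c) * N :=
    Primrec.nat_mul.to_comp.comp (hf.comp (.pair (.const s) (.pair (.const w)
      (.pair (.const _) .id)))) (.const N)
  have h2 : Computable fun c : List ℕ =>
      decide (((P.step)^[f (s, w, τ.code, c) * N] (initialState
        ((s :: w :: τ.num :: (τ.code ++ c.length :: c)) ++
          automatonInput A A.trans.toList))).reg 0 = 1) :=
    (PrimrecPred.decide (Primrec.eq.comp Primrec.id (.const 1))).to_comp.comp
      ((primrec_run P).to_comp.comp hinput.to_comp hsteps)
  classical
  refine ⟨inferInstance, (Primrec.and.to_comp.comp h1.to_comp h2).of_eq fun c => ?_⟩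
  rw [← Bool.decide_and]
  exact decide_eq_decide.2 (hiff c).symm

end Decisional

theorem theorem2 :
    (∃ (P : Program) (f : ℕ × ℕ × List ℕ × List ℕ → ℕ), Computable f ∧
      ∀ (s w : ℕ), 0 < s → 0 < w → ∀ (τ : Vocabulary) (φ : τ.language.Sentence)
        (n : ℕ) (A : FinAut (LayerAlphabet (Fin s) w τ) n)
        (l : List (Fin n × LayerAlphabet (Fin s) w τ × Fin n)),
        l.Nodup → (∀ t, t ∈ l ↔ t ∈ A.trans) →
        ∀ C : Set (CategoryTheory.Bundled.{0} τ.language.Structure), Represents A C →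
          P.DecidesInTime (parameterInput s w τ φ ++ automatonInput A l)
            (f (s, w, τ.code, sentenceCode φ) * max 1 A.size)
            (∃ S ∈ C, FirstOrder.Language.Sentence.Realize S φ)) ∧
    ∀ (s w : ℕ), 0 < s → 0 < w → ∀ (τ : Vocabulary)
      (C : Set (CategoryTheory.Bundled.{0} τ.language.Structure)),
      IsRegularDecisional (Fin s) w C →
        ComputablePred fun c : List ℕ => ∃ φ : τ.language.Sentence,
          sentenceCode φ = c ∧ ∃ S ∈ C, FirstOrder.Language.Sentence.Realize S φ := by
  obtain ⟨P, f, hf, hP⟩ := exists_program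
  exact ⟨⟨P, f, hf, fun s w _ _ => hP s w⟩, fun _ _ _ _ _ _ => computablePred_exists_realize⟩
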